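/- Let $n\ge 0$, let $x_0,\dots,x_n$ be the homogeneous coordinates on $\mathbb P^n=\mathbb P^n_{\mathbb C}$, and for $\emptyset\ne I\subseteq\{0,\dots,n\}$ let $P_I=\bigcap_{i\in I}P_i=\operatorname{Spec}\mathbb C[x_0,\dots,x_n,x_i^{-1}:i\in I]_0$ be the affine open set where $x_i\neq 0$ for all $i\in I$. Let $C^\bullet$ be the algebraic Čech–de Rham complex of $\mathbb P^n$ for the cover by the standard charts $P_0,\dots,P_n$, that is, the total complex of the double complex $\bigoplus_{|I|=p+1}\Omega^q(P_I)$ of algebraic (Kähler) differential forms, with differential $\delta+(-1)^p d$, where $\delta$ is the alternating Čech differential and $d$ the exterior derivative. For nonempty $I$ with $i_0=\min I$ let $T_I^\bullet\subseteq\Omega^\bullet(P_I)$ be the complex with zero differential and terms $$T_I^q=\bigoplus_{i_0\in J\subseteq I,\ |J|=q+1}\mathbb C\cdot\prod_{i_0<i\in J}\frac{d(x_i/x_{i_0})}{x_i/x_{i_0}}$$ (products in increasing order of $i$; the displayed forms are linearly independent). Then: 1. $H^m(C^\bullet)$ is one-dimensional for $m=2k$ with $0\le k\le n$, and zero for every other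 $m$. 2. The families with components in the $T_I^\bullet$ form a subcomplex of $C^\bullet$, the total complex of the torus complexes $T_I^\bullet$, and its inclusion in $C^\bullet$ is a quasi-isomorphism. 3. For $0\le k\le n$ the family of $k$-forms $$c_k=\sum_{I=\{i_0<\dots<i_k\}\subseteq\{0,\dots,n\}}\ \prod_{i_0<i\in I}\frac{d(x_i/x_{i_0})}{x_i/x_{i_0}},$$ whose $I$-th summand is a form on $P_I$, is a cocycle of degree $2k$ in this subcomplex, and its class generates the one-dimensional space $H^{2k}(C^\bullet)$. -/

import Mathlib

noncomputable section

open CategoryTheory KaehlerDifferential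

namespace CechDeRham

/-! ## The algebraic de Rham complex of a commutative algebra -/

section DeRham

variable (k A : Type) [CommRing k] [CommRing A] [Algebra k A]

/-- The algebra of Kähler differential forms of all degrees of `A` over `k`: the exterior
`A`-algebra of the module `Ω[A⁄k]`. The forms of degree `q` are `⋀[A]^q Ω[A⁄k]`. -/
abbrev Forms : Type := ExteriorAlgebra A Ω[A⁄k]

variable {k A}

/-- The function `a` as a form of degree `0`. -/
abbrev fn (a : A) : Forms k A := algebraMap A (Forms k A) a

/-- The exact `1`-form `da`. -/
abbrev df (a : A) : Forms k A := ExteriorAlgebra.ι A (D k A a)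

/-- The algebra automorphism of `Forms k A` that is multiplication by `(-1)^q` in degree `q`. -/
abbrev sgn : Forms k A →ₐ[A] Forms k A := CliffordAlgebra.involute

theorem sgn_df (a : A) : sgn (df a : Forms k A) = - df a :=
  CliffordAlgebra.involute_ι _

theorem sgn_sgn (x : Forms k A) : sgn (sgn x) = x := CliffordAlgebra.involute_involute x

theorem Forms.induction {C : Forms k A → Prop} (hfn : ∀ a, C (fn a)) (hdf : ∀ a, C (df a))
    (hadd : ∀ x y, C x → C y → C (x + y)) (hmul : ∀ x y, C x → C y → C (x * y))
    (x : Forms k A) : C x := by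
  induction x using ExteriorAlgebra.induction with
  | algebraMap r => exact hfn r
  | ι w =>
    have hw : w ∈ Submodule.span A (Set.range (D k A)) := by
      rw [KaehlerDifferential.span_range_derivation]; trivial
    induction hw using Submodule.span_induction with
    | mem x h => obtain ⟨a, rfl⟩ := h; exact hdf a
    | zero => simpa using hfn 0
    | add x y _ _ hx hy => rw [map_add]; exact hadd _ _ hx hy
    | smul a x _ hx =>
      rw [map_smul, Algebra.smul_def]; exact hmul _ _ (hfn a) hx
  | mul a b ha hb => exact hmul _ _ ha hb
  | add a b ha hb => exact hadd _ _ ha hb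

theorem df_mul_df_swap (a b : A) : (df a * df b : Forms k A) = - (df b * df a) :=
  eq_neg_of_add_eq_zero_left (ExteriorAlgebra.ι_add_mul_swap _ _)

theorem fn_comm (a : A) (x : Forms k A) : fn a * x = x * fn a := Algebra.commutes a x

theorem df_comm (a : A) (x : Forms k A) : df a * x = sgn x * df a := by
  induction x using Forms.induction with
  | hfn b => rw [AlgHom.commutes]; exact (fn_comm b _).symm
  | hdf b => rw [sgn_df, neg_mul, df_mul_df_swap]
  | hadd x y hx hy => rw [mul_add, map_add, add_mul, hx, hy]
  | hmul x y hx hy => rw [map_mul, ← mul_assoc, hx, mul_assoc, hy, mul_assoc]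

variable (k A) in
/-- Auxiliary to the construction of the exterior derivative: pairs `(x, y)` of forms with the
product `(x, y) (x', y') = (x x', sgn x y' + y x')`, so that a ring-theoretic section `x ↦ (x, δ x)`
of the first projection is the same as an antiderivation `δ`. -/
@[ext]
structure Twisted : Type where
  /-- the form itself -/
  fst : Forms k A
  /-- the place of its derivative -/
  snd : Forms k A

namespace Twisted

instance : Add (Twisted k A) := ⟨fun x y => ⟨x.fst + y.fst, x.snd + y.snd⟩⟩
instance : Zero (Twisted k A) := ⟨⟨0, 0⟩⟩
instance : Neg (Twisted k A) := ⟨fun x => ⟨-x.fst, -x.snd⟩⟩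
instance : Mul (Twisted k A) := ⟨fun x y => ⟨x.fst * y.fst, sgn x.fst * y.snd + x.snd * y.fst⟩⟩
instance : One (Twisted k A) := ⟨⟨1, 0⟩⟩

theorem add_fst (x y : Twisted k A) : (x + y).fst = x.fst + y.fst := rfl
theorem add_snd (x y : Twisted k A) : (x + y).snd = x.snd + y.snd := rfl
theorem mul_fst (x y : Twisted k A) : (x * y).fst = x.fst * y.fst := rfl
theorem mul_snd (x y : Twisted k A) :
    (x * y).snd = sgn x.fst * y.snd + x.snd * y.fst := rfl
theorem zero_fst : (0 : Twisted k A).fst = 0 := rfl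
theorem zero_snd : (0 : Twisted k A).snd = 0 := rfl
theorem one_fst : (1 : Twisted k A).fst = 1 := rfl
theorem one_snd : (1 : Twisted k A).snd = 0 := rfl
theorem neg_fst (x : Twisted k A) : (-x).fst = -x.fst := rfl
theorem neg_snd (x : Twisted k A) : (-x).snd = -x.snd := rfl

instance : AddCommGroup (Twisted k A) where
  add_assoc x y z := by ext <;> simp only [add_fst, add_snd, add_assoc]
  zero_add x := by ext <;> simp only [add_fst, add_snd, zero_fst, zero_snd, zero_add]
  add_zero x := by ext <;> simp only [add_fst, add_snd, zero_fst, zero_snd, add_zero]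
  neg_add_cancel x := by
    ext <;> simp only [add_fst, add_snd, neg_fst, neg_snd, zero_fst, zero_snd, neg_add_cancel]
  add_comm x y := by ext <;> simp only [add_fst, add_snd, add_comm]
  nsmul := nsmulRec
  zsmul := zsmulRec

instance : Ring (Twisted k A) :=
  { (inferInstance : AddCommGroup (Twisted k A)) with
    mul_assoc := fun x y z => by
      ext
      · simp only [mul_fst, mul_assoc]
      · simp only [mul_fst, mul_snd, map_mul]; noncomm_ring
    one_mul := fun x => by ext <;> simp [mul_fst, mul_snd, one_fst, one_snd]
    mul_one := fun x => by ext <;> simp [mul_fst, mul_snd, one_fst, one_snd]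
    left_distrib := fun x y z => by
      ext
      · simp only [mul_fst, add_fst, mul_add]
      · simp only [mul_snd, add_fst, add_snd]; noncomm_ring
    right_distrib := fun x y z => by
      ext
      · simp only [mul_fst, add_fst, add_mul]
      · simp only [mul_snd, add_fst, add_snd, map_add]; noncomm_ring
    zero_mul := fun x => by ext <;> simp [mul_fst, mul_snd, zero_fst, zero_snd]
    mul_zero := fun x => by ext <;> simp [mul_fst, mul_snd, zero_fst, zero_snd] }

/-- The ring homomorphism `a ↦ (a, da)`. -/
def ofFn : A →+* Twisted k A where
  toFun a := ⟨fn a, df a⟩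
  map_one' := by ext <;> simp [df, one_fst, one_snd]
  map_mul' a b := by
    ext
    · simp [mul_fst]
    · rw [mul_snd]
      change df (a * b) = sgn (fn a) * df b + df a * fn b
      rw [AlgHom.commutes, ← fn_comm]
      simp only [df, Derivation.leibniz, map_add, map_smul, Algebra.smul_def]
  map_zero' := by ext <;> simp [df, zero_fst, zero_snd]
  map_add' a b := by ext <;> simp [df, add_fst, add_snd]

instance : Algebra A (Twisted k A) :=
  ofFn.toAlgebra' fun a x => by
    ext
    · exact fn_comm _ _
    · rw [mul_snd, mul_snd]
      change sgn (fn a) * x.snd + df a * x.fst = sgn x.fst * df a + x.snd * fn a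
      rw [AlgHom.commutes, df_comm, fn_comm a x.snd, add_comm]

theorem smul_fst (a : A) (x : Twisted k A) : (a • x).fst = fn a * x.fst := rfl

theorem smul_snd (a : A) (x : Twisted k A) :
    (a • x).snd = fn a * x.snd + df a * x.fst := by
  change sgn (fn a) * x.snd + df a * x.fst = _
  rw [AlgHom.commutes]

instance : Algebra k (Twisted k A) := Algebra.compHom _ (algebraMap k A)

instance : IsScalarTower k A (Twisted k A) := IsScalarTower.of_algebraMap_eq fun _ => rfl

/-- The derivation `a ↦ (da, 0)`. -/
def der : Derivation k A (Twisted k A) where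
  toFun a := ⟨df a, 0⟩
  map_add' a b := by ext <;> simp [df, add_fst, add_snd]
  map_smul' r a := by
    have h : (df (r • a) : Forms k A) = fn (algebraMap k A r) * df a := by
      rw [df, Derivation.map_smul, ← algebraMap_smul A r, map_smul, Algebra.smul_def]
    rw [RingHom.id_apply, ← algebraMap_smul A r (_ : Twisted k A)]
    ext
    · rw [smul_fst, h]
    · rw [smul_snd]; simp [df]
  map_one_eq_zero' := by
    change (⟨df 1, 0⟩ : Twisted k A) = 0
    ext <;> simp [df, zero_fst, zero_snd]
  leibniz' a b := by
    change (⟨df (a * b), 0⟩ : Twisted k A) = a • ⟨df b, 0⟩ + b • ⟨df a, 0⟩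
    ext
    · rw [add_fst, smul_fst, smul_fst]
      simp only [df, Derivation.leibniz, map_add, map_smul, Algebra.smul_def]
    · simp only [add_snd, smul_snd]
      simp [df_mul_df_swap a b]

theorem der_apply (a : A) : (der a : Twisted k A) = ⟨df a, 0⟩ := rfl

theorem lift_fst (w : Ω[A⁄k]) :
    ((der (k := k) (A := A)).liftKaehlerDifferential w).fst = ExteriorAlgebra.ι A w := by
  have hw : w ∈ Submodule.span A (Set.range (D k A)) := by
    rw [KaehlerDifferential.span_range_derivation]; trivial
  induction hw using Submodule.span_induction with
  | mem x h => obtain ⟨a, rfl⟩ := h; rw [Derivation.liftKaehlerDifferential_comp_D, der_apply]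
  | zero => rw [map_zero, map_zero, zero_fst]
  | add x y _ _ hx hy => rw [map_add, add_fst, hx, hy, map_add]
  | smul a x _ hx => rw [map_smul, smul_fst, map_smul, Algebra.smul_def, hx]

theorem lift_snd_comm (w w' : Ω[A⁄k]) :
    ((der (k := k) (A := A)).liftKaehlerDifferential w).snd * ExteriorAlgebra.ι A w' =
      ExteriorAlgebra.ι A w' * ((der (k := k) (A := A)).liftKaehlerDifferential w).snd := by
  have hw : w ∈ Submodule.span A (Set.range (D k A)) := by
    rw [KaehlerDifferential.span_range_derivation]; trivial
  induction hw using Submodule.span_induction with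
  | mem x h =>
    obtain ⟨a, rfl⟩ := h
    rw [Derivation.liftKaehlerDifferential_comp_D, der_apply, zero_mul, mul_zero]
  | zero => rw [map_zero, zero_snd, zero_mul, mul_zero]
  | add x y _ _ hx hy => rw [map_add, add_snd, add_mul, hx, hy, mul_add]
  | smul a x _ hx =>
    have h1 : ∀ u v : Ω[A⁄k], (ExteriorAlgebra.ι A u * ExteriorAlgebra.ι A v : Forms k A) =
        - (ExteriorAlgebra.ι A v * ExteriorAlgebra.ι A u) :=
      fun u v => eq_neg_of_add_eq_zero_left (ExteriorAlgebra.ι_add_mul_swap _ _)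
    rw [map_smul, smul_snd, lift_fst, add_mul, mul_add, mul_assoc, hx, ← mul_assoc, fn_comm,
      mul_assoc (ExteriorAlgebra.ι A w'), mul_assoc (df a), h1 x w', mul_neg, ← mul_assoc (df a),
      h1 _ w', neg_mul, neg_neg, mul_assoc]

/-- The algebra homomorphism `x ↦ (x, dx)`. -/
def lift : Forms k A →ₐ[A] Twisted k A :=
  ExteriorAlgebra.lift A ⟨der.liftKaehlerDifferential, fun w => by
    ext
    · rw [mul_fst, lift_fst]; exact ExteriorAlgebra.ι_sq_zero w
    · rw [mul_snd, lift_fst, CliffordAlgebra.involute_ι, lift_snd_comm, neg_mul, neg_add_cancel,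
        zero_snd]⟩

theorem lift_fn (a : A) : lift (fn a : Forms k A) = ⟨fn a, df a⟩ :=
  lift.commutes a

theorem lift_df (a : A) : lift (df a : Forms k A) = ⟨df a, 0⟩ := by
  rw [lift, ExteriorAlgebra.lift_ι_apply]
  exact Derivation.liftKaehlerDifferential_comp_D _ _

theorem lift_fst' (x : Forms k A) : (lift x).fst = x := by
  induction x using Forms.induction with
  | hfn b => rw [lift_fn]
  | hdf b => rw [lift_df]
  | hadd x y hx hy => rw [map_add, add_fst, hx, hy]
  | hmul x y hx hy => rw [map_mul, mul_fst, hx, hy]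

end Twisted

/-- The exterior derivative on algebraic differential forms. By `extD_fn`, `extD_df` and
`extD_mul` it is the antiderivation with `d(a) = da` and `d(da) = 0` for every function `a`. -/
def extD : Forms k A →ₗ[k] Forms k A where
  toFun x := (Twisted.lift x).snd
  map_add' x y := by rw [map_add, Twisted.add_snd]
  map_smul' r x := by
    rw [RingHom.id_apply, ← algebraMap_smul A r x, map_smul, Twisted.smul_snd,
      ← algebraMap_smul A r (_ : Forms k A), Algebra.smul_def]
    simp [df]

theorem extD_fn (a : A) : extD (fn a : Forms k A) = df a := by
  change (Twisted.lift (fn a : Forms k A)).snd = _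
  rw [Twisted.lift_fn]

theorem extD_df (a : A) : extD (df a : Forms k A) = 0 := by
  change (Twisted.lift (df a : Forms k A)).snd = _
  rw [Twisted.lift_df]

theorem extD_mul (x y : Forms k A) : extD (x * y) = sgn x * extD y + extD x * y := by
  change (Twisted.lift (x * y)).snd = _
  rw [map_mul, Twisted.mul_snd, Twisted.lift_fst', Twisted.lift_fst']
  rfl

theorem extD_sgn (x : Forms k A) : extD (sgn x) = - sgn (extD x) := by
  induction x using Forms.induction with
  | hfn b => rw [AlgHom.commutes, extD_fn, sgn_df, neg_neg]
  | hdf b => rw [sgn_df, map_neg, extD_df, map_zero]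
  | hadd x y hx hy => rw [map_add, map_add, map_add, map_add, hx, hy, neg_add]
  | hmul x y hx hy =>
    rw [map_mul, extD_mul, extD_mul, map_add, map_mul, map_mul, hx, hy]; noncomm_ring

theorem extD_extD (x : Forms k A) : extD (extD x) = 0 := by
  induction x using Forms.induction with
  | hfn b => rw [extD_fn, extD_df]
  | hdf b => rw [extD_df, map_zero]
  | hadd x y hx hy => rw [map_add, map_add, hx, hy, add_zero]
  | hmul x y hx hy =>
    rw [extD_mul, map_add, extD_mul, extD_mul, hx, hy, extD_sgn]; noncomm_ring

theorem ι_mem (w : Ω[A⁄k]) : (ExteriorAlgebra.ι A w : Forms k A) ∈ ⋀[A]^1 Ω[A⁄k] := by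
  change _ ∈ LinearMap.range _ ^ 1
  rw [pow_one]; exact ⟨_, rfl⟩

theorem df_mem (a : A) : (df a : Forms k A) ∈ ⋀[A]^1 Ω[A⁄k] := ι_mem _

theorem fn_mem (a : A) : (fn a : Forms k A) ∈ ⋀[A]^0 Ω[A⁄k] := by
  change _ ∈ LinearMap.range _ ^ 0
  rw [pow_zero]; exact Submodule.algebraMap_mem _

theorem mul_mem_deg {p q : ℕ} {x y : Forms k A} (hx : x ∈ ⋀[A]^p Ω[A⁄k])
    (hy : y ∈ ⋀[A]^q Ω[A⁄k]) : x * y ∈ ⋀[A]^(p + q) Ω[A⁄k] := by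
  change _ ∈ LinearMap.range _ ^ (p + q)
  rw [pow_add]; exact Submodule.mul_mem_mul hx hy

theorem extD_mem {q : ℕ} {x : Forms k A} (hx : x ∈ ⋀[A]^q Ω[A⁄k]) :
    extD x ∈ ⋀[A]^(q + 1) Ω[A⁄k] := by
  induction hx using Submodule.pow_induction_on_left' with
  | algebraMap r => rw [extD_fn]; exact df_mem r
  | add x y i hx hy ihx ihy => rw [map_add]; exact add_mem ihx ihy
  | mem_mul m hm i x hx ih =>
    obtain ⟨w, rfl⟩ := hm
    have h1 : extD (ExteriorAlgebra.ι A w : Forms k A) ∈ ⋀[A]^2 Ω[A⁄k] := by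
      have hw : w ∈ Submodule.span A (Set.range (D k A)) := by
        rw [KaehlerDifferential.span_range_derivation]; trivial
      induction hw using Submodule.span_induction with
      | mem x h => obtain ⟨a, rfl⟩ := h; rw [extD_df]; exact zero_mem _
      | zero => simp
      | add x y _ _ hx hy => rw [map_add, map_add]; exact add_mem hx hy
      | smul a x _ hx =>
        rw [map_smul, Algebra.smul_def, extD_mul, AlgHom.commutes, extD_fn]
        refine add_mem ?_ (mul_mem_deg (df_mem a) (ι_mem x))
        rw [← Algebra.smul_def]; exact Submodule.smul_mem _ _ hx
    rw [extD_mul, CliffordAlgebra.involute_ι]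
    refine add_mem ?_ ?_
    · rw [neg_mul]
      refine neg_mem ?_
      have := mul_mem_deg (ι_mem w) ih
      rwa [show i.succ + 1 = 1 + (i + 1) by omega]
    · rw [show i.succ + 1 = 2 + i by omega]
      exact mul_mem_deg h1 hx

variable {B C : Type} [CommRing B] [Algebra k B] [CommRing C] [Algebra k C]

/-- The pull-back of forms along an algebra homomorphism. By `pullback_fn` and `pullback_df` it is
the `k`-algebra homomorphism with `a ↦ f a` and `da ↦ d(f a)`. -/
def pullback (f : A →ₐ[k] B) : Forms k A →ₐ[k] Forms k B :=
  letI : Algebra A B := f.toRingHom.toAlgebra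
  haveI : IsScalarTower k A B := IsScalarTower.of_algebraMap_eq fun r => (f.commutes r).symm
  (ExteriorAlgebra.lift A
    ⟨(ExteriorAlgebra.ι B).restrictScalars A ∘ₗ KaehlerDifferential.map k k A B,
      fun _ => ExteriorAlgebra.ι_sq_zero (R := B) _⟩).restrictScalars k

theorem pullback_fn (f : A →ₐ[k] B) (a : A) : pullback f (fn a) = fn (f a) := by
  let _ : Algebra A B := f.toRingHom.toAlgebra
  have _ : IsScalarTower k A B := IsScalarTower.of_algebraMap_eq fun r => (f.commutes r).symm
  exact (AlgHom.commutes _ a).trans (IsScalarTower.algebraMap_apply A B (Forms k B) a)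

theorem pullback_df (f : A →ₐ[k] B) (a : A) : pullback f (df a) = df (f a) := by
  let _ : Algebra A B := f.toRingHom.toAlgebra
  have _ : IsScalarTower k A B := IsScalarTower.of_algebraMap_eq fun r => (f.commutes r).symm
  refine (ExteriorAlgebra.lift_ι_apply A _ _ _).trans ?_
  exact congrArg (ExteriorAlgebra.ι B) (KaehlerDifferential.map_D k k A B a)

theorem pullback_sgn (f : A →ₐ[k] B) (x : Forms k A) :
    pullback f (sgn x) = sgn (pullback f x) := by
  induction x using Forms.induction with
  | hfn b => rw [AlgHom.commutes, pullback_fn, AlgHom.commutes]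
  | hdf b => rw [sgn_df, map_neg, pullback_df, sgn_df]
  | hadd x y hx hy => simp only [map_add, hx, hy]
  | hmul x y hx hy => simp only [map_mul, hx, hy]

theorem pullback_extD (f : A →ₐ[k] B) (x : Forms k A) :
    pullback f (extD x) = extD (pullback f x) := by
  induction x using Forms.induction with
  | hfn b => rw [extD_fn, pullback_fn, pullback_df, extD_fn]
  | hdf b => rw [extD_df, pullback_df, extD_df, map_zero]
  | hadd x y hx hy => simp only [map_add, hx, hy]
  | hmul x y hx hy => simp only [map_mul, map_add, extD_mul, pullback_sgn, hx, hy]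

theorem pullback_comp (g : B →ₐ[k] C) (f : A →ₐ[k] B) (x : Forms k A) :
    pullback g (pullback f x) = pullback (g.comp f) x := by
  induction x using Forms.induction with
  | hfn b => simp only [pullback_fn]; rfl
  | hdf b => simp only [pullback_df]; rfl
  | hadd x y hx hy => simp only [map_add, hx, hy]
  | hmul x y hx hy => simp only [map_mul, hx, hy]

theorem pullback_mem (f : A →ₐ[k] B) {q : ℕ} {x : Forms k A} (hx : x ∈ ⋀[A]^q Ω[A⁄k]) :
    pullback f x ∈ ⋀[B]^q Ω[B⁄k] := by
  induction hx using Submodule.pow_induction_on_left' with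
  | algebraMap r => rw [pullback_fn]; exact fn_mem _
  | add x y i hx hy ihx ihy => rw [map_add]; exact add_mem ihx ihy
  | mem_mul m hm i x hx ih =>
    obtain ⟨w, rfl⟩ := hm
    rw [map_mul, Nat.succ_eq_one_add]
    refine mul_mem_deg ?_ ih
    have hw : w ∈ Submodule.span A (Set.range (D k A)) := by
      rw [KaehlerDifferential.span_range_derivation]; trivial
    induction hw using Submodule.span_induction with
    | mem x h => obtain ⟨a, rfl⟩ := h; rw [pullback_df]; exact df_mem _
    | zero => rw [map_zero, map_zero]; exact zero_mem _
    | add x y _ _ hx hy => rw [map_add, map_add]; exact add_mem hx hy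
    | smul a x _ hx =>
      rw [map_smul, Algebra.smul_def, map_mul, pullback_fn, ← Algebra.smul_def]
      exact Submodule.smul_mem _ _ hx

end DeRham

/-! ## Logarithmic forms -/

section Log

variable {k A : Type} [CommRing k] [CommRing A] [Algebra k A]

theorem dlog_mul {a a' b b' : A} (ha : a * a' = 1) (hb : b * b' = 1) :
    (fn (a' * b') * df (a * b) : Forms k A) = fn a' * df a + fn b' * df b := by
  have h : (df (a * b) : Forms k A) = fn a * df b + fn b * df a := by
    simp only [df, Derivation.leibniz, map_add, map_smul, Algebra.smul_def]
  rw [h, mul_add, ← mul_assoc, ← mul_assoc, ← map_mul, ← map_mul,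
    show a' * b' * a = b' by linear_combination b' * ha,
    show a' * b' * b = a' by linear_combination a' * hb, add_comm]

theorem extD_dlog {a a' : A} (ha : a * a' = 1) : extD (fn a' * df a : Forms k A) = 0 := by
  have h0 : (fn a * df a' + fn a' * df a : Forms k A) = 0 := by
    have h : (df (a * a') : Forms k A) = fn a * df a' + fn a' * df a := by
      simp only [df, Derivation.leibniz, map_add, map_smul, Algebra.smul_def]
    rw [← h, ha]; simp [df]
  have h1 : (df a' : Forms k A) = - (fn (a' * a') * df a) := by
    have h2 : (fn a' * (fn a * df a' + fn a' * df a) : Forms k A) = 0 := by rw [h0, mul_zero]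
    rw [mul_add, ← mul_assoc, ← map_mul, mul_comm a' a, ha, map_one, one_mul, ← mul_assoc,
      ← map_mul] at h2
    exact eq_neg_of_add_eq_zero_left h2
  rw [extD_mul, extD_df, mul_zero, zero_add, extD_fn, h1, neg_mul, mul_assoc,
    ExteriorAlgebra.ι_sq_zero, mul_zero, neg_zero]

theorem sgn_dlog (a a' : A) : sgn (fn a' * df a : Forms k A) = - (fn a' * df a) := by
  rw [map_mul, AlgHom.commutes, sgn_df, mul_neg]

theorem dlog_swap (a a' b b' : A) : (fn a' * df a * (fn b' * df b) : Forms k A) =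
    - (fn b' * df b * (fn a' * df a)) := by
  rw [mul_assoc, ← mul_assoc (df a), ← fn_comm, mul_assoc (fn b') (df a), df_mul_df_swap,
    mul_assoc (fn b'), ← mul_assoc (df b), ← fn_comm, mul_assoc (fn a') (df b), mul_neg, mul_neg,
    ← mul_assoc, ← mul_assoc, ← fn_comm (k := k) b' (fn a'), mul_assoc, mul_assoc]

theorem dlog_sq (a a' : A) : (fn a' * df a * (fn a' * df a) : Forms k A) = 0 := by
  rw [mul_assoc, ← mul_assoc (df a), ← fn_comm, mul_assoc (fn a') (df a),
    ExteriorAlgebra.ι_sq_zero, mul_zero, mul_zero]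

theorem dlog_mem (a a' : A) : (fn a' * df a : Forms k A) ∈ ⋀[A]^1 Ω[A⁄k] := by
  rw [← Algebra.smul_def]; exact Submodule.smul_mem _ _ (df_mem a)

end Log

section AntiComm

variable {R ι : Type} [Ring R]

theorem prod_perm_sign (g : ι → R) (hg : ∀ i j, g i * g j = - (g j * g i)) {l l' : List ι}
    (h : l.Perm l') : (l.map g).prod = (l'.map g).prod ∨ (l.map g).prod = - (l'.map g).prod := by
  induction h with
  | nil => exact Or.inl rfl
  | cons x _ ih =>
    simp only [List.map_cons, List.prod_cons]
    rcases ih with h | h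
    · exact Or.inl (by rw [h])
    · exact Or.inr (by rw [h, mul_neg])
  | swap x y l =>
    right
    simp only [List.map_cons, List.prod_cons]
    rw [← mul_assoc, ← mul_assoc, hg, neg_mul]
  | trans _ _ h1 h2 =>
    rcases h1 with h1 | h1 <;> rcases h2 with h2 | h2 <;> rw [h1, h2] <;> simp

end AntiComm

/-! ## The standard cover of projective space -/

/-- The homogeneous coordinate ring `ℂ[x₀, …, xₙ]`. -/
abbrev Coord (n : ℕ) : Type := MvPolynomial (Fin (n + 1)) ℂ

/-- The multiplicative set generated by the coordinates `x_i` with `i ∈ I`. -/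
abbrev coordMonoid (n : ℕ) (I : Finset (Fin (n + 1))) : Submonoid (Coord n) :=
  Submonoid.closure (MvPolynomial.X '' (I : Set (Fin (n + 1))))

theorem coordMonoid_mono {n : ℕ} {I J : Finset (Fin (n + 1))} (h : I ⊆ J) :
    coordMonoid n I ≤ coordMonoid n J :=
  Submonoid.closure_mono (Set.image_mono (Finset.coe_subset.2 h))

/-- The coordinate ring `ℂ[x₀, …, xₙ, x_i⁻¹ : i ∈ I]₀` of the affine open set
`P_I = ⋂_{i ∈ I} P_i ⊆ ℙⁿ` on which all `x_i`, `i ∈ I`, are nonzero (for nonempty `I`). -/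
abbrev ChartRing (n : ℕ) (I : Finset (Fin (n + 1))) : Type :=
  HomogeneousLocalization (MvPolynomial.homogeneousSubmodule (Fin (n + 1)) ℂ) (coordMonoid n I)

attribute [local instance] MvPolynomial.gradedAlgebra

variable {n : ℕ}

instance (I : Finset (Fin (n + 1))) : Algebra ℂ (ChartRing n I) where
  algebraMap := (algebraMap (MvPolynomial.homogeneousSubmodule (Fin (n + 1)) ℂ 0) _).comp
    (algebraMap ℂ (MvPolynomial.homogeneousSubmodule (Fin (n + 1)) ℂ 0))
  commutes' _ _ := mul_comm _ _
  smul_def' r x := by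
    apply HomogeneousLocalization.val_injective
    rw [HomogeneousLocalization.val_smul, HomogeneousLocalization.val_mul, Algebra.smul_def]
    rfl

/-- Restriction of functions from `P_I` to `P_J` for `I ⊆ J`. -/
def restrictFn {I J : Finset (Fin (n + 1))} (h : I ⊆ J) : ChartRing n I →ₐ[ℂ] ChartRing n J :=
  { HomogeneousLocalization.mapId (MvPolynomial.homogeneousSubmodule (Fin (n + 1)) ℂ)
      (coordMonoid_mono h) with
    commutes' := fun _ => rfl }

/-- The function `x_i / x_j` on `P_I`, for `j ∈ I` (and `0`, by convention, if `j ∉ I`). -/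
def ratio (I : Finset (Fin (n + 1))) (i j : Fin (n + 1)) : ChartRing n I :=
  if h : j ∈ I then
    .mk ⟨1, ⟨MvPolynomial.X i, MvPolynomial.isHomogeneous_X ℂ i⟩,
      ⟨MvPolynomial.X j, MvPolynomial.isHomogeneous_X ℂ j⟩,
      Submonoid.subset_closure ⟨j, h, rfl⟩⟩
  else 0

theorem ratio_val {I : Finset (Fin (n + 1))} {i j : Fin (n + 1)} (hj : j ∈ I) :
    (ratio I i j).val = Localization.mk (MvPolynomial.X i)
      (⟨MvPolynomial.X j, Submonoid.subset_closure ⟨j, hj, rfl⟩⟩ : coordMonoid n I) := by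
  rw [ratio, dif_pos hj]; rfl

theorem ratio_mul {I : Finset (Fin (n + 1))} {i j l : Fin (n + 1)} (hj : j ∈ I) (hl : l ∈ I) :
    ratio I i j * ratio I j l = ratio I i l := by
  apply HomogeneousLocalization.val_injective
  rw [HomogeneousLocalization.val_mul, ratio_val hj, ratio_val hl, ratio_val hl,
    Localization.mk_mul, Localization.mk_eq_mk_iff, Localization.r_iff_exists]
  refine ⟨1, ?_⟩
  simp only [Submonoid.coe_mul, Submonoid.coe_one]
  ring

theorem ratio_self {I : Finset (Fin (n + 1))} {i : Fin (n + 1)} (hi : i ∈ I) :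
    ratio I i i = 1 := by
  apply HomogeneousLocalization.val_injective
  rw [ratio_val hi, HomogeneousLocalization.val_one]
  exact Localization.mk_self
    (⟨MvPolynomial.X i, Submonoid.subset_closure ⟨i, hi, rfl⟩⟩ : coordMonoid n I)

theorem restrictFn_ratio {I J : Finset (Fin (n + 1))} (h : I ⊆ J) {i j : Fin (n + 1)}
    (hj : j ∈ I) : restrictFn h (ratio I i j) = ratio J i j := by
  rw [ratio, ratio, dif_pos hj, dif_pos (h hj)]; rfl

theorem restrictFn_comp {I J K : Finset (Fin (n + 1))} (h : I ⊆ J) (h' : J ⊆ K) :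
    (restrictFn h').comp (restrictFn h) = restrictFn (h.trans h') := by
  ext x
  obtain ⟨c, rfl⟩ := x.mk_surjective
  rfl

/-- The algebraic differential forms (of all degrees) on `P_I`. -/
abbrev ChartForms (n : ℕ) (I : Finset (Fin (n + 1))) : Type := Forms ℂ (ChartRing n I)

instance (I : Finset (Fin (n + 1))) : Module ℂ (ChartForms n I) := Algebra.toModule

/-- Restriction of differential forms from `P_I` to `P_J` for `I ⊆ J`. -/
def restrict {I J : Finset (Fin (n + 1))} (h : I ⊆ J) : ChartForms n I →ₐ[ℂ] ChartForms n J :=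
  pullback (restrictFn h)

theorem restrict_restrict {I J K : Finset (Fin (n + 1))} (h : I ⊆ J) (h' : J ⊆ K)
    (x : ChartForms n I) : restrict h' (restrict h x) = restrict (h.trans h') x := by
  rw [restrict, restrict, restrict, pullback_comp, restrictFn_comp]

/-! ## The total Čech–de Rham complex -/

/-- Families of forms `ω_I` on `P_I`, of arbitrary degrees. -/
abbrev Family (n : ℕ) : Type := (I : Finset (Fin (n + 1))) → ChartForms n I

/-- The position of `j` in `I` (counted from `0`), that is, the number of `i ∈ I` with `i < j`. -/
def position (I : Finset (Fin (n + 1))) (j : Fin (n + 1)) : ℕ := (I.filter (· < j)).card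

/-- The Čech differential
`(δω)_{i₀ < ⋯ < i_p} = ∑ₐ (-1)^a ω_{i₀ < ⋯ < î_a < ⋯ < i_p}`, restricted to `P_{i₀ … i_p}`. -/
def cechD : Family n →ₗ[ℂ] Family n where
  toFun ω I := ∑ j ∈ I, (-1 : ℂ) ^ position I j • restrict (I.erase_subset j) (ω (I.erase j))
  map_add' ω η := by
    funext I
    simp only [Pi.add_apply, map_add, smul_add, Finset.sum_add_distrib]
  map_smul' r ω := by
    funext I
    simp only [Pi.smul_apply, map_smul, RingHom.id_apply, Finset.smul_sum]
    exact Finset.sum_congr rfl fun j _ => smul_comm _ _ _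

/-- The total differential `D = δ + (-1)^p d`, on the forms on `P_I` with `|I| = p + 1`. -/
def totalD : Family n →ₗ[ℂ] Family n where
  toFun ω I := cechD ω I + (-1 : ℂ) ^ (I.card + 1) • extD (ω I)
  map_add' ω η := by
    funext I
    simp only [Pi.add_apply, map_add, smul_add]
    abel
  map_smul' r ω := by
    funext I
    simp only [Pi.smul_apply, map_smul, RingHom.id_apply, smul_add]
    rw [smul_comm r]

theorem totalD_apply (ω : Family n) (I : Finset (Fin (n + 1))) :
    totalD ω I = cechD ω I + (-1 : ℂ) ^ (I.card + 1) • extD (ω I) := rfl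

theorem cechD_apply (ω : Family n) (I : Finset (Fin (n + 1))) : cechD ω I =
    ∑ j ∈ I, (-1 : ℂ) ^ position I j • restrict (I.erase_subset j) (ω (I.erase j)) := rfl

theorem position_erase_of_le {I : Finset (Fin (n + 1))} {j l : Fin (n + 1)} (h : l ≤ j) :
    position (I.erase j) l = position I l := by
  unfold position
  congr 1
  ext i
  simp only [Finset.mem_filter, Finset.mem_erase]
  exact ⟨fun ⟨⟨_, h1⟩, h2⟩ => ⟨h1, h2⟩, fun ⟨h1, h2⟩ => ⟨⟨(h2.trans_le h).ne, h1⟩, h2⟩⟩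

theorem position_erase_of_lt {I : Finset (Fin (n + 1))} {j l : Fin (n + 1)} (hj : j ∈ I)
    (h : j < l) : position (I.erase j) l + 1 = position I l := by
  unfold position
  rw [Finset.filter_erase]
  exact Finset.card_erase_add_one (Finset.mem_filter.2 ⟨hj, h⟩)

theorem position_swap {I : Finset (Fin (n + 1))} {j l : Fin (n + 1)} (hj : j ∈ I) (hl : l ∈ I)
    (h : j ≠ l) : (-1 : ℂ) ^ position I j * (-1) ^ position (I.erase j) l =
      - ((-1 : ℂ) ^ position I l * (-1) ^ position (I.erase l) j) := by
  rcases lt_or_gt_of_ne h with h | h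
  · rw [position_erase_of_le h.le, ← position_erase_of_lt hj h, pow_succ]; ring
  · rw [position_erase_of_le h.le, ← position_erase_of_lt hl h, pow_succ]; ring

theorem restrict_congr (ω : Family n) {I J K : Finset (Fin (n + 1))} (hJ : J ⊆ I) (hK : K ⊆ I)
    (h : J = K) : restrict hJ (ω J) = restrict hK (ω K) := by
  subst h; rfl

theorem cechD_cechD (ω : Family n) : cechD (cechD ω) = 0 := by
  funext I
  simp only [cechD_apply, map_sum, map_smul, restrict_restrict, Finset.smul_sum, smul_smul]
  rw [Finset.sum_sigma']
  refine Finset.sum_involution (fun p _ => ⟨p.2, p.1⟩) ?_ ?_ ?_ ?_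
  · rintro ⟨j, l⟩ h
    simp only [Finset.mem_sigma, Finset.mem_erase] at h
    obtain ⟨hj, hlj, hl⟩ := h
    rw [position_swap hj hl hlj.symm, neg_smul,
      restrict_congr ω _ (((I.erase l).erase_subset j).trans (I.erase_subset l))
        (Finset.erase_right_comm)]
    exact neg_add_cancel _
  · rintro ⟨j, l⟩ h _ h'
    simp only [Finset.mem_sigma, Finset.mem_erase] at h
    exact h.2.1 (congrArg Sigma.fst h')
  · rintro ⟨j, l⟩ h
    simp only [Finset.mem_sigma, Finset.mem_erase] at h ⊢
    exact ⟨h.2.2, h.2.1.symm, h.1⟩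
  · rintro ⟨j, l⟩ _; rfl

theorem totalD_totalD (ω : Family n) : totalD (totalD ω) = 0 := by
  funext I
  have h1 : cechD (totalD ω) I = - ((-1 : ℂ) ^ (I.card + 1) • extD (cechD ω I)) := by
    have h2 : totalD ω = cechD ω + fun J => (-1 : ℂ) ^ (J.card + 1) • extD (ω J) := rfl
    rw [h2, map_add, cechD_cechD, zero_add, cechD_apply, cechD_apply, map_sum, Finset.smul_sum,
      ← Finset.sum_neg_distrib]
    refine Finset.sum_congr rfl fun j hj => ?_
    rw [map_smul, map_smul, smul_comm, restrict, pullback_extD, ← neg_smul,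
      ← Finset.card_erase_add_one hj]
    congr 1
    ring
  rw [totalD_apply, h1, totalD_apply, map_add, map_smul, extD_extD, smul_zero, add_zero]
  exact neg_add_cancel _

/-- The total Čech–de Rham cochains of degree `m`: families of `q`-forms `ω_I` on `P_I`, where `I`
runs over the nonempty sets with `(|I| - 1) + q = m`. (The component at `I = ∅`, which is not part
of the cover, is zero.) -/
def cochains (n m : ℕ) : Submodule ℂ (Family n) where
  carrier := {ω | (∀ I q, I.card + q = m + 1 → ω I ∈ ⋀[ChartRing n I]^q Ω[ChartRing n I⁄ℂ]) ∧
    ∀ I, I = ∅ ∨ m + 1 < I.card → ω I = 0}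
  add_mem' h h' := ⟨fun I q hI => add_mem (h.1 I q hI) (h'.1 I q hI), fun I hI => by
    rw [Pi.add_apply, h.2 I hI, h'.2 I hI, add_zero]⟩
  zero_mem' := ⟨fun _ _ _ => zero_mem _, fun _ _ => rfl⟩
  smul_mem' r ω h := ⟨fun I q hI => by
    rw [Pi.smul_apply, ← algebraMap_smul (ChartRing n I) r (ω I)]
    exact Submodule.smul_mem _ _ (h.1 I q hI), fun I hI => by
    rw [Pi.smul_apply, h.2 I hI, smul_zero]⟩

theorem ofNat_smul_mem {I : Finset (Fin (n + 1))} {q : ℕ} (r : ℂ) {x : ChartForms n I}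
    (hx : x ∈ ⋀[ChartRing n I]^q Ω[ChartRing n I⁄ℂ]) :
    r • x ∈ ⋀[ChartRing n I]^q Ω[ChartRing n I⁄ℂ] := by
  rw [← algebraMap_smul (ChartRing n I) r x]
  exact Submodule.smul_mem _ _ hx

theorem totalD_empty {ω : Family n} (h : ω ∅ = 0) : totalD ω ∅ = 0 := by
  rw [totalD_apply, cechD_apply, Finset.sum_empty, h, map_zero, smul_zero, add_zero]

theorem totalD_of_lt {m : ℕ} {ω : Family n} (h : ω ∈ cochains n m) {I : Finset (Fin (n + 1))}
    (hI : m + 2 < I.card) : totalD ω I = 0 := by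
  rw [totalD_apply, cechD_apply, h.2 I (Or.inr (by omega)), map_zero, smul_zero, add_zero]
  refine Finset.sum_eq_zero fun j hj => ?_
  rw [h.2 _ (Or.inr _), map_zero, smul_zero]
  have := Finset.card_erase_add_one hj
  omega

theorem totalD_mem {m : ℕ} {ω : Family n} (h : ω ∈ cochains n m) :
    totalD ω ∈ cochains n (m + 1) := by
  refine ⟨fun I q hI => ?_, fun I hI => ?_⟩
  · rw [totalD_apply]
    refine add_mem (Submodule.sum_mem _ fun j hj => ?_) (ofNat_smul_mem _ ?_)
    · refine ofNat_smul_mem _ (pullback_mem _ (h.1 _ q ?_))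
      have := Finset.card_erase_add_one hj
      omega
    · rcases q with _ | q
      · rw [h.2 I (Or.inr (by omega)), map_zero]; exact zero_mem _
      · exact extD_mem (h.1 I q (by omega))
  · rcases hI with rfl | hI
    · exact totalD_empty (h.2 _ (Or.inl rfl))
    · exact totalD_of_lt h hI

/-- The complex of the submodules `V m` of the families of forms, with the differential `D`. -/
def totalComplex (V : ℕ → Submodule ℂ (Family n)) (hV : ∀ m, ∀ ω ∈ V m, totalD ω ∈ V (m + 1)) :
    CochainComplex (ModuleCat ℂ) ℕ :=
  CochainComplex.of (fun m => ModuleCat.of ℂ (V m))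
    (fun m => ModuleCat.ofHom (totalD.restrict (hV m)))
    (fun m => by
      ext ω I
      exact congrFun (totalD_totalD (ω : Family n)) I)

/-- The algebraic Čech–de Rham complex of `ℙⁿ` for the cover by the standard charts `P_j`: the
total complex of the double complex with terms `∏_{|I| = p + 1} Ω^q(P_I)`. -/
def cechDeRham (n : ℕ) : CochainComplex (ModuleCat ℂ) ℕ :=
  totalComplex (cochains n) fun _ _ h => totalD_mem h

/-! ## The torus complexes -/

/-- The logarithmic form `d(x_i/x_j) / (x_i/x_j)` on `P_I`, for `i, j ∈ I`. -/
def dlog (I : Finset (Fin (n + 1))) (i j : Fin (n + 1)) : ChartForms n I :=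
  fn (ratio I j i) * df (ratio I i j)

/-- The ordered product `∏_{i ∈ K} d(x_i/x_{i₀}) / (x_i/x_{i₀})` on `P_I`, with the factors in
increasing order of `i`. -/
def dlogProd (I : Finset (Fin (n + 1))) (i₀ : Fin (n + 1)) (K : Finset (Fin (n + 1))) :
    ChartForms n I :=
  ((K.sort (· ≤ ·)).map fun i => dlog I i i₀).prod

/-- The term `T_I^q` in degree `q` of the torus complex of `P_I`: the span of the forms
`∏_{i₀ < i ∈ J} d(x_i/x_{i₀}) / (x_i/x_{i₀})` with `i₀ = min I ∈ J ⊆ I` and `|J| = q + 1`. -/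
def torus (I : Finset (Fin (n + 1))) (q : ℕ) : Submodule ℂ (ChartForms n I) :=
  Submodule.span ℂ {ω | ∃ i₀ J, IsLeast (I : Set (Fin (n + 1))) i₀ ∧ i₀ ∈ J ∧ J ⊆ I ∧
    J.card = q + 1 ∧ ω = dlogProd I i₀ (J.erase i₀)}

theorem dlog_self {I : Finset (Fin (n + 1))} {i : Fin (n + 1)} (hi : i ∈ I) : dlog I i i = 0 := by
  rw [dlog, ratio_self hi]; simp [df]

theorem dlog_sub {I : Finset (Fin (n + 1))} {i j l : Fin (n + 1)} (hi : i ∈ I) (hj : j ∈ I)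
    (hl : l ∈ I) : dlog I i j = dlog I i l - dlog I j l := by
  have h1 : dlog I i l = fn (ratio I j i * ratio I l j) * df (ratio I i j * ratio I j l) := by
    rw [mul_comm (ratio I j i), ratio_mul hj hi, ratio_mul hj hl, dlog]
  rw [eq_sub_iff_add_eq, h1, dlog_mul, dlog, dlog]
  · rw [ratio_mul hj hi, ratio_self hi]
  · rw [ratio_mul hl hj, ratio_self hj]

theorem restrict_dlog {I J : Finset (Fin (n + 1))} (h : I ⊆ J) {i j : Fin (n + 1)} (hi : i ∈ I)
    (hj : j ∈ I) : restrict h (dlog I i j) = dlog J i j := by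
  rw [dlog, restrict, map_mul, pullback_fn, pullback_df, restrictFn_ratio h hi,
    restrictFn_ratio h hj, dlog]

theorem extD_prod_dlog {I : Finset (Fin (n + 1))} {i₀ : Fin (n + 1)} (h₀ : i₀ ∈ I)
    (l : List (Fin (n + 1))) (hl : ∀ i ∈ l, i ∈ I) :
    extD (l.map fun i => dlog I i i₀).prod = 0 := by
  induction l with
  | nil =>
    have := extD_fn (k := ℂ) (1 : ChartRing n I)
    simpa [df] using this
  | cons a l ih =>
    rw [List.map_cons, List.prod_cons, extD_mul, ih fun i hi => hl i (List.mem_cons_of_mem _ hi),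
      mul_zero, zero_add]
    have ha : a ∈ I := hl a List.mem_cons_self
    rw [dlog, extD_dlog (by rw [ratio_mul h₀ ha, ratio_self ha]), zero_mul]

theorem prod_dlog_mem (I : Finset (Fin (n + 1))) (i₀ : Fin (n + 1)) (l : List (Fin (n + 1))) :
    (l.map fun i => dlog I i i₀).prod ∈ ⋀[ChartRing n I]^l.length Ω[ChartRing n I⁄ℂ] := by
  induction l with
  | nil => simp
  | cons a l ih =>
    rw [List.map_cons, List.prod_cons, List.length_cons, add_comm l.length 1]
    exact mul_mem_deg (dlog_mem _ _) ih

theorem dlogProd_mem (I : Finset (Fin (n + 1))) (i₀ : Fin (n + 1)) (K : Finset (Fin (n + 1))) :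
    dlogProd I i₀ K ∈ ⋀[ChartRing n I]^K.card Ω[ChartRing n I⁄ℂ] := by
  rw [← Finset.length_sort (· ≤ ·)]
  exact prod_dlog_mem I i₀ _

theorem torus_le {I : Finset (Fin (n + 1))} {q : ℕ} {ω : ChartForms n I} (h : ω ∈ torus I q) :
    ω ∈ ⋀[ChartRing n I]^q Ω[ChartRing n I⁄ℂ] := by
  induction h using Submodule.span_induction with
  | mem x hx =>
    obtain ⟨i₀, J, _, hi, _, hc, rfl⟩ := hx
    have h := dlogProd_mem I i₀ (J.erase i₀)
    rwa [Finset.card_erase_of_mem hi, hc, Nat.add_sub_cancel] at h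
  | zero => exact zero_mem _
  | add x y _ _ hx hy => exact add_mem hx hy
  | smul r x _ hx => exact ofNat_smul_mem r hx

theorem extD_torus {I : Finset (Fin (n + 1))} {q : ℕ} {ω : ChartForms n I} (h : ω ∈ torus I q) :
    extD ω = 0 := by
  induction h using Submodule.span_induction with
  | mem x hx =>
    obtain ⟨i₀, J, hl, hi, hJ, hc, rfl⟩ := hx
    exact extD_prod_dlog (hJ hi) _ fun i hi' =>
      hJ (Finset.erase_subset _ _ ((Finset.mem_sort _).1 hi'))
  | zero => exact map_zero _
  | add x y _ _ hx hy => rw [map_add, hx, hy, add_zero]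
  | smul r x _ hx => rw [map_smul, hx, smul_zero]

theorem dlogProd_mem_torus {I K : Finset (Fin (n + 1))} {i₀ : Fin (n + 1)}
    (h₀ : IsLeast (I : Set (Fin (n + 1))) i₀) (hK : K ⊆ I) (hK₀ : i₀ ∉ K) :
    dlogProd I i₀ K ∈ torus I K.card := by
  refine Submodule.subset_span ⟨i₀, insert i₀ K, h₀, Finset.mem_insert_self _ _,
    Finset.insert_subset h₀.1 hK, Finset.card_insert_of_notMem hK₀, ?_⟩
  rw [Finset.erase_insert hK₀]

theorem dlog_anticomm (I : Finset (Fin (n + 1))) (i₀ i j : Fin (n + 1)) :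
    dlog I i i₀ * dlog I j i₀ = - (dlog I j i₀ * dlog I i i₀) := dlog_swap _ _ _ _

theorem dlogProd_perm (I : Finset (Fin (n + 1))) (i₀ : Fin (n + 1)) {K : Finset (Fin (n + 1))}
    {l : List (Fin (n + 1))} (h : l.Perm K.toList) :
    (l.map fun i => dlog I i i₀).prod = dlogProd I i₀ K ∨
      (l.map fun i => dlog I i i₀).prod = - dlogProd I i₀ K :=
  prod_perm_sign _ (dlog_anticomm I i₀) (h.trans (Finset.sort_perm_toList _ _).symm)

theorem dlog_mul_torus {I : Finset (Fin (n + 1))} {i₀ i : Fin (n + 1)} {q : ℕ}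
    (h₀ : IsLeast (I : Set (Fin (n + 1))) i₀) (hi : i ∈ I) {ω : ChartForms n I}
    (h : ω ∈ torus I q) : dlog I i i₀ * ω ∈ torus I (q + 1) := by
  induction h using Submodule.span_induction with
  | mem x hx =>
    obtain ⟨i₁, J, hl, hi₁, hJ, hc, rfl⟩ := hx
    obtain rfl := hl.unique h₀
    by_cases hii : i = i₁
    · rw [hii, dlog_self (hJ hi₁), zero_mul]; exact zero_mem _
    have hcard : (J.erase i₁).card = q := by
      rw [Finset.card_erase_of_mem hi₁, hc, Nat.add_sub_cancel]
    by_cases hiJ : i ∈ J.erase i₁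
    · have hp : (i :: ((J.erase i₁).erase i).toList).Perm (J.erase i₁).toList := by
        have := Finset.toList_insert (Finset.notMem_erase i (J.erase i₁))
        rw [Finset.insert_erase hiJ] at this
        exact this.symm
      have hz : dlog I i i₁ *
          ((i :: ((J.erase i₁).erase i).toList).map fun i => dlog I i i₁).prod = 0 := by
        rw [List.map_cons, List.prod_cons, ← mul_assoc, dlog, dlog_sq, zero_mul]
      rcases dlogProd_perm I i₁ hp with h | h
      · rw [← h, hz]; exact zero_mem _
      · rw [← neg_eq_iff_eq_neg] at h
        rw [← h, mul_neg, hz, neg_zero]; exact zero_mem _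
    · have hp : (i :: (J.erase i₁).sort (· ≤ ·)).Perm (insert i (J.erase i₁)).toList :=
        ((Finset.sort_perm_toList _ _).cons i).trans (Finset.toList_insert hiJ).symm
      have hm : dlogProd I i₁ (insert i (J.erase i₁)) ∈ torus I (q + 1) := by
        rw [← hcard, ← Finset.card_insert_of_notMem hiJ]
        refine dlogProd_mem_torus h₀ (Finset.insert_subset hi ((J.erase_subset i₁).trans hJ)) ?_
        simp [Ne.symm hii]
      change (((i :: (J.erase i₁).sort (· ≤ ·))).map fun i => dlog I i i₁).prod ∈ _
      rcases dlogProd_perm I i₁ hp with h | h <;> rw [h]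
      · exact hm
      · exact neg_mem hm
  | zero => rw [mul_zero]; exact zero_mem _
  | add x y _ _ hx hy => rw [mul_add]; exact add_mem hx hy
  | smul r x _ hx => rw [mul_smul_comm]; exact Submodule.smul_mem _ _ hx

theorem restrict_torus {I J : Finset (Fin (n + 1))} (h : I ⊆ J) {q : ℕ} {ω : ChartForms n I}
    (hω : ω ∈ torus I q) : restrict h ω ∈ torus J q := by
  induction hω using Submodule.span_induction with
  | mem x hx =>
    obtain ⟨i₀, K, hl, hi, hK, hc, rfl⟩ := hx
    have hJ : J.Nonempty := ⟨i₀, h (hK hi)⟩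
    have hj : IsLeast (J : Set (Fin (n + 1))) (J.min' hJ) := Finset.isLeast_min' J hJ
    have key : ∀ l : List (Fin (n + 1)), (∀ i ∈ l, i ∈ I) →
        restrict h (l.map fun i => dlog I i i₀).prod ∈ torus J l.length := by
      intro l hlI
      induction l with
      | nil =>
        have := dlogProd_mem_torus hj (Finset.empty_subset J) (Finset.notMem_empty _)
        simpa [dlogProd] using this
      | cons a l ih =>
        have ha : a ∈ I := hlI a List.mem_cons_self
        rw [List.map_cons, List.prod_cons, map_mul, restrict_dlog h ha hl.1,
          dlog_sub (h ha) (h hl.1) hj.1, sub_mul, List.length_cons]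
        have := ih fun i hi => hlI i (List.mem_cons_of_mem _ hi)
        exact sub_mem (dlog_mul_torus hj (h ha) this) (dlog_mul_torus hj (h hl.1) this)
    have := key ((K.erase i₀).sort (· ≤ ·)) fun i hi' =>
      hK (Finset.erase_subset _ _ ((Finset.mem_sort _).1 hi'))
    rwa [Finset.length_sort, Finset.card_erase_of_mem hi, hc, Nat.add_sub_cancel] at this
  | zero => rw [map_zero]; exact zero_mem _
  | add x y _ _ hx hy => rw [map_add]; exact add_mem hx hy
  | smul r x _ hx => rw [map_smul]; exact Submodule.smul_mem _ _ hx

/-- The cochains of degree `m` of the total complex of the torus complexes: those Čech–de Rham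
cochains whose component on each `P_I` lies in `T_I^q`, where `(|I| - 1) + q = m`. -/
def torusCochains (n m : ℕ) : Submodule ℂ (Family n) where
  carrier := {ω | (∀ I q, I.Nonempty → I.card + q = m + 1 → ω I ∈ torus I q) ∧
    ∀ I, I = ∅ ∨ m + 1 < I.card → ω I = 0}
  add_mem' h h' := ⟨fun I q hn hI => add_mem (h.1 I q hn hI) (h'.1 I q hn hI), fun I hI => by
    rw [Pi.add_apply, h.2 I hI, h'.2 I hI, add_zero]⟩
  zero_mem' := ⟨fun _ _ _ _ => zero_mem _, fun _ _ => rfl⟩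
  smul_mem' r ω h := ⟨fun I q hn hI => Submodule.smul_mem _ _ (h.1 I q hn hI), fun I hI => by
    rw [Pi.smul_apply, h.2 I hI, smul_zero]⟩

theorem torusCochains_le (n m : ℕ) : torusCochains n m ≤ cochains n m := by
  intro ω h
  refine ⟨fun I q hI => ?_, h.2⟩
  rcases I.eq_empty_or_nonempty with rfl | hn
  · rw [h.2 _ (Or.inl rfl)]; exact zero_mem _
  · exact torus_le (h.1 I q hn hI)

theorem totalD_torus_mem {m : ℕ} {ω : Family n} (h : ω ∈ torusCochains n m) :
    totalD ω ∈ torusCochains n (m + 1) := by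
  refine ⟨fun I q hn hI => ?_, (totalD_mem (torusCochains_le n m h)).2⟩
  rw [totalD_apply]
  refine add_mem (Submodule.sum_mem _ fun j hj => ?_) (Submodule.smul_mem _ _ ?_)
  · have hc := Finset.card_erase_add_one hj
    rcases (I.erase j).eq_empty_or_nonempty with he | he
    · rw [h.2 _ (Or.inl he), map_zero, smul_zero]; exact zero_mem _
    · exact Submodule.smul_mem _ _ (restrict_torus _ (h.1 _ q he (by omega)))
  · rcases q with _ | q
    · rw [h.2 I (Or.inr (by omega)), map_zero]; exact zero_mem _
    · rw [extD_torus (h.1 I q hn (by omega))]; exact zero_mem _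

/-- The total complex of the torus complexes `T_I^•`, a subcomplex of the Čech–de Rham complex. -/
def torusTotal (n : ℕ) : CochainComplex (ModuleCat ℂ) ℕ :=
  totalComplex (torusCochains n) fun _ _ h => totalD_torus_mem h

/-- The inclusion of the total complex of the torus complexes in the Čech–de Rham complex. -/
def torusInclusion (n : ℕ) : torusTotal n ⟶ cechDeRham n :=
  CochainComplex.ofHom
    (fun m => ModuleCat.ofHom (Submodule.inclusion (torusCochains_le n m)))
    (fun m => by
      simp only [torusTotal, cechDeRham, totalComplex, CochainComplex.of_d]
      rfl)

/-- The family `c_k`, with the component `∏_{i₀ < i ∈ I} d(x_i/x_{i₀}) / (x_i/x_{i₀})` on `P_I` for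
`I = {i₀ < ⋯ < i_k}`, and zero component for `|I| ≠ k + 1`. -/
def chernFamily (n k : ℕ) : Family n := fun I =>
  if h : I.card = k + 1 then
    dlogProd I (I.min' (Finset.card_pos.1 (by omega)))
      (I.erase (I.min' (Finset.card_pos.1 (by omega))))
  else 0

theorem chernFamily_mem (n k : ℕ) : chernFamily n k ∈ torusCochains n (2 * k) := by
  refine ⟨fun I q hn hI => ?_, fun I hI => ?_⟩
  · unfold chernFamily
    split_ifs with h
    · obtain rfl : q = k := by omega
      exact Submodule.subset_span ⟨_, I, Finset.isLeast_min' I hn, Finset.min'_mem I hn,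
        Finset.Subset.refl I, h, rfl⟩
    · exact zero_mem _
  · rw [chernFamily, dif_neg]
    rcases hI with rfl | hI
    · simp
    · omega

/-- The element `c_k` of degree `2k` of the total complex of the torus complexes. -/
def chernCochain (n k : ℕ) : (torusTotal n).X (2 * k) :=
  (⟨chernFamily n k, chernFamily_mem n k⟩ : torusCochains n (2 * k))

end CechDeRham

end

noncomputable section

open CategoryTheory KaehlerDifferential

namespace CechDeRham

attribute [local instance] MvPolynomial.gradedAlgebra

variable {n : ℕ}

/-! The cohomology is carried by the torus-invariant forms. Fix complex numbers c_j that are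
linearly independent over ℚ, and let v = ∑ c_j x_j ∂/∂x_j. The forms on a chart are spanned by
eigenforms of the Lie derivative L_v, namely monomials times products of the d(x_j/x_{i₀}). The
eigenvalue is the sum of the c_j weighted by the total exponents, so it vanishes only when all
exponents do, and then the form is a product of logarithmic differentials. Hence L_v is
diagonalizable with kernel T_I (`lie_monForm`, `monForm_mem_torus`, `lie_eq_zero_of_lie_lie`). With
a sign, contraction with v is a homotopy from L_v to 0 on the total complex (`totalD_contrFamily`),
so the inclusion of ker L_v is a quasi-isomorphism (`exists_torus_cohomologous`,
`exists_torus_totalD_eq`).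

On the torus complexes d vanishes and only δ remains. Since dlog(x_i/x_j) behaves like e_i - e_j in
an exterior algebra on e_0, …, e_n, the space T_I^q is the kernel of the Koszul contraction `kos`
(e_i ↦ 1) on Λ^q(ℂ^I). In this description restriction is an inclusion, free of the choice of i₀
(`restrict_realize`, `exists_realize_eq`, `eq_zero_of_realize_eq_zero`).

The Čech complex of I ↦ Λ^q(ℂ^I), with I = ∅ included, splits according to the set K of generators
that occur. For s ∉ K, inserting s into I contracts the summand of K, so everything is acyclic
except for K = {0, …, n} (`modelD_insertH`, `modelD_mem_exact`). The exact sequences 0 → ker kos →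
Λ^q → ker kos → 0 for nonempty I therefore shift cohomology by two total degrees. This descent ends
with the constants at I = ∅ and gives at most one class in each even degree
(`exists_modelChern_add`). The Čech and Koszul differentials agree on the products e_I
(`kos_topFamily`), so the descent takes c_{k+1} to c_k, and c_k is nonzero as long as k ≤ n
(`eq_zero_of_smul_modelChern`). -/

/-! ## Monomials and Euler derivations on the charts -/

/-- The number `∑ j, c j * a j`. -/
def pairing (c : Fin (n + 1) → ℂ) (a : Fin (n + 1) →₀ ℕ) : ℂ := ∑ j, c j * a j

theorem pairing_add (c : Fin (n + 1) → ℂ) (a b : Fin (n + 1) →₀ ℕ) :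
    pairing c (a + b) = pairing c a + pairing c b := by
  simp [pairing, mul_add, Finset.sum_add_distrib]

theorem pairing_single (c : Fin (n + 1) → ℂ) (j : Fin (n + 1)) :
    pairing c (Finsupp.single j 1) = c j := by
  simp [pairing, Finsupp.single_apply]

/-- The monomial `x^a`. -/
abbrev mon (a : Fin (n + 1) →₀ ℕ) : Coord n := MvPolynomial.monomial a 1

theorem mon_add (a b : Fin (n + 1) →₀ ℕ) : mon (a + b) = mon a * mon b := by
  simp [MvPolynomial.monomial_mul]

/-- The ring `ℂ[x₀, …, xₙ, x_i⁻¹ : i ∈ I]`. -/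
abbrev Loc (n : ℕ) (I : Finset (Fin (n + 1))) : Type := Localization (coordMonoid n I)

/-- The localization homomorphism. -/
abbrev toLoc (I : Finset (Fin (n + 1))) : Coord n →+* Loc n I := algebraMap (Coord n) (Loc n I)

/-- The function `m` on `P_I` is the monomial `x^a / x^b`, where `b` is supported in `I`. -/
def IsMon (I : Finset (Fin (n + 1))) (a b : Fin (n + 1) →₀ ℕ) (m : ChartRing n I) : Prop :=
  (∀ j ∉ I, b j = 0) ∧ m.val * toLoc I (mon b) = toLoc I (mon a)

theorem mon_mem {I : Finset (Fin (n + 1))} {b : Fin (n + 1) →₀ ℕ} (hb : ∀ j ∉ I, b j = 0) :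
    mon b ∈ coordMonoid n I := by
  rw [mon, MvPolynomial.monomial_eq, map_one, one_mul]
  refine Submonoid.prod_mem _ fun j hj =>
    Submonoid.pow_mem _ (Submonoid.subset_closure (Set.mem_image_of_mem _ ?_)) _
  by_contra h
  exact (Finsupp.mem_support_iff.1 hj) (hb j h)

theorem exists_mon_of_mem {I : Finset (Fin (n + 1))} {p : Coord n} (hp : p ∈ coordMonoid n I) :
    ∃ b : Fin (n + 1) →₀ ℕ, (∀ j ∉ I, b j = 0) ∧ p = mon b := by
  induction hp using Submonoid.closure_induction with
  | mem x hx =>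
    obtain ⟨i, hi, rfl⟩ := hx
    refine ⟨Finsupp.single i 1, fun j hj => ?_, rfl⟩
    rw [Finsupp.single_apply, if_neg]
    rintro rfl; exact hj hi
  | one => exact ⟨0, fun _ _ => rfl, rfl⟩
  | mul x y _ _ hx hy =>
    obtain ⟨a, ha, rfl⟩ := hx
    obtain ⟨b, hb, rfl⟩ := hy
    exact ⟨a + b, fun j hj => by simp [ha j hj, hb j hj], (mon_add a b).symm⟩

theorem isUnit_mon {I : Finset (Fin (n + 1))} {b : Fin (n + 1) →₀ ℕ} (hb : ∀ j ∉ I, b j = 0) :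
    IsUnit (toLoc I (mon b)) :=
  IsLocalization.map_units (Loc n I) (⟨_, mon_mem hb⟩ : coordMonoid n I)

theorem IsMon.mul {I : Finset (Fin (n + 1))} {a b a' b' : Fin (n + 1) →₀ ℕ} {m m' : ChartRing n I}
    (h : IsMon I a b m) (h' : IsMon I a' b' m') : IsMon I (a + a') (b + b') (m * m') := by
  refine ⟨fun j hj => by simp [h.1 j hj, h'.1 j hj], ?_⟩
  rw [mon_add, mon_add, map_mul, map_mul, ← h.2, ← h'.2, HomogeneousLocalization.val_mul,
    mul_mul_mul_comm]

theorem isMon_one (I : Finset (Fin (n + 1))) : IsMon I 0 0 1 :=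
  ⟨fun _ _ => rfl, by rw [HomogeneousLocalization.val_one, one_mul]⟩

theorem IsMon.eq_one {I : Finset (Fin (n + 1))} {a : Fin (n + 1) →₀ ℕ} {m : ChartRing n I}
    (h : IsMon I a a m) : m = 1 := by
  apply HomogeneousLocalization.val_injective
  refine (isUnit_mon h.1).mul_right_cancel ?_
  rw [h.2, HomogeneousLocalization.val_one, one_mul]

theorem val_mk_mul {I : Finset (Fin (n + 1))} (p : Coord n) (q : coordMonoid n I) :
    (Localization.mk p q : Loc n I) * toLoc I q = toLoc I p := by
  rw [Localization.mk_eq_mk']; exact IsLocalization.mk'_spec _ p q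

theorem isMon_ratio {I : Finset (Fin (n + 1))} (i : Fin (n + 1)) {j : Fin (n + 1)} (hj : j ∈ I) :
    IsMon I (Finsupp.single i 1) (Finsupp.single j 1) (ratio I i j) := by
  refine ⟨fun l hl => ?_, ?_⟩
  · rw [Finsupp.single_apply, if_neg]
    rintro rfl; exact hl hj
  · rw [ratio_val hj]; exact val_mk_mul _ _

/-- The denominators allowed on P_I are themselves monomials, so splitting the numerator of a
fraction into its terms suffices. Linear statements about functions can then be checked on
monomials, the eigenvectors of the Euler derivations. -/
theorem span_isMon (I : Finset (Fin (n + 1))) :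
    Submodule.span ℂ {m : ChartRing n I | ∃ a b, IsMon I a b m} = ⊤ := by
  rw [eq_top_iff]
  rintro x -
  obtain ⟨⟨d, ⟨p, hp⟩, ⟨q, hq⟩, hq'⟩, rfl⟩ := x.mk_surjective
  change q ∈ _ at hq'
  obtain ⟨b, hb, rfl⟩ := exists_mon_of_mem hq'
  have key : ∀ a ∈ p.support, mon a ∈ MvPolynomial.homogeneousSubmodule (Fin (n + 1)) ℂ d :=
    fun a ha => MvPolynomial.isHomogeneous_monomial _ (by
      have := hp (MvPolynomial.mem_support_iff.1 ha)
      rwa [Finsupp.degree_eq_weight_one])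
  have : (HomogeneousLocalization.mk ⟨d, ⟨p, hp⟩, ⟨_, hq⟩, hq'⟩ : ChartRing n I) =
      ∑ a ∈ p.support.attach, MvPolynomial.coeff a.1 p •
        (HomogeneousLocalization.mk ⟨d, ⟨_, key a.1 a.2⟩, ⟨_, hq⟩, hq'⟩ : ChartRing n I) := by
    apply HomogeneousLocalization.val_injective
    refine (isUnit_mon hb).mul_right_cancel ?_
    have hs : ∀ (s : Finset p.support) (f : p.support → ChartRing n I),
        (∑ a ∈ s, f a).val = ∑ a ∈ s, (f a).val := fun s f =>
      map_sum (algebraMap (ChartRing n I) (Loc n I)) f s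
    rw [hs, Finset.sum_mul, HomogeneousLocalization.val_mk]
    refine (val_mk_mul p ⟨_, hq'⟩).trans ?_
    conv_lhs => rw [p.as_sum, ← Finset.sum_attach, map_sum]
    refine Finset.sum_congr rfl fun a _ => ?_
    rw [HomogeneousLocalization.val_smul, HomogeneousLocalization.val_mk, smul_mul_assoc]
    refine Eq.trans ?_ (congrArg _ (val_mk_mul (mon a.1) ⟨_, hq'⟩).symm)
    rw [show MvPolynomial.monomial a.1 (MvPolynomial.coeff a.1 p) =
      MvPolynomial.coeff a.1 p • mon a.1 by simp [MvPolynomial.smul_monomial]]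
    exact map_smul (Algebra.algHom ℂ (Coord n) (Loc n I)) _ _
  rw [this]
  refine Submodule.sum_mem _ fun a _ =>
    Submodule.smul_mem _ _ (Submodule.subset_span ⟨a, b, hb, ?_⟩)
  rw [HomogeneousLocalization.val_mk]
  exact val_mk_mul _ ⟨_, hq'⟩

theorem toLoc_injective (I : Finset (Fin (n + 1))) : Function.Injective (toLoc I) := by
  refine IsLocalization.injective _ (M := coordMonoid n I) fun x hx => ?_
  obtain ⟨b, hb, rfl⟩ := exists_mon_of_mem hx
  exact mem_nonZeroDivisors_of_ne_zero (by simp)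

/-- After denominators are cleared the relation holds among polynomials, because `toLoc I` is
injective; from there it passes to any larger localization. -/
theorem isMon_restrictFn {I J : Finset (Fin (n + 1))} (h : I ⊆ J) {a b : Fin (n + 1) →₀ ℕ}
    {m : ChartRing n I} (hm : IsMon I a b m) : IsMon J a b (restrictFn h m) := by
  refine ⟨fun j hj => hm.1 j fun h' => hj (h h'), ?_⟩
  obtain ⟨⟨d, ⟨p, hp⟩, ⟨q, hq⟩, hq'⟩, rfl⟩ := m.mk_surjective
  change q ∈ _ at hq'
  have e : restrictFn h (HomogeneousLocalization.mk ⟨d, ⟨p, hp⟩, ⟨q, hq⟩, hq'⟩) =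
      HomogeneousLocalization.mk ⟨d, ⟨p, hp⟩, ⟨q, hq⟩, coordMonoid_mono h hq'⟩ := rfl
  have h1 : p * mon b = mon a * q := by
    apply toLoc_injective I
    have h2 := hm.2
    rw [HomogeneousLocalization.val_mk] at h2
    rw [map_mul, map_mul, ← h2]
    refine Eq.trans ?_ (mul_right_comm _ _ _)
    exact congrArg (· * toLoc I (mon b)) (val_mk_mul p (⟨q, hq'⟩ : coordMonoid n I)).symm
  rw [e, HomogeneousLocalization.val_mk]
  refine (IsLocalization.map_units (Loc n J)
    (⟨q, coordMonoid_mono h hq'⟩ : coordMonoid n J)).mul_right_cancel ?_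
  refine (mul_right_comm _ _ _).trans ?_
  refine (congrArg (· * toLoc J (mon b))
    (val_mk_mul p (⟨q, coordMonoid_mono h hq'⟩ : coordMonoid n J))).trans ?_
  change toLoc J p * toLoc J (mon b) = toLoc J (mon a) * toLoc J q
  rw [← map_mul, h1, map_mul]

/-! ### The Euler derivations -/

/-- The homomorphism `x_j ↦ x_j + ε c_j x_j` to the dual numbers. -/
def eulerHom (c : Fin (n + 1) → ℂ) (I : Finset (Fin (n + 1))) :
    Coord n →ₐ[ℂ] DualNumber (Loc n I) :=
  MvPolynomial.aeval fun j => (TrivSqZeroExt.inl (toLoc I (MvPolynomial.X j)) +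
      TrivSqZeroExt.inr (c j • toLoc I (MvPolynomial.X j)) : DualNumber (Loc n I))

theorem eulerHom_X (c : Fin (n + 1) → ℂ) (I : Finset (Fin (n + 1))) (j : Fin (n + 1)) :
    eulerHom c I (MvPolynomial.X j) = TrivSqZeroExt.inl (toLoc I (MvPolynomial.X j)) +
      TrivSqZeroExt.inr (c j • toLoc I (MvPolynomial.X j)) := MvPolynomial.aeval_X _ _

theorem eulerHom_fst (c : Fin (n + 1) → ℂ) (I : Finset (Fin (n + 1))) (p : Coord n) :
    (eulerHom c I p).fst = toLoc I p := by
  have : (TrivSqZeroExt.fstHom ℂ (Loc n I) (Loc n I)).comp (eulerHom c I) =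
      Algebra.algHom ℂ (Coord n) (Loc n I) := by
    refine MvPolynomial.algHom_ext fun j => ?_
    rw [AlgHom.comp_apply, eulerHom_X]
    simp only [TrivSqZeroExt.fstHom_apply, TrivSqZeroExt.fst_add, TrivSqZeroExt.fst_inl,
      TrivSqZeroExt.fst_inr, add_zero]
    rfl
  exact DFunLike.congr_fun this p

/-- The ε-coefficient of a homomorphism to the dual numbers is a derivation over its constant part;
here it is ∑ c_j x_j ∂/∂x_j. -/
theorem eulerHom_mul_snd (c : Fin (n + 1) → ℂ) (I : Finset (Fin (n + 1))) (p q : Coord n) :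
    (eulerHom c I (p * q)).snd =
      toLoc I p * (eulerHom c I q).snd + toLoc I q * (eulerHom c I p).snd := by
  rw [map_mul, TrivSqZeroExt.snd_mul, eulerHom_fst, eulerHom_fst,
    MulOpposite.smul_eq_mul_unop, smul_eq_mul, MulOpposite.unop_op]
  congr 1
  exact mul_comm _ _

theorem eulerHom_mon_snd (c : Fin (n + 1) → ℂ) (I : Finset (Fin (n + 1)))
    (a : Fin (n + 1) →₀ ℕ) : (eulerHom c I (mon a)).snd = pairing c a • toLoc I (mon a) := by
  have key : ∀ a b : Fin (n + 1) →₀ ℕ, (eulerHom c I (mon a)).snd = pairing c a • toLoc I (mon a) →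
      (eulerHom c I (mon b)).snd = pairing c b • toLoc I (mon b) →
      (eulerHom c I (mon (a + b))).snd = pairing c (a + b) • toLoc I (mon (a + b)) := by
    intro a b ha hb
    rw [mon_add, eulerHom_mul_snd, ha, hb, map_mul, pairing_add, add_smul, mul_smul_comm,
      mul_smul_comm, add_comm, mul_comm (toLoc I (mon b))]
  have h0 : (eulerHom c I (mon 0)).snd = pairing c 0 • toLoc I (mon 0) := by
    have : mon (0 : Fin (n + 1) →₀ ℕ) = 1 := rfl
    rw [this, map_one, TrivSqZeroExt.snd_one, pairing]; simp
  induction a using Finsupp.induction_linear with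
  | zero => exact h0
  | add a b ha hb => exact key a b ha hb
  | single j k =>
    induction k with
    | zero => rw [Finsupp.single_zero]; exact h0
    | succ k ih =>
      rw [Finsupp.single_add]
      refine key _ _ ih ?_
      rw [pairing_single]
      change (eulerHom c I (MvPolynomial.X j)).snd = _
      rw [eulerHom_X, TrivSqZeroExt.snd_add, TrivSqZeroExt.snd_inl, zero_add,
        TrivSqZeroExt.snd_inr]
      rfl

/-- `eulerHom` as a ring homomorphism. -/
def eulerRingHom (c : Fin (n + 1) → ℂ) (I : Finset (Fin (n + 1))) :
    Coord n →+* DualNumber (Loc n I) := (eulerHom c I).toRingHom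

theorem eulerRingHom_apply (c : Fin (n + 1) → ℂ) (I : Finset (Fin (n + 1))) (p : Coord n) :
    eulerRingHom c I p = eulerHom c I p := rfl

/-- A dual number is invertible as soon as its constant part is, so the derivation extends to the
localization without a quotient rule. -/
theorem isUnit_eulerRingHom (c : Fin (n + 1) → ℂ) (I : Finset (Fin (n + 1)))
    (y : coordMonoid n I) : IsUnit (eulerRingHom c I y) := by
  rw [eulerRingHom_apply]
  refine TrivSqZeroExt.isUnit_iff_isUnit_fst.2 ?_
  rw [eulerHom_fst]
  exact IsLocalization.map_units _ y

/-- The extension of `eulerHom` to the localization. -/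
def eulerLift (c : Fin (n + 1) → ℂ) (I : Finset (Fin (n + 1))) :
    Loc n I →+* DualNumber (Loc n I) :=
  IsLocalization.lift (M := coordMonoid n I) (S := Loc n I) (P := DualNumber (Loc n I))
    (isUnit_eulerRingHom c I)

theorem eulerLift_toLoc (c : Fin (n + 1) → ℂ) (I : Finset (Fin (n + 1))) (p : Coord n) :
    eulerLift c I (toLoc I p) = eulerHom c I p := by
  rw [eulerLift, toLoc, IsLocalization.lift_eq, eulerRingHom_apply]

theorem eulerLift_fst (c : Fin (n + 1) → ℂ) (I : Finset (Fin (n + 1)))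
    (x : Loc n I) : (eulerLift c I x).fst = x := by
  have : (TrivSqZeroExt.fstHom ℂ (Loc n I) (Loc n I)).toRingHom.comp (eulerLift c I) =
      RingHom.id (Loc n I) := by
    refine IsLocalization.ringHom_ext (coordMonoid n I) (RingHom.ext fun p => ?_)
    change (eulerLift c I (toLoc I p)).fst = _
    rw [eulerLift_toLoc, eulerHom_fst]; rfl
  exact DFunLike.congr_fun this x

theorem eulerLift_mul_snd (c : Fin (n + 1) → ℂ) (I : Finset (Fin (n + 1))) (x y : Loc n I) :
    (eulerLift c I (x * y)).snd = x * (eulerLift c I y).snd + y * (eulerLift c I x).snd := by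
  rw [map_mul, TrivSqZeroExt.snd_mul, eulerLift_fst, eulerLift_fst,
    MulOpposite.smul_eq_mul_unop, smul_eq_mul, MulOpposite.unop_op, mul_comm y]

/-- Apply the Leibniz rule to m · x^b = x^a and cancel the unit x^b. -/
theorem eulerLift_isMon (c : Fin (n + 1) → ℂ) {I : Finset (Fin (n + 1))}
    {a b : Fin (n + 1) →₀ ℕ} {m : ChartRing n I} (hm : IsMon I a b m) :
    (eulerLift c I m.val).snd = (pairing c a - pairing c b) • m.val := by
  have h := congrArg (fun x => (eulerLift c I x).snd) hm.2
  simp only [eulerLift_mul_snd, eulerLift_toLoc, eulerHom_mon_snd] at h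
  refine (isUnit_mon hm.1).mul_right_cancel ?_
  simp only [← hm.2, Algebra.smul_def, map_sub] at h ⊢
  linear_combination h

theorem eulerLift_smul_snd (c : Fin (n + 1) → ℂ) {I : Finset (Fin (n + 1))} (r : ℂ)
    (x : Loc n I) : (eulerLift c I (r • x)).snd = r • (eulerLift c I x).snd := by
  have h : (eulerLift c I (algebraMap ℂ _ r)).snd = 0 := by
    rw [IsScalarTower.algebraMap_apply ℂ (Coord n), eulerLift_toLoc, AlgHom.commutes,
      TrivSqZeroExt.algebraMap_eq_inl', TrivSqZeroExt.snd_inl]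
  rw [Algebra.smul_def, eulerLift_mul_snd, h, mul_zero, add_zero, Algebra.smul_def]

/-- The derivation of the localization preserves the part of degree zero, since it only rescales the
monomials that span that part. -/
theorem exists_eulerLift (c : Fin (n + 1) → ℂ) {I : Finset (Fin (n + 1))} (x : ChartRing n I) :
    ∃ y : ChartRing n I, y.val = (eulerLift c I x.val).snd := by
  have hx : x ∈ Submodule.span ℂ {m : ChartRing n I | ∃ a b, IsMon I a b m} := by
    rw [span_isMon]; trivial
  induction hx using Submodule.span_induction with
  | mem m hm =>
    obtain ⟨a, b, hm⟩ := hm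
    exact ⟨(pairing c a - pairing c b) • m, by
      rw [eulerLift_isMon c hm, HomogeneousLocalization.val_smul]⟩
  | zero => exact ⟨0, by simp⟩
  | add x y _ _ hx hy =>
    obtain ⟨x', hx⟩ := hx
    obtain ⟨y', hy⟩ := hy
    exact ⟨x' + y', by simp [hx, hy]⟩
  | smul r x _ hx =>
    obtain ⟨x', hx⟩ := hx
    exact ⟨r • x', by
      rw [HomogeneousLocalization.val_smul, HomogeneousLocalization.val_smul, eulerLift_smul_snd,
        hx]⟩

/-- The action of `∑ c_j x_j ∂/∂x_j` on the functions on `P_I`. -/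
def eulerFun (c : Fin (n + 1) → ℂ) {I : Finset (Fin (n + 1))} (x : ChartRing n I) :
    ChartRing n I := (exists_eulerLift c x).choose

theorem eulerFun_val (c : Fin (n + 1) → ℂ) {I : Finset (Fin (n + 1))} (x : ChartRing n I) :
    (eulerFun c x).val = (eulerLift c I x.val).snd := (exists_eulerLift c x).choose_spec

/-- The Euler derivation `∑ c_j x_j ∂/∂x_j` on the functions on `P_I`. -/
def euler (c : Fin (n + 1) → ℂ) (I : Finset (Fin (n + 1))) :
    Derivation ℂ (ChartRing n I) (ChartRing n I) where
  toFun x := eulerFun c x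
  map_add' x y := by
    apply HomogeneousLocalization.val_injective
    simp only [HomogeneousLocalization.val_add, eulerFun_val, map_add, TrivSqZeroExt.snd_add]
  map_smul' r x := by
    apply HomogeneousLocalization.val_injective
    simp only [RingHom.id_apply, HomogeneousLocalization.val_smul, eulerFun_val, eulerLift_smul_snd]
  map_one_eq_zero' := by
    apply HomogeneousLocalization.val_injective
    change (eulerFun c 1).val = _
    simp [eulerFun_val]
  leibniz' x y := by
    apply HomogeneousLocalization.val_injective
    change (eulerFun c (x * y)).val = (x * eulerFun c y + y * eulerFun c x).val
    simp only [HomogeneousLocalization.val_add, HomogeneousLocalization.val_mul, eulerFun_val,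
      eulerLift_mul_snd]

theorem euler_isMon (c : Fin (n + 1) → ℂ) {I : Finset (Fin (n + 1))}
    {a b : Fin (n + 1) →₀ ℕ} {m : ChartRing n I} (hm : IsMon I a b m) :
    euler c I m = (pairing c a - pairing c b) • m := by
  apply HomogeneousLocalization.val_injective
  rw [HomogeneousLocalization.val_smul, ← eulerLift_isMon c hm]
  exact eulerFun_val c m

theorem euler_ratio (c : Fin (n + 1) → ℂ) {I : Finset (Fin (n + 1))} (i : Fin (n + 1))
    {j : Fin (n + 1)} (hj : j ∈ I) : euler c I (ratio I i j) = (c i - c j) • ratio I i j := by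
  rw [euler_isMon c (isMon_ratio i hj), pairing_single, pairing_single]

theorem restrictFn_euler (c : Fin (n + 1) → ℂ) {I J : Finset (Fin (n + 1))} (h : I ⊆ J)
    (x : ChartRing n I) : restrictFn h (euler c I x) = euler c J (restrictFn h x) := by
  have hx : x ∈ Submodule.span ℂ {m : ChartRing n I | ∃ a b, IsMon I a b m} := by
    rw [span_isMon]; trivial
  induction hx using Submodule.span_induction with
  | mem m hm =>
    obtain ⟨a, b, hm⟩ := hm
    rw [euler_isMon c hm, euler_isMon c (isMon_restrictFn h hm), map_smul]
  | zero => simp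
  | add x y _ _ hx hy => simp only [map_add, hx, hy]
  | smul r x _ hx => simp only [map_smul, Derivation.map_smul, hx]

/-! ### The differentials of the affine coordinates generate -/

/-- Dehomogenization: `x_j ↦ x_j / x_{i₀}`. -/
def dehom (I : Finset (Fin (n + 1))) (i₀ : Fin (n + 1)) : Coord n →ₐ[ℂ] ChartRing n I :=
  MvPolynomial.aeval fun j => ratio I j i₀

theorem dehom_mon {I : Finset (Fin (n + 1))} {i₀ : Fin (n + 1)} (h₀ : i₀ ∈ I)
    (a : Fin (n + 1) →₀ ℕ) : IsMon I a (Finsupp.single i₀ a.degree) (dehom I i₀ (mon a)) := by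
  have h0 : IsMon I (0 : Fin (n + 1) →₀ ℕ) (Finsupp.single i₀ 0) (dehom I i₀ (mon 0)) := by
    rw [show mon (0 : Fin (n + 1) →₀ ℕ) = 1 from rfl, map_one, Finsupp.single_zero]
    exact isMon_one I
  induction a using Finsupp.induction_linear with
  | zero => simpa using h0
  | add a b ha hb =>
    rw [mon_add, map_mul, map_add, Finsupp.single_add]
    exact ha.mul hb
  | single j k =>
    rw [Finsupp.degree_single]
    induction k with
    | zero => simpa using h0
    | succ k ih =>
      rw [Finsupp.single_add, mon_add, map_mul, Finsupp.single_add]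
      refine ih.mul ?_
      have : dehom I i₀ (mon (Finsupp.single j 1)) = ratio I j i₀ := MvPolynomial.aeval_X _ _
      rw [this]
      exact isMon_ratio j h₀

/-- This is p(x) = x_{i₀}^d · p(x/x_{i₀}) for homogeneous p, checked term by term. -/
theorem dehom_val {I : Finset (Fin (n + 1))} {i₀ : Fin (n + 1)} (h₀ : i₀ ∈ I) {d : ℕ}
    {p : Coord n} (hp : p ∈ MvPolynomial.homogeneousSubmodule (Fin (n + 1)) ℂ d) :
    (dehom I i₀ p).val * toLoc I (mon (Finsupp.single i₀ d)) = toLoc I p := by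
  have hs : ∀ (s : Finset (Fin (n + 1) →₀ ℕ)) (f : (Fin (n + 1) →₀ ℕ) → ChartRing n I),
      (∑ a ∈ s, f a).val = ∑ a ∈ s, (f a).val := fun s f =>
    map_sum (algebraMap (ChartRing n I) (Loc n I)) f s
  conv_lhs => rw [p.as_sum]
  conv_rhs => rw [p.as_sum]
  rw [map_sum, map_sum, hs, Finset.sum_mul]
  refine Finset.sum_congr rfl fun a ha => ?_
  have hd : a.degree = d := by
    have := hp (MvPolynomial.mem_support_iff.1 ha)
    rwa [Finsupp.degree_eq_weight_one]
  rw [show MvPolynomial.monomial a (MvPolynomial.coeff a p) =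
      MvPolynomial.coeff a p • mon a by simp [MvPolynomial.smul_monomial], map_smul,
    HomogeneousLocalization.val_smul, smul_mul_assoc, ← hd, (dehom_mon h₀ a).2]
  exact (map_smul (Algebra.algHom ℂ (Coord n) (Loc n I)) _ _).symm

theorem isUnit_dehom {I : Finset (Fin (n + 1))} {i₀ : Fin (n + 1)} (h₀ : i₀ ∈ I) {p : Coord n}
    (hp : p ∈ coordMonoid n I) : IsUnit (dehom I i₀ p) := by
  induction hp using Submonoid.closure_induction with
  | mem x hx =>
    obtain ⟨i, hi, rfl⟩ := hx
    rw [show dehom I i₀ (MvPolynomial.X i) = ratio I i i₀ from MvPolynomial.aeval_X _ _]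
    exact IsUnit.of_mul_eq_one (ratio I i₀ i) (by rw [ratio_mul h₀ hi, ratio_self hi])
  | one => rw [map_one]; exact isUnit_one
  | mul x y _ _ hx hy => rw [map_mul]; exact hx.mul hy

theorem exists_dehom {I : Finset (Fin (n + 1))} {i₀ : Fin (n + 1)} (h₀ : i₀ ∈ I)
    (x : ChartRing n I) :
    ∃ p q : Coord n, x * dehom I i₀ q = dehom I i₀ p ∧ IsUnit (dehom I i₀ q) := by
  obtain ⟨⟨d, ⟨p, hp⟩, ⟨q, hq⟩, hq'⟩, rfl⟩ := x.mk_surjective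
  change q ∈ _ at hq'
  refine ⟨p, q, ?_, isUnit_dehom h₀ hq'⟩
  apply HomogeneousLocalization.val_injective
  have hu : IsUnit (toLoc I (mon (Finsupp.single i₀ d))) := isUnit_mon fun j hj => by
    rw [Finsupp.single_apply, if_neg]
    rintro rfl; exact hj h₀
  refine hu.mul_right_cancel ?_
  rw [HomogeneousLocalization.val_mul, mul_assoc, dehom_val h₀ hq, dehom_val h₀ hp,
    HomogeneousLocalization.val_mk]
  exact val_mk_mul p (⟨q, hq'⟩ : coordMonoid n I)

theorem span_D_ratio {I : Finset (Fin (n + 1))} {i₀ : Fin (n + 1)} (h₀ : i₀ ∈ I) :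
    Submodule.span (ChartRing n I) (Set.range fun j => D ℂ (ChartRing n I) (ratio I j i₀)) = ⊤ := by
  rw [eq_top_iff, ← span_range_derivation, Submodule.span_le]
  rintro _ ⟨x, rfl⟩
  have key : ∀ p : Coord n, D ℂ (ChartRing n I) (dehom I i₀ p) ∈ Submodule.span (ChartRing n I)
      (Set.range fun j => D ℂ (ChartRing n I) (ratio I j i₀)) := by
    intro p
    induction p using MvPolynomial.induction_on with
    | C r =>
      rw [← MvPolynomial.algebraMap_eq, AlgHom.commutes, Derivation.map_algebraMap]
      exact zero_mem _
    | add p q hp hq => rw [map_add, map_add]; exact add_mem hp hq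
    | mul_X p j hp =>
      rw [map_mul, Derivation.leibniz]
      refine add_mem (Submodule.smul_mem _ _ ?_) (Submodule.smul_mem _ _ hp)
      rw [show dehom I i₀ (MvPolynomial.X j) = ratio I j i₀ from MvPolynomial.aeval_X _ _]
      exact Submodule.subset_span ⟨j, rfl⟩
  -- Every function x satisfies x q = p with p, q polynomials in the x_j/x_{i₀} and q a unit, so q
  -- dx = dp - x dq reduces the claim to polynomials.
  obtain ⟨p, q, h, hq⟩ := exists_dehom h₀ x
  have h1 := congrArg (D ℂ (ChartRing n I)) h
  rw [Derivation.leibniz, ← eq_sub_iff_add_eq'] at h1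
  rw [SetLike.mem_coe, ← Submodule.smul_mem_iff_of_isUnit _ hq, h1]
  exact sub_mem (key p) (Submodule.smul_mem _ _ (key q))

/-! ## Contraction and Lie derivative -/

section Contraction

variable {k A B : Type} [CommRing k] [CommRing A] [Algebra k A] [CommRing B] [Algebra k B]

/-- Contraction of forms with the derivation `e`. -/
def contr (e : Derivation k A A) : Forms k A →ₗ[A] Forms k A :=
  CliffordAlgebra.contractLeft (Q := (0 : QuadraticForm A Ω[A⁄k])) e.liftKaehlerDifferential

theorem fn_mul (a b : A) : (fn (a * b) : Forms k A) = fn a * fn b := map_mul _ _ _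

theorem fn_add (a b : A) : (fn (a + b) : Forms k A) = fn a + fn b := map_add _ _ _

theorem fn_zero : (fn 0 : Forms k A) = 0 := map_zero _

theorem fn_one : (fn 1 : Forms k A) = 1 := map_one _

theorem smul_eq_fn_mul (a : A) (x : Forms k A) : a • x = fn a * x := Algebra.smul_def _ _

theorem scalar_smul (r : k) (x : Forms k A) : r • x = fn (algebraMap k A r) * x := by
  rw [← algebraMap_smul A r x, Algebra.smul_def]

theorem fn_smul (r : k) (a : A) : (fn (r • a) : Forms k A) = r • fn a := by
  rw [scalar_smul, Algebra.smul_def, fn_mul]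

theorem df_smul (r : k) (a : A) : (df (r • a) : Forms k A) = r • df a := by
  rw [df, Derivation.map_smul, ← algebraMap_smul A r, map_smul, algebraMap_smul]

theorem ι_smul_mul (a : A) (w : Ω[A⁄k]) (x : Forms k A) :
    ExteriorAlgebra.ι A (a • w) * x = fn a * (ExteriorAlgebra.ι A w * x) := by
  rw [map_smul, Algebra.smul_def, mul_assoc]

theorem contr_fn (e : Derivation k A A) (a : A) : contr e (fn a) = 0 :=
  CliffordAlgebra.contractLeft_algebraMap (Q := (0 : QuadraticForm A Ω[A⁄k])) _ _

theorem contr_ι_mul (e : Derivation k A A) (w : Ω[A⁄k]) (x : Forms k A) :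
    contr e (ExteriorAlgebra.ι A w * x) =
      fn (e.liftKaehlerDifferential w) * x - ExteriorAlgebra.ι A w * contr e x := by
  rw [← Algebra.smul_def]
  exact CliffordAlgebra.contractLeft_ι_mul _ _ _

theorem contr_df_mul (e : Derivation k A A) (a : A) (x : Forms k A) :
    contr e (df a * x) = fn (e a) * x - df a * contr e x := by
  rw [df, contr_ι_mul, Derivation.liftKaehlerDifferential_comp_D]

theorem contr_df (e : Derivation k A A) (a : A) : contr e (df a) = fn (e a) := by
  have := contr_df_mul e a 1
  rwa [mul_one, mul_one, ← map_one (algebraMap A (Forms k A)), contr_fn, mul_zero, sub_zero] at this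

theorem contr_fn_mul (e : Derivation k A A) (a : A) (x : Forms k A) :
    contr e (fn a * x) = fn a * contr e x := by
  rw [← Algebra.smul_def, map_smul, Algebra.smul_def]

theorem contr_mul (e : Derivation k A A) (x y : Forms k A) :
    contr e (x * y) = contr e x * y + sgn x * contr e y := by
  induction x using Forms.induction generalizing y with
  | hfn b => rw [contr_fn_mul, contr_fn, AlgHom.commutes, zero_mul, zero_add]
  | hdf b => rw [contr_df_mul, contr_df, sgn_df, neg_mul, sub_eq_add_neg]
  | hadd x x' hx hx' => rw [add_mul, map_add, hx, hx', map_add, map_add]; noncomm_ring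
  | hmul x x' hx hx' => rw [mul_assoc, hx, hx', hx, map_mul]; noncomm_ring

theorem contr_sgn (e : Derivation k A A) (x : Forms k A) :
    contr e (sgn x) = - sgn (contr e x) := by
  induction x using Forms.induction with
  | hfn b => rw [AlgHom.commutes, contr_fn, map_zero, neg_zero]
  | hdf b => rw [sgn_df, map_neg, contr_df, AlgHom.commutes]
  | hadd x y hx hy => rw [map_add, map_add, map_add, map_add, hx, hy, neg_add]
  | hmul x y hx hy =>
    rw [map_mul, contr_mul, contr_mul, map_add, map_mul, map_mul, hx, hy]; noncomm_ring

theorem contr_pullback {e : Derivation k A A} {e' : Derivation k B B} (f : A →ₐ[k] B)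
    (h : ∀ a, f (e a) = e' (f a)) (x : Forms k A) :
    pullback f (contr e x) = contr e' (pullback f x) := by
  induction x using Forms.induction with
  | hfn b => rw [contr_fn, pullback_fn, contr_fn, map_zero]
  | hdf b => rw [contr_df, pullback_fn, pullback_df, contr_df, h]
  | hadd x y hx hy => simp only [map_add, hx, hy]
  | hmul x y hx hy => simp only [map_mul, map_add, contr_mul, pullback_sgn, hx, hy]

theorem contr_of_mem_zero (e : Derivation k A A) {x : Forms k A} (hx : x ∈ ⋀[A]^0 Ω[A⁄k]) :
    contr e x = 0 := by
  change x ∈ LinearMap.range _ ^ 0 at hx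
  rw [pow_zero, Submodule.mem_one] at hx
  obtain ⟨a, rfl⟩ := hx
  exact contr_fn e a

theorem contr_mem (e : Derivation k A A) {q : ℕ} {x : Forms k A}
    (hx : x ∈ ⋀[A]^(q + 1) Ω[A⁄k]) : contr e x ∈ ⋀[A]^q Ω[A⁄k] := by
  -- The exponent is made a free variable, because the induction over powers cannot run on `q + 1`
  -- directly.
  have key : ∀ p (x : Forms k A), x ∈ ⋀[A]^p Ω[A⁄k] →
      ∀ q, p = q + 1 → contr e x ∈ ⋀[A]^q Ω[A⁄k] := by
    intro p x hx
    induction hx using Submodule.pow_induction_on_left' with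
    | algebraMap r => intro q hq; exact absurd hq (by omega)
    | add x y i hx hy ihx ihy =>
      intro q hq
      rw [map_add]; exact add_mem (ihx q hq) (ihy q hq)
    | mem_mul m hm i x hx ih =>
      intro q hq
      obtain rfl : i = q := by omega
      obtain ⟨w, rfl⟩ := hm
      rw [contr_ι_mul, ← Algebra.smul_def]
      refine sub_mem (Submodule.smul_mem _ _ hx) ?_
      rcases i with _ | i
      · rw [contr_of_mem_zero e hx, mul_zero]; exact zero_mem _
      · rw [add_comm i 1]; exact mul_mem_deg (ι_mem w) (ih i rfl)
  exact key _ x hx q rfl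

/-- The Lie derivative of forms along the derivation `e`. -/
def lie (e : Derivation k A A) : Module.End k (Forms k A) :=
  extD ∘ₗ (contr e).restrictScalars k + (contr e).restrictScalars k ∘ₗ extD

theorem lie_apply (e : Derivation k A A) (x : Forms k A) :
    lie e x = extD (contr e x) + contr e (extD x) := rfl

theorem lie_fn (e : Derivation k A A) (a : A) : lie e (fn a) = fn (e a) := by
  rw [lie_apply, contr_fn, map_zero, zero_add, extD_fn, contr_df]

theorem lie_df (e : Derivation k A A) (a : A) : lie e (df a) = df (e a) := by
  rw [lie_apply, contr_df, extD_fn, extD_df, map_zero, add_zero]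

/-- The anticommutator of two antiderivations is a derivation: the cross terms cancel because both
operators anticommute with `sgn`. Eigenvalues on products therefore add. -/
theorem lie_mul (e : Derivation k A A) (x y : Forms k A) :
    lie e (x * y) = lie e x * y + x * lie e y := by
  simp only [lie_apply, contr_mul, extD_mul, map_add, contr_sgn, extD_sgn, sgn_sgn]
  noncomm_ring

end Contraction

/-- A diagonalizable operator has no nilpotent part. After removal of the kernel component, the rest
lies both in the generalized 0-eigenspace of order 2 and in the sum of those for nonzero
eigenvalues, and these are independent. -/
theorem eq_zero_of_mem_iSup_eigenspace {K V : Type} [Field K] [AddCommGroup V] [Module K V]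
    (f : Module.End K V) {w : V} (hw : w ∈ ⨆ μ, f.eigenspace μ) (h : f (f w) = 0) : f w = 0 := by
  rw [iSup_split_single _ (0 : K), Submodule.mem_sup] at hw
  obtain ⟨y, hy, z, hz, rfl⟩ := hw
  rw [Module.End.mem_eigenspace_iff, zero_smul] at hy
  rw [map_add, hy, zero_add] at h ⊢
  have hd := (Module.End.independent_genEigenspace f 2) 0
  have hz' : z ∈ ⨆ μ, ⨆ (_ : μ ≠ 0), f.genEigenspace μ 2 := by
    have hle : (⨆ μ, ⨆ (_ : μ ≠ 0), f.eigenspace μ) ≤ ⨆ μ, ⨆ (_ : μ ≠ 0), f.genEigenspace μ 2 :=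
      iSup₂_mono fun μ _ => (f.genEigenspace μ).mono (by norm_num)
    exact hle hz
  have hz0 : z ∈ f.genEigenspace 0 2 := by
    rw [show (2 : ℕ∞) = ((2 : ℕ) : ℕ∞) from rfl, Module.End.mem_genEigenspace_nat]
    simpa [pow_two] using h
  rw [Submodule.disjoint_def.1 hd z hz0 hz', map_zero]

/-! ## The weight decomposition of the forms on a chart -/

/-- The exponents of the product of the `x_j`, `j ∈ l`. -/
def listDegree (l : List (Fin (n + 1))) : Fin (n + 1) →₀ ℕ :=
  (l.map fun j => Finsupp.single j 1).sum

theorem isMon_mul_prod {I : Finset (Fin (n + 1))} {i₀ : Fin (n + 1)} (h₀ : i₀ ∈ I)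
    {a b : Fin (n + 1) →₀ ℕ} {m : ChartRing n I} (hm : IsMon I a b m) (l : List (Fin (n + 1))) :
    IsMon I (a + listDegree l) (b + Finsupp.single i₀ l.length)
      (m * (l.map fun j => ratio I j i₀).prod) := by
  induction l with
  | nil => simpa [listDegree] using hm
  | cons j l ih =>
    have h := (isMon_ratio j h₀).mul ih
    have e1 : a + listDegree (j :: l) = Finsupp.single j 1 + (a + listDegree l) := by
      simp only [listDegree, List.map_cons, List.sum_cons]; abel
    have e2 : b + Finsupp.single i₀ (j :: l).length =
        Finsupp.single i₀ 1 + (b + Finsupp.single i₀ l.length) := by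
      rw [List.length_cons, Finsupp.single_add]; abel
    rw [e1, e2, List.map_cons, List.prod_cons, mul_left_comm]
    exact h

/-- The form `m ∏_{j ∈ l} d(x_j / x_{i₀})`. -/
def monForm (I : Finset (Fin (n + 1))) (i₀ : Fin (n + 1)) (m : ChartRing n I)
    (l : List (Fin (n + 1))) : ChartForms n I :=
  fn m * (l.map fun j => df (ratio I j i₀)).prod

/-- The Lie derivative is a derivation and takes da to d(v a), so each factor d(x_j/x_{i₀}) is an
eigenform with eigenvalue c_j - c_{i₀}, and m contributes its own weight. -/
theorem lie_monForm (c : Fin (n + 1) → ℂ) {I : Finset (Fin (n + 1))} {i₀ : Fin (n + 1)}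
    (h₀ : i₀ ∈ I) {a b : Fin (n + 1) →₀ ℕ} {m : ChartRing n I} (hm : IsMon I a b m)
    (l : List (Fin (n + 1))) : lie (euler c I) (monForm I i₀ m l) =
      (pairing c (a + listDegree l) - pairing c (b + Finsupp.single i₀ l.length)) •
        monForm I i₀ m l := by
  have key : lie (euler c I) (l.map fun j => (df (ratio I j i₀) : ChartForms n I)).prod =
      (pairing c (listDegree l) - pairing c (Finsupp.single i₀ l.length)) •
        (l.map fun j => (df (ratio I j i₀) : ChartForms n I)).prod := by
    induction l with
    | nil =>
      have := lie_fn (euler c I) (1 : ChartRing n I)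
      simpa [pairing, listDegree] using this
    | cons j l ih =>
      rw [List.map_cons, List.prod_cons, lie_mul, lie_df, ih, euler_ratio c j h₀, df_smul,
        smul_mul_assoc, mul_smul_comm, ← add_smul]
      congr 1
      rw [List.length_cons, Finsupp.single_add, pairing_add, pairing_single,
        show listDegree (j :: l) = Finsupp.single j 1 + listDegree l by simp [listDegree],
        pairing_add, pairing_single]
      ring
  rw [monForm, lie_mul, lie_fn, key, euler_isMon c hm, fn_smul, smul_mul_assoc, mul_smul_comm,
    ← add_smul, pairing_add, pairing_add]
  congr 1
  ring

theorem df_ratio {I : Finset (Fin (n + 1))} {i j : Fin (n + 1)} (hi : i ∈ I) (hj : j ∈ I) :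
    (df (ratio I i j) : ChartForms n I) = fn (ratio I i j) * dlog I i j := by
  rw [dlog, ← mul_assoc, ← fn_mul, ratio_mul hj hi, ratio_self hi, fn_one, one_mul]

theorem monForm_eq {I : Finset (Fin (n + 1))} {i₀ : Fin (n + 1)} (h₀ : i₀ ∈ I)
    (m : ChartRing n I) (l : List (Fin (n + 1))) (hl : ∀ j ∈ l, j ∈ I) :
    monForm I i₀ m l = fn (m * (l.map fun j => ratio I j i₀).prod) *
      (l.map fun j => dlog I j i₀).prod := by
  rw [monForm, fn_mul, mul_assoc]
  congr 1
  induction l with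
  | nil => rw [List.map_nil, List.map_nil, List.map_nil, List.prod_nil, List.prod_nil,
      fn_one, mul_one]
  | cons j l ih =>
    rw [List.map_cons, List.prod_cons, List.map_cons, List.prod_cons, List.map_cons,
      List.prod_cons, ih fun i hi => hl i (List.mem_cons_of_mem _ hi),
      df_ratio (hl j List.mem_cons_self) h₀, fn_mul, mul_assoc, mul_assoc,
      ← mul_assoc (dlog I j i₀), ← mul_assoc (fn _) (dlog I j i₀),
      fn_comm _ (dlog I j i₀)]

theorem prod_dlog_mem_torus {I : Finset (Fin (n + 1))} {i₀ : Fin (n + 1)}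
    (h₀ : IsLeast (I : Set (Fin (n + 1))) i₀) (l : List (Fin (n + 1))) (hl : ∀ j ∈ l, j ∈ I) :
    (l.map fun j => dlog I j i₀).prod ∈ torus I l.length := by
  induction l with
  | nil =>
    have := dlogProd_mem_torus h₀ (Finset.empty_subset I) (Finset.notMem_empty _)
    simpa [dlogProd] using this
  | cons a l ih =>
    rw [List.map_cons, List.prod_cons, List.length_cons]
    exact dlog_mul_torus h₀ (hl a List.mem_cons_self)
      (ih fun i hi => hl i (List.mem_cons_of_mem _ hi))

/-- Independence over ℚ makes the single vector field v separate all integral weights of the torus.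
-/
theorem eq_of_pairing_eq {c : Fin (n + 1) → ℂ} (hc : LinearIndependent ℚ c)
    {a b : Fin (n + 1) →₀ ℕ} (h : pairing c a = pairing c b) : a = b := by
  rw [Fintype.linearIndependent_iff] at hc
  have := hc (fun j => (a j : ℚ) - b j) (by
    simp only [pairing] at h
    rw [← sub_eq_zero, ← Finset.sum_sub_distrib] at h
    rw [← h]
    refine Finset.sum_congr rfl fun j _ => ?_
    rw [Algebra.smul_def, map_sub, map_natCast, map_natCast]
    ring)
  ext j
  have := this j
  exact_mod_cast sub_eq_zero.1 this

/-- At weight zero the total numerator and denominator are equal monomials. Hence all x_j with j ∈ l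
are invertible on P_I, each d(x_j/x_{i₀}) can be rewritten as (x_j/x_{i₀}) dlog, and the resulting
coefficient is 1. -/
theorem monForm_mem_torus {c : Fin (n + 1) → ℂ} (hc : LinearIndependent ℚ c)
    {I : Finset (Fin (n + 1))} {i₀ : Fin (n + 1)} (h₀ : IsLeast (I : Set (Fin (n + 1))) i₀)
    {a b : Fin (n + 1) →₀ ℕ} {m : ChartRing n I} (hm : IsMon I a b m) (l : List (Fin (n + 1)))
    (h : pairing c (a + listDegree l) - pairing c (b + Finsupp.single i₀ l.length) = 0) :
    monForm I i₀ m l ∈ torus I l.length := by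
  have hab := eq_of_pairing_eq hc (sub_eq_zero.1 h)
  have hM := isMon_mul_prod h₀.1 hm l
  rw [hab] at hM
  -- The total denominator only involves indices from I, whereas every j ∈ l occurs in the
  -- numerator.
  have hl : ∀ j ∈ l, j ∈ I := by
    intro j hj
    by_contra hjI
    have h1 := hM.1 j hjI
    rw [← hab, Finsupp.add_apply] at h1
    have h2 : listDegree l j ≠ 0 := by
      clear hM hab h h1
      induction l with
      | nil => simp at hj
      | cons i l ih =>
        rw [show listDegree (i :: l) = Finsupp.single i 1 + listDegree l by simp [listDegree],
          Finsupp.add_apply]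
        rcases List.mem_cons.1 hj with rfl | hj
        · simp
        · have := ih hj
          omega
    omega
  rw [monForm_eq h₀.1 m l hl, hM.eq_one, fn_one, one_mul]
  exact prod_dlog_mem_torus h₀ l hl

theorem monForm_mem (I : Finset (Fin (n + 1))) (i₀ : Fin (n + 1)) (m : ChartRing n I)
    (l : List (Fin (n + 1))) :
    monForm I i₀ m l ∈ ⋀[ChartRing n I]^l.length Ω[ChartRing n I⁄ℂ] := by
  rw [monForm, ← Algebra.smul_def]
  refine Submodule.smul_mem _ _ ?_
  induction l with
  | nil => simp
  | cons a l ih =>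
    rw [List.map_cons, List.prod_cons, List.length_cons, add_comm l.length 1]
    exact mul_mem_deg (df_mem _) ih

/-- Products of q of the differentials d(x_j/x_{i₀}) generate the q-forms over the ring of
functions, and that ring is spanned by monomials. Here j runs over all indices, not only those in I.
-/
theorem mem_span_monForm {I : Finset (Fin (n + 1))} {i₀ : Fin (n + 1)} (h₀ : i₀ ∈ I) {q : ℕ}
    {x : ChartForms n I} (hx : x ∈ ⋀[ChartRing n I]^q Ω[ChartRing n I⁄ℂ]) :
    x ∈ Submodule.span ℂ {ω | ∃ a b m l, IsMon I a b m ∧ l.length = q ∧ ω = monForm I i₀ m l} := by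
  -- The complex span is stable under multiplication by functions, because a product of monomials is
  -- a monomial.
  have hfn : ∀ (q : ℕ) (f : ChartRing n I) (y : ChartForms n I),
      y ∈ Submodule.span ℂ {ω | ∃ a b m l, IsMon I a b m ∧ l.length = q ∧ ω = monForm I i₀ m l} →
      fn f * y ∈
        Submodule.span ℂ {ω | ∃ a b m l, IsMon I a b m ∧ l.length = q ∧ ω = monForm I i₀ m l} := by
    intro q f y hy
    have hf : f ∈ Submodule.span ℂ {m : ChartRing n I | ∃ a b, IsMon I a b m} := by
      rw [span_isMon]; trivial
    induction hf using Submodule.span_induction with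
    | mem m hm =>
      obtain ⟨a, b, hm⟩ := hm
      induction hy using Submodule.span_induction with
      | mem y hy =>
        obtain ⟨a', b', m', l, hm', hl, rfl⟩ := hy
        refine Submodule.subset_span ⟨_, _, m * m', l, hm.mul hm', hl, ?_⟩
        rw [monForm, monForm, fn_mul, mul_assoc]
      | zero => rw [mul_zero]; exact zero_mem _
      | add x y _ _ hx hy => rw [mul_add]; exact add_mem hx hy
      | smul r x _ hx => rw [mul_smul_comm]; exact Submodule.smul_mem _ _ hx
    | zero => rw [fn_zero, zero_mul]; exact zero_mem _
    | add x y _ _ hx hy => rw [fn_add, add_mul]; exact add_mem hx hy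
    | smul r x _ hx => rw [fn_smul, smul_mul_assoc]; exact Submodule.smul_mem _ _ hx
  induction hx using Submodule.pow_induction_on_left' with
  | algebraMap r =>
    rw [← mul_one (algebraMap _ _ r)]
    refine hfn _ _ _ (Submodule.subset_span ⟨_, _, 1, [], isMon_one I, rfl, ?_⟩)
    simp [monForm]
  | add x y i hx hy ihx ihy => exact add_mem ihx ihy
  | mem_mul m hm i x hx ih =>
    obtain ⟨w, rfl⟩ := hm
    have hw : w ∈ Submodule.span (ChartRing n I)
        (Set.range fun j => D ℂ (ChartRing n I) (ratio I j i₀)) := by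
      rw [span_D_ratio h₀]; trivial
    induction hw using Submodule.span_induction with
    | mem w hw =>
      obtain ⟨j, rfl⟩ := hw
      clear hx
      induction ih using Submodule.span_induction with
      | mem y hy =>
        obtain ⟨a, b, m, l, hm, hl, rfl⟩ := hy
        refine Submodule.subset_span ⟨a, b, m, j :: l, hm, by simp [hl], ?_⟩
        rw [monForm, monForm, List.map_cons, List.prod_cons, ← mul_assoc, ← mul_assoc, fn_comm]
      | zero => rw [mul_zero]; exact zero_mem _
      | add x y _ _ hx hy => rw [mul_add]; exact add_mem hx hy
      | smul r x _ hx => rw [mul_smul_comm]; exact Submodule.smul_mem _ _ hx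
    | zero => rw [map_zero, zero_mul]; exact zero_mem _
    | add x y _ _ hx hy => rw [map_add, add_mul]; exact add_mem hx hy
    | smul r w _ hw => rw [ι_smul_mul]; exact hfn _ _ _ hw

/-- Every form is the sum of a form in the torus complex and a Lie derivative. -/
theorem exists_torus_add_lie {c : Fin (n + 1) → ℂ} (hc : LinearIndependent ℚ c)
    {I : Finset (Fin (n + 1))} (hI : I.Nonempty) {q : ℕ} {x : ChartForms n I}
    (hx : x ∈ ⋀[ChartRing n I]^q Ω[ChartRing n I⁄ℂ]) :
    ∃ t ∈ torus I q, ∃ w ∈ ⋀[ChartRing n I]^q Ω[ChartRing n I⁄ℂ], x = t + lie (euler c I) w := by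
  have h₀ := I.isLeast_min' hI
  have h := mem_span_monForm h₀.1 hx
  clear hx
  induction h using Submodule.span_induction with
  | mem x hx =>
    obtain ⟨a, b, m, l, hm, rfl, rfl⟩ := hx
    have hL := lie_monForm c h₀.1 hm l
    by_cases hμ : pairing c (a + listDegree l) -
        pairing c (b + Finsupp.single (I.min' hI) l.length) = 0
    · exact ⟨_, monForm_mem_torus hc h₀ hm l hμ, 0, zero_mem _, by rw [map_zero, add_zero]⟩
    -- An eigenform of nonzero weight is the Lie derivative of itself divided by the weight.
    · refine ⟨0, zero_mem _, _, ofNat_smul_mem (pairing c (a + listDegree l) -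
        pairing c (b + Finsupp.single (I.min' hI) l.length))⁻¹ (monForm_mem I (I.min' hI) m l), ?_⟩
      rw [map_smul, hL, smul_smul, inv_mul_cancel₀ hμ, one_smul, zero_add]
  | zero => exact ⟨0, zero_mem _, 0, zero_mem _, by rw [map_zero, add_zero]⟩
  | add x y _ _ hx hy =>
    obtain ⟨t, ht, w, hw, rfl⟩ := hx
    obtain ⟨t', ht', w', hw', rfl⟩ := hy
    exact ⟨t + t', add_mem ht ht', w + w', add_mem hw hw', by rw [map_add]; abel⟩
  | smul r x _ hx =>
    obtain ⟨t, ht, w, hw, rfl⟩ := hx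
    exact ⟨r • t, Submodule.smul_mem _ _ ht, r • w, ofNat_smul_mem r hw, by
      rw [map_smul, smul_add]⟩

theorem lie_eq_zero_of_lie_lie (c : Fin (n + 1) → ℂ) {I : Finset (Fin (n + 1))}
    (hI : I.Nonempty) {q : ℕ} {x : ChartForms n I}
    (hx : x ∈ ⋀[ChartRing n I]^q Ω[ChartRing n I⁄ℂ])
    (h : lie (euler c I) (lie (euler c I) x) = 0) : lie (euler c I) x = 0 := by
  refine eq_zero_of_mem_iSup_eigenspace _ ?_ h
  refine (Submodule.span_le.2 ?_) (mem_span_monForm (I.isLeast_min' hI).1 hx)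
  rintro _ ⟨a, b, m, l, hm, rfl, rfl⟩
  exact Submodule.mem_iSup_of_mem _ (Module.End.mem_eigenspace_iff.2
    (lie_monForm c (I.isLeast_min' hI).1 hm l))

theorem contr_dlog_mul (c : Fin (n + 1) → ℂ) {I : Finset (Fin (n + 1))} {i j : Fin (n + 1)}
    (hi : i ∈ I) (hj : j ∈ I) (x : ChartForms n I) :
    contr (euler c I) (dlog I i j * x) = (c i - c j) • x - dlog I i j * contr (euler c I) x := by
  rw [dlog, mul_assoc, contr_fn_mul, contr_df_mul, euler_ratio c i hj, fn_smul, smul_mul_assoc,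
    mul_sub, mul_smul_comm, ← mul_assoc, ← fn_mul, ratio_mul hi hj, ratio_self hj, fn_one, one_mul,
    mul_assoc]

/-- Contracting a logarithmic factor yields the constant c_i - c_{i₀}, so the contraction is a
constant combination of products of closed forms. -/
theorem extD_contr_prod_dlog (c : Fin (n + 1) → ℂ) {I : Finset (Fin (n + 1))} {i₀ : Fin (n + 1)}
    (h₀ : i₀ ∈ I) (l : List (Fin (n + 1))) (hl : ∀ i ∈ l, i ∈ I) :
    extD (contr (euler c I) (l.map fun i => dlog I i i₀).prod) = 0 := by
  induction l with
  | nil =>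
    rw [List.map_nil, List.prod_nil, ← fn_one, contr_fn, map_zero]
  | cons a l ih =>
    have ha := hl a List.mem_cons_self
    have hl' := fun i hi => hl i (List.mem_cons_of_mem _ hi)
    rw [List.map_cons, List.prod_cons, contr_dlog_mul c ha h₀, map_sub, map_smul,
      extD_prod_dlog h₀ l hl', smul_zero, extD_mul, ih hl', mul_zero, zero_add, dlog,
      extD_dlog (by rw [ratio_mul h₀ ha, ratio_self ha]), zero_mul, sub_zero]

theorem lie_torus (c : Fin (n + 1) → ℂ) {I : Finset (Fin (n + 1))} {q : ℕ} {x : ChartForms n I}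
    (hx : x ∈ torus I q) : lie (euler c I) x = 0 := by
  rw [lie_apply, extD_torus hx, map_zero, add_zero]
  induction hx using Submodule.span_induction with
  | mem x hx =>
    obtain ⟨i₀, J, hl, hi, hJ, hc, rfl⟩ := hx
    exact extD_contr_prod_dlog c (hJ hi) _ fun i hi' =>
      hJ (Finset.erase_subset _ _ ((Finset.mem_sort _).1 hi'))
  | zero => rw [map_zero, map_zero]
  | add x y _ _ hx hy => rw [map_add, map_add, hx, hy, add_zero]
  | smul r x _ hx =>
    rw [scalar_smul, contr_fn_mul, ← scalar_smul, map_smul, hx, smul_zero]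

/-! ## The homotopy on the total complex -/

theorem restrict_contr (c : Fin (n + 1) → ℂ) {I J : Finset (Fin (n + 1))} (h : I ⊆ J)
    (x : ChartForms n I) : restrict h (contr (euler c I) x) = contr (euler c J) (restrict h x) :=
  contr_pullback _ (restrictFn_euler c h) x

theorem contr_scalar_smul (c : Fin (n + 1) → ℂ) {I : Finset (Fin (n + 1))} (r : ℂ)
    (x : ChartForms n I) : contr (euler c I) (r • x) = r • contr (euler c I) x := by
  rw [scalar_smul, contr_fn_mul, ← scalar_smul]

/-- The contraction with the Euler derivation on families of forms, with the sign that makes it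
anticommute with the Čech differential. -/
def contrFamily (c : Fin (n + 1) → ℂ) (ω : Family n) : Family n := fun I =>
  (-1 : ℂ) ^ (I.card + 1) • contr (euler c I) (ω I)

/-- The Lie derivative along the Euler derivation on families of forms. -/
def lieFamily (c : Fin (n + 1) → ℂ) (ω : Family n) : Family n := fun I => lie (euler c I) (ω I)

/-- Contraction commutes with restriction, and the sign (-1)^(|I|+1) flips when an index is removed
from I. -/
theorem cechD_contrFamily (c : Fin (n + 1) → ℂ) (ω : Family n) :
    cechD (contrFamily c ω) = - contrFamily c (cechD ω) := by
  funext I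
  rw [Pi.neg_apply, contrFamily, cechD_apply, cechD_apply, map_sum, Finset.smul_sum,
    ← Finset.sum_neg_distrib]
  refine Finset.sum_congr rfl fun j hj => ?_
  rw [contrFamily, map_smul, restrict_contr, contr_scalar_smul, smul_comm, ← neg_smul,
    ← Finset.card_erase_add_one hj]
  congr 1
  ring

/-- Cartan's formula for the total complex: the Čech parts cancel by anticommutation, and the signs
of d and of the contraction multiply to 1. -/
theorem totalD_contrFamily (c : Fin (n + 1) → ℂ) (ω : Family n) :
    totalD (contrFamily c ω) + contrFamily c (totalD ω) = lieFamily c ω := by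
  funext I
  have h1 : (-1 : ℂ) ^ (I.card + 1) * (-1 : ℂ) ^ (I.card + 1) = 1 := by
    rw [← mul_pow]; norm_num
  have h2 := congrFun (cechD_contrFamily c ω) I
  rw [Pi.neg_apply, contrFamily] at h2
  rw [Pi.add_apply, totalD_apply, h2]
  simp only [contrFamily]
  rw [totalD_apply, map_add, smul_add, contr_scalar_smul, smul_smul, h1, one_smul, map_smul,
    smul_smul, h1, one_smul, lieFamily, lie_apply]
  abel

theorem totalD_lieFamily (c : Fin (n + 1) → ℂ) (ω : Family n) :
    totalD (lieFamily c ω) = lieFamily c (totalD ω) := by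
  rw [← totalD_contrFamily, ← totalD_contrFamily, map_add, totalD_totalD, totalD_totalD, zero_add]
  have : contrFamily c (0 : Family n) = 0 := by
    funext I; rw [contrFamily, Pi.zero_apply, map_zero, smul_zero]
  rw [this, add_zero]

theorem lieFamily_add (c : Fin (n + 1) → ℂ) (ω η : Family n) :
    lieFamily c (ω + η) = lieFamily c ω + lieFamily c η := by
  funext I; exact map_add _ _ _

theorem lieFamily_torus (c : Fin (n + 1) → ℂ) {m : ℕ} {ω : Family n}
    (h : ω ∈ torusCochains n m) : lieFamily c ω = 0 := by
  funext I
  rw [lieFamily]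
  rcases I.eq_empty_or_nonempty with rfl | hn
  · rw [h.2 _ (Or.inl rfl), map_zero]; rfl
  · by_cases hI : m + 1 < I.card
    · rw [h.2 _ (Or.inr hI), map_zero]; rfl
    · exact lie_torus c (h.1 I (m + 1 - I.card) hn (by omega))

theorem lieFamily_eq_zero_of_lieFamily (c : Fin (n + 1) → ℂ) {m : ℕ} {ω : Family n}
    (h : ω ∈ cochains n m) (hω : lieFamily c (lieFamily c ω) = 0) : lieFamily c ω = 0 := by
  funext I
  rcases I.eq_empty_or_nonempty with rfl | hn
  · rw [lieFamily, h.2 _ (Or.inl rfl), map_zero]; rfl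
  · by_cases hI : m + 1 < I.card
    · rw [lieFamily, h.2 _ (Or.inr hI), map_zero]; rfl
    · exact lie_eq_zero_of_lie_lie c hn (h.1 I (m + 1 - I.card) (by omega)) (congrFun hω I)

theorem contrFamily_mem (c : Fin (n + 1) → ℂ) {m : ℕ} {ω : Family n}
    (h : ω ∈ cochains n (m + 1)) : contrFamily c ω ∈ cochains n m := by
  refine ⟨fun I q hI => ofNat_smul_mem _ (contr_mem _ (h.1 I (q + 1) (by omega))), fun I hI => ?_⟩
  rw [contrFamily]
  rcases hI with rfl | hI
  · rw [h.2 _ (Or.inl rfl), map_zero, smul_zero]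
  · by_cases hI' : m + 1 + 1 < I.card
    · rw [h.2 _ (Or.inr hI'), map_zero, smul_zero]
    -- Here |I| = m + 2, the largest size that occurs in degree m + 1; the component is a function
    -- and contracts to zero.
    · rw [contr_of_mem_zero _ (h.1 I 0 (by omega)), smul_zero]

theorem exists_torus_add_lieFamily {c : Fin (n + 1) → ℂ} (hc : LinearIndependent ℚ c) {m : ℕ}
    {ω : Family n} (h : ω ∈ cochains n m) :
    ∃ τ ∈ torusCochains n m, ∃ η ∈ cochains n m, ω = τ + lieFamily c η := by
  have key : ∀ I : Finset (Fin (n + 1)), ∃ p : ChartForms n I × ChartForms n I,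
      ((∀ q, I.Nonempty → I.card + q = m + 1 → p.1 ∈ torus I q ∧
        p.2 ∈ ⋀[ChartRing n I]^q Ω[ChartRing n I⁄ℂ]) ∧
      (I = ∅ ∨ m + 1 < I.card → p.1 = 0 ∧ p.2 = 0)) ∧ ω I = p.1 + lie (euler c I) p.2 := by
    intro I
    by_cases hI : I = ∅ ∨ m + 1 < I.card
    · refine ⟨0, ⟨fun q hn hq => ⟨zero_mem _, zero_mem _⟩, fun _ => ⟨rfl, rfl⟩⟩, ?_⟩
      rw [h.2 I hI, Prod.fst_zero, Prod.snd_zero, map_zero, add_zero]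
    · push Not at hI
      obtain ⟨t, ht, w, hw, hx⟩ := exists_torus_add_lie hc hI.1
        (h.1 I (m + 1 - I.card) (by omega))
      refine ⟨(t, w), ⟨fun q hn hq => ?_, fun h' => ?_⟩, hx⟩
      · obtain rfl : q = m + 1 - I.card := by omega
        exact ⟨ht, hw⟩
      · rcases h' with h' | h'
        · exact absurd h' hI.1.ne_empty
        · omega
  choose p hp hω using key
  refine ⟨fun I => (p I).1, ⟨fun I q hn hI => ((hp I).1 q hn hI).1, fun I hI => ((hp I).2 hI).1⟩,
    fun I => (p I).2, ⟨fun I q hI => ?_, fun I hI => ((hp I).2 hI).2⟩, funext hω⟩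
  rcases I.eq_empty_or_nonempty with rfl | hn
  · change (p ∅).2 ∈ _
    rw [((hp ∅).2 (Or.inl rfl)).2]; exact zero_mem _
  · exact ((hp I).1 q hn hI).2

/-! ### Reduction of cocycles and coboundaries to the torus complexes -/

theorem exists_linearIndependent_rat (n : ℕ) :
    ∃ c : Fin (n + 1) → ℂ, LinearIndependent ℚ c := by
  refine Module.le_rank_iff.1 ?_
  rw [Complex.rank_rat_complex]
  exact (Cardinal.nat_lt_continuum (n + 1)).le

theorem contrFamily_of_mem_zero (c : Fin (n + 1) → ℂ) {ω : Family n} (h : ω ∈ cochains n 0) :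
    contrFamily c ω = 0 := by
  funext I
  rw [contrFamily, Pi.zero_apply]
  by_cases hI : I = ∅ ∨ 0 + 1 < I.card
  · rw [h.2 _ hI, map_zero, smul_zero]
  · push Not at hI
    have := hI.1.card_pos
    rw [contr_of_mem_zero _ (h.1 I 0 (by omega)), smul_zero]

theorem lieFamily_mem (c : Fin (n + 1) → ℂ) {m : ℕ} {ω : Family n} (h : ω ∈ cochains n m) :
    lieFamily c ω ∈ cochains n m := by
  rw [← totalD_contrFamily]
  refine add_mem ?_ (contrFamily_mem c (totalD_mem h))
  rcases m with _ | m
  · rw [contrFamily_of_mem_zero c h, map_zero]; exact zero_mem _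
  · exact totalD_mem (contrFamily_mem c h)

/-- Every Čech–de Rham cocycle is cohomologous to a cocycle of the torus complexes. -/
theorem exists_torus_cohomologous {m : ℕ} {ω : Family n} (h : ω ∈ cochains n m)
    (hω : totalD ω = 0) : ∃ τ ∈ torusCochains n m, totalD τ = 0 ∧
      (ω = τ ∨ ∃ l, m = l + 1 ∧ ∃ η ∈ cochains n l, ω = τ + totalD η) := by
  obtain ⟨c, hc⟩ := exists_linearIndependent_rat n
  obtain ⟨τ, hτ, η, hη, rfl⟩ := exists_torus_add_lieFamily hc h
  -- Splitting twice gives ω = τ + L²ξ; the spare factor L is used up in applying the homotopy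
  -- formula to Lξ.
  obtain ⟨τ', hτ', ξ, hξ, rfl⟩ := exists_torus_add_lieFamily hc hη
  rw [lieFamily_add, lieFamily_torus c hτ', zero_add] at hω ⊢
  rw [map_add, totalD_lieFamily, totalD_lieFamily] at hω
  -- Applying L to 0 = Dτ + L²Dξ gives L³Dξ = 0, since L kills the torus cochain Dτ;
  -- diagonalizability removes the extra powers.
  have h1 : lieFamily c (totalD ξ) = 0 := by
    have hD := totalD_mem hξ
    refine lieFamily_eq_zero_of_lieFamily c hD ?_
    refine lieFamily_eq_zero_of_lieFamily c (lieFamily_mem c hD) ?_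
    have h1 := congrArg (lieFamily c) hω
    rw [lieFamily_add, lieFamily_torus c (totalD_torus_mem hτ), zero_add] at h1
    rw [h1]
    funext I; exact map_zero _
  have h2 : ∀ I, lieFamily c (0 : Family n) I = 0 := fun I => map_zero _
  rw [h1, show lieFamily c (0 : Family n) = 0 from funext h2, add_zero] at hω
  refine ⟨τ, hτ, hω, ?_⟩
  -- Cartan's formula for Lξ, which is closed because D(Lξ) = L(Dξ) = 0.
  have h3 : lieFamily c (lieFamily c ξ) = totalD (contrFamily c (lieFamily c ξ)) := by
    rw [← totalD_contrFamily, totalD_lieFamily, h1]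
    have : contrFamily c (0 : Family n) = 0 := by
      funext I; rw [contrFamily, Pi.zero_apply, map_zero, smul_zero]
    rw [this, add_zero]
  rw [h3]
  rcases m with _ | l
  · left
    rw [contrFamily_of_mem_zero c (lieFamily_mem c hξ), map_zero, add_zero]
  · exact Or.inr ⟨l, rfl, _, contrFamily_mem c (lieFamily_mem c hξ), rfl⟩

/-- A cochain of the torus complexes that is the differential of a Čech–de Rham cochain is the
differential of a cochain of the torus complexes. -/
theorem exists_torus_totalD_eq {m : ℕ} {τ η : Family n} (hτ : τ ∈ torusCochains n (m + 1))
    (hη : η ∈ cochains n m) (h : τ = totalD η) : ∃ σ ∈ torusCochains n m, τ = totalD σ := by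
  obtain ⟨c, hc⟩ := exists_linearIndependent_rat n
  obtain ⟨σ, hσ, ξ, hξ, rfl⟩ := exists_torus_add_lieFamily hc hη
  refine ⟨σ, hσ, ?_⟩
  rw [map_add, totalD_lieFamily] at h
  -- The image L(Dξ) is a torus cochain, hence killed by L; so L²Dξ = 0, which forces L(Dξ) = 0.
  have h1 : lieFamily c (totalD ξ) = τ - totalD σ := by rw [h, add_sub_cancel_left]
  have h2 := lieFamily_torus c (sub_mem hτ (totalD_torus_mem hσ))
  rw [← h1] at h2
  rw [h, lieFamily_eq_zero_of_lieFamily c (totalD_mem hξ) h2, add_zero]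

/-! ## Linear independence of the logarithmic forms -/

theorem contr_dlogProd_eq_zero (c : Fin (n + 1) → ℂ) {I K : Finset (Fin (n + 1))}
    {i₀ : Fin (n + 1)} (h₀ : i₀ ∈ I) (hK : K ⊆ I) (hc : ∀ i ∈ K, c i = c i₀) :
    contr (euler c I) (dlogProd I i₀ K) = 0 := by
  have key : ∀ l : List (Fin (n + 1)), (∀ i ∈ l, i ∈ K) →
      contr (euler c I) (l.map fun i => dlog I i i₀).prod = 0 := by
    intro l hl
    induction l with
    | nil => rw [List.map_nil, List.prod_nil, ← fn_one, contr_fn]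
    | cons a l ih =>
      have ha := hl a List.mem_cons_self
      rw [List.map_cons, List.prod_cons, contr_dlog_mul c (hK ha) h₀,
        ih fun i hi => hl i (List.mem_cons_of_mem _ hi), hc a ha, sub_self, zero_smul, mul_zero,
        sub_zero]
  exact key _ fun i hi => (Finset.mem_sort _).1 hi

theorem dlogProd_insert {I K : Finset (Fin (n + 1))} {i₀ a : Fin (n + 1)} (ha : ∀ x ∈ K, a < x) :
    dlogProd I i₀ (insert a K) = dlog I a i₀ * dlogProd I i₀ K := by
  rw [dlogProd, Finset.sort_insert (r := (· ≤ ·)) (fun b hb => (ha b hb).le)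
    (fun h => (ha a h).false)]
  rfl

theorem chartForms_one_ne_zero {I : Finset (Fin (n + 1))} : (1 : ChartForms n I) ≠ 0 := by
  intro h
  have h1 : (fn 1 : ChartForms n I) = fn 0 := by rw [fn_one, fn_zero, h]
  have h2 : (1 : ChartRing n I) = 0 := ExteriorAlgebra.algebraMap_leftInverse _ |>.injective h1
  have h3 := congrArg (fun x : ChartRing n I => x.val) h2
  simp only [HomogeneousLocalization.val_one, HomogeneousLocalization.val_zero] at h3
  have h4 : toLoc I 1 = toLoc I 0 := by rw [map_one, map_zero, h3]
  exact one_ne_zero (toLoc_injective I h4)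

/-- Contraction with x_a ∂/∂x_a kills the products without the index a and strips the factor of a
from the others. Taking a smaller than all of S puts that factor first, so no sign appears. The
relation splits into two relations over S. -/
theorem eq_zero_of_sum_dlogProd {I : Finset (Fin (n + 1))} {i₀ : Fin (n + 1)} (h₀ : i₀ ∈ I)
    (S : Finset (Fin (n + 1))) (hS : S ⊆ I.erase i₀) (r : Finset (Fin (n + 1)) → ℂ)
    (h : ∑ K ∈ S.powerset, r K • dlogProd I i₀ K = 0) : ∀ K ⊆ S, r K = 0 := by
  induction S using Finset.induction_on_min generalizing r with
  | empty =>
    intro K hK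
    obtain rfl := Finset.subset_empty.1 hK
    simp only [Finset.powerset_empty, Finset.sum_singleton] at h
    rw [show dlogProd I i₀ ∅ = 1 by simp [dlogProd]] at h
    exact (smul_eq_zero.1 h).resolve_right chartForms_one_ne_zero
  | insert a S ha ih =>
    have haS : a ∉ S := fun h => (ha a h).false
    have hS' := (Finset.subset_insert a S).trans hS
    have haI := Finset.mem_erase.1 (hS (Finset.mem_insert_self a S))
    rw [Finset.sum_powerset_insert haS] at h
    have hc : ∀ K ⊆ S, contr (euler (Pi.single a 1) I) (dlogProd I i₀ K) = 0 := fun K hK =>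
      contr_dlogProd_eq_zero _ h₀ ((hK.trans hS').trans (I.erase_subset _)) fun i hi => by
        rw [Pi.single_eq_of_ne (by rintro rfl; exact haS (hK hi)),
          Pi.single_eq_of_ne haI.1.symm]
    have h1 := congrArg (contr (euler (Pi.single a 1) I)) h
    rw [map_add, map_sum, map_sum, map_zero, Finset.sum_eq_zero fun K hK => by
      rw [contr_scalar_smul, hc K (Finset.mem_powerset.1 hK), smul_zero], zero_add] at h1
    have h2 : ∑ K ∈ S.powerset, r (insert a K) • dlogProd I i₀ K = 0 := by
      rw [← h1]
      refine Finset.sum_congr rfl fun K hK => ?_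
      have hK := Finset.mem_powerset.1 hK
      rw [contr_scalar_smul, dlogProd_insert fun x hx => ha x (hK hx), contr_dlog_mul _ haI.2 h₀,
        hc K hK, mul_zero, sub_zero, Pi.single_eq_same, Pi.single_eq_of_ne haI.1.symm, sub_zero,
        one_smul]
    have h3 := ih hS' (fun K => r (insert a K)) h2
    rw [Finset.sum_eq_zero (s := S.powerset) (f := fun K => r (insert a K) • _) fun K hK => by
      rw [h3 K (Finset.mem_powerset.1 hK), zero_smul], add_zero] at h
    have h4 := ih hS' r h
    intro K hK
    by_cases haK : a ∈ K
    · rw [← Finset.insert_erase haK]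
      exact h3 _ (Finset.subset_insert_iff.1 hK)
    · exact h4 K ((Finset.subset_insert_iff_of_notMem haK).1 hK)

theorem linearIndependent_dlogProd {I : Finset (Fin (n + 1))} {i₀ : Fin (n + 1)}
    (h₀ : IsLeast (I : Set (Fin (n + 1))) i₀) : LinearIndependent ℂ
      (fun K : {K : Finset (Fin (n + 1)) // K ⊆ I.erase i₀} => dlogProd I i₀ K) := by
  rw [Fintype.linearIndependent_iff]
  intro g hg K
  have := eq_zero_of_sum_dlogProd h₀.1 (I.erase i₀) subset_rfl
    (fun K => if h : K ⊆ I.erase i₀ then g ⟨K, h⟩ else 0) (by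
      rw [← hg, Finset.sum_subtype (p := fun K => K ⊆ I.erase i₀) (I.erase i₀).powerset
        (fun K => Finset.mem_powerset)]
      exact Finset.sum_congr rfl fun K _ => by rw [dif_pos K.2]) K.1 K.2
  rwa [dif_pos K.2] at this

/-! ## A combinatorial model of the torus complexes -/

/-- The exterior algebra on the vector space with basis `e₀, …, eₙ`. -/
abbrev Model (n : ℕ) : Type := ExteriorAlgebra ℂ (Fin (n + 1) → ℂ)

/-- The generator `e_i`. -/
def gen (i : Fin (n + 1)) : Model n := ExteriorAlgebra.ι ℂ (Pi.single i 1)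

/-- The product of the generators `e_i`, `i ∈ l`. -/
def genProd (l : List (Fin (n + 1))) : Model n := (l.map gen).prod

theorem genProd_nil : genProd ([] : List (Fin (n + 1))) = 1 := rfl

theorem genProd_cons (i : Fin (n + 1)) (l : List (Fin (n + 1))) :
    genProd (i :: l) = gen i * genProd l := by
  rw [genProd, List.map_cons, List.prod_cons]; rfl

theorem gen_mul_gen (i j : Fin (n + 1)) : gen i * gen j = - (gen j * gen i) :=
  eq_neg_of_add_eq_zero_left (ExteriorAlgebra.ι_add_mul_swap _ _)

theorem gen_mul_self (i : Fin (n + 1)) : gen i * gen i = 0 := ExteriorAlgebra.ι_sq_zero _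

theorem gen_mul_genProd_of_mem {i : Fin (n + 1)} {l : List (Fin (n + 1))} (h : i ∈ l) :
    gen i * genProd l = 0 := by
  induction l with
  | nil => simp at h
  | cons j l ih =>
    rw [genProd_cons, ← mul_assoc]
    rcases List.mem_cons.1 h with rfl | h
    · rw [gen_mul_self, zero_mul]
    · rw [gen_mul_gen, neg_mul, mul_assoc, ih h, mul_zero, neg_zero]

theorem genProd_of_not_nodup {l : List (Fin (n + 1))} (h : ¬ l.Nodup) : genProd l = 0 := by
  induction l with
  | nil => simp at h
  | cons j l ih =>
    rw [genProd_cons]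
    by_cases hj : j ∈ l
    · exact gen_mul_genProd_of_mem hj
    · rw [ih fun h' => h (List.nodup_cons.2 ⟨hj, h'⟩), mul_zero]

/-- The span of the products of `q` generators `e_i` with `i ∈ I`. -/
def modelSub (I : Finset (Fin (n + 1))) (q : ℕ) : Submodule ℂ (Model n) :=
  Submodule.span ℂ {x | ∃ l : List (Fin (n + 1)), l.length = q ∧ (∀ i ∈ l, i ∈ I) ∧ x = genProd l}

theorem genProd_mem {I : Finset (Fin (n + 1))} {l : List (Fin (n + 1))} (h : ∀ i ∈ l, i ∈ I) :
    genProd l ∈ modelSub I l.length := Submodule.subset_span ⟨l, rfl, h, rfl⟩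

/-- A linear map that maps the products of generators from `I` into a submodule. -/
theorem modelSub_le_comap {I : Finset (Fin (n + 1))} {q : ℕ} (f : Model n →ₗ[ℂ] Model n)
    (V : Submodule ℂ (Model n))
    (h : ∀ l : List (Fin (n + 1)), l.length = q → (∀ i ∈ l, i ∈ I) → f (genProd l) ∈ V)
    {x : Model n} (hx : x ∈ modelSub I q) : f x ∈ V := by
  have : modelSub I q ≤ V.comap f := by
    refine Submodule.span_le.2 ?_
    rintro _ ⟨l, hl, hI, rfl⟩
    exact h l hl hI
  exact this hx

theorem modelSub_mono {I J : Finset (Fin (n + 1))} (h : I ⊆ J) {q : ℕ} {x : Model n}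
    (hx : x ∈ modelSub I q) : x ∈ modelSub J q :=
  modelSub_le_comap LinearMap.id _ (fun _ hl hI => hl ▸ genProd_mem fun i hi => h (hI i hi)) hx

theorem gen_mul_mem {I : Finset (Fin (n + 1))} {i : Fin (n + 1)} (hi : i ∈ I) {q : ℕ} {x : Model n}
    (hx : x ∈ modelSub I q) : gen i * x ∈ modelSub I (q + 1) :=
  modelSub_le_comap (LinearMap.mulLeft ℂ (gen i)) _ (fun l hl hI => by
    rw [LinearMap.mulLeft_apply, ← genProd_cons, ← hl]
    exact genProd_mem (l := i :: l) fun j hj => by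
      rcases List.mem_cons.1 hj with rfl | hj
      · exact hi
      · exact hI j hj) hx

/-- More than |I| factors from I must repeat a generator. -/
theorem eq_zero_of_mem_modelSub {I : Finset (Fin (n + 1))} {q : ℕ} (hq : I.card < q) {x : Model n}
    (hx : x ∈ modelSub I q) : x = 0 := by
  refine (Submodule.mem_bot ℂ).1 (modelSub_le_comap LinearMap.id ⊥ (fun l hl hI => ?_) hx)
  rw [LinearMap.id_apply, Submodule.mem_bot]
  refine genProd_of_not_nodup fun h => ?_
  have h1 := List.toFinset_card_of_nodup h
  have h2 : l.toFinset ⊆ I := fun i hi => hI i (List.mem_toFinset.1 hi)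
  have h3 := Finset.card_le_card h2
  omega

theorem mem_modelSub_zero {I : Finset (Fin (n + 1))} {x : Model n} (hx : x ∈ modelSub I 0) :
    ∃ a : ℂ, x = a • 1 := by
  have := modelSub_le_comap LinearMap.id (Submodule.span ℂ {1}) (fun l hl hI => by
    rw [List.length_eq_zero_iff.1 hl]; exact Submodule.mem_span_singleton_self _) hx
  obtain ⟨a, ha⟩ := Submodule.mem_span_singleton.1 this
  exact ⟨a, ha.symm⟩

/-- Contraction with the linear form `e_i ↦ c_i`. -/
def modelContr (c : Fin (n + 1) → ℂ) : Model n →ₗ[ℂ] Model n :=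
  CliffordAlgebra.contractLeft (Q := (0 : QuadraticForm ℂ (Fin (n + 1) → ℂ)))
    (∑ j, c j • LinearMap.proj j)

theorem modelContr_gen_mul (c : Fin (n + 1) → ℂ) (i : Fin (n + 1)) (x : Model n) :
    modelContr c (gen i * x) = c i • x - gen i * modelContr c x := by
  refine (CliffordAlgebra.contractLeft_ι_mul _ _ _).trans ?_
  congr 2
  simp [Pi.single_apply]

theorem modelContr_one (c : Fin (n + 1) → ℂ) : modelContr c 1 = 0 :=
  CliffordAlgebra.contractLeft_one (Q := (0 : QuadraticForm ℂ (Fin (n + 1) → ℂ))) _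

theorem modelContr_modelContr (c : Fin (n + 1) → ℂ) (x : Model n) :
    modelContr c (modelContr c x) = 0 := CliffordAlgebra.contractLeft_contractLeft _ _

theorem modelContr_comm (c c' : Fin (n + 1) → ℂ) (x : Model n) :
    modelContr c (modelContr c' x) = - modelContr c' (modelContr c x) :=
  CliffordAlgebra.contractLeft_comm _ _ _

theorem modelContr_of_mem_zero (c : Fin (n + 1) → ℂ) {I : Finset (Fin (n + 1))} {x : Model n}
    (hx : x ∈ modelSub I 0) : modelContr c x = 0 := by
  obtain ⟨a, rfl⟩ := mem_modelSub_zero hx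
  rw [map_smul, modelContr_one, smul_zero]

theorem modelContr_mem (c : Fin (n + 1) → ℂ) {I : Finset (Fin (n + 1))} {q : ℕ} {x : Model n}
    (hx : x ∈ modelSub I (q + 1)) : modelContr c x ∈ modelSub I q := by
  refine modelSub_le_comap (modelContr c) _ (fun l hl hI => ?_) hx
  clear hx
  induction l generalizing q with
  | nil => simp at hl
  | cons i l ih =>
    have hI' := fun j hj => hI j (List.mem_cons_of_mem _ hj)
    obtain rfl : l.length = q := by simpa using hl
    rw [genProd_cons, modelContr_gen_mul]
    refine sub_mem (Submodule.smul_mem _ _ (genProd_mem hI')) ?_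
    rcases l with _ | ⟨j, l⟩
    · rw [genProd_nil, modelContr_one, mul_zero]; exact zero_mem _
    · exact gen_mul_mem (hI i List.mem_cons_self) (ih rfl hI')

/-- The algebra endomorphism of the exterior algebra induced by `e_i ↦ v_i`. -/
def modelMap (v : Fin (n + 1) → Fin (n + 1) → ℂ) : Model n →ₐ[ℂ] Model n :=
  ExteriorAlgebra.map (Fintype.linearCombination ℂ v)

theorem modelMap_gen (v : Fin (n + 1) → Fin (n + 1) → ℂ) (i : Fin (n + 1)) :
    modelMap v (gen i) = ExteriorAlgebra.ι ℂ (v i) := by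
  rw [modelMap, gen, ExteriorAlgebra.map_apply_ι, Fintype.linearCombination_apply_single, one_smul]

/-! ### The Koszul contraction and differences of generators -/

/-- The contraction with the linear form that is `1` on all generators. -/
abbrev kos : Model n →ₗ[ℂ] Model n := modelContr 1

theorem kos_gen_mul (i : Fin (n + 1)) (x : Model n) : kos (gen i * x) = x - gen i * kos x := by
  rw [kos, modelContr_gen_mul, Pi.one_apply, one_smul]

/-- The algebra endomorphism `e_i ↦ e_i - e_{i₀}`. -/
def shift (i₀ : Fin (n + 1)) : Model n →ₐ[ℂ] Model n :=
  modelMap fun i => Pi.single i 1 - Pi.single i₀ 1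

theorem shift_gen (i₀ i : Fin (n + 1)) : shift i₀ (gen i) = gen i - gen i₀ := by
  rw [shift, modelMap_gen, map_sub]; rfl

/-- The map x ↦ kos(e_{i₀} x) is multiplicative on products of generators and sends e_i to e_i -
e_{i₀}. This links logarithmic forms with base point i₀ to the kernel of `kos`. -/
theorem shift_genProd (i₀ : Fin (n + 1)) (l : List (Fin (n + 1))) :
    shift i₀ (genProd l) = kos (gen i₀ * genProd l) := by
  induction l with
  | nil => rw [genProd_nil, map_one, kos_gen_mul, kos, modelContr_one, mul_zero, sub_zero]
  | cons i l ih =>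
    rw [genProd_cons, map_mul, ih, shift_gen, kos_gen_mul, kos_gen_mul, kos_gen_mul, mul_sub,
      sub_mul, sub_mul, mul_sub, ← mul_assoc (gen i₀) (gen i₀), gen_mul_self, zero_mul, sub_zero,
      ← mul_assoc (gen i), gen_mul_gen i i₀, neg_mul, mul_assoc]
    abel

/-- Use kos(e_{i₀} x) = x - e_{i₀} kos x. On the kernel of `kos` the choice of base point is thus
invisible. -/
theorem shift_of_mem {I : Finset (Fin (n + 1))} {q : ℕ} {x : Model n} (hx : x ∈ modelSub I q)
    (i₀ : Fin (n + 1)) (h : kos x = 0) : shift i₀ x = x := by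
  have h1 : ((shift i₀).toLinearMap - kos ∘ₗ LinearMap.mulLeft ℂ (gen i₀)) x = 0 := by
    refine (Submodule.mem_bot ℂ).1 (modelSub_le_comap _ ⊥ (fun l hl hI => ?_) hx)
    rw [Submodule.mem_bot, LinearMap.sub_apply, sub_eq_zero]
    exact shift_genProd i₀ l
  rw [LinearMap.sub_apply, sub_eq_zero] at h1
  refine h1.trans ?_
  rw [LinearMap.comp_apply, LinearMap.mulLeft_apply, kos_gen_mul, h, mul_zero, sub_zero]

/-! ### Splitting by the set of generators that occur -/

/-- The algebra endomorphism that maps `e_s` to `0` and fixes the other generators. -/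
def kill (s : Fin (n + 1)) : Model n →ₐ[ℂ] Model n :=
  modelMap fun i => if i = s then 0 else Pi.single i 1

theorem kill_gen_self (s : Fin (n + 1)) : kill s (gen s) = 0 := by
  rw [kill, modelMap_gen, if_pos rfl, map_zero]

theorem kill_gen {s i : Fin (n + 1)} (h : i ≠ s) : kill s (gen i) = gen i := by
  rw [kill, modelMap_gen, if_neg h]; rfl

theorem kill_genProd_of_notMem {s : Fin (n + 1)} {l : List (Fin (n + 1))} (h : s ∉ l) :
    kill s (genProd l) = genProd l := by
  induction l with
  | nil => rw [genProd_nil, map_one]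
  | cons i l ih =>
    rw [List.mem_cons, not_or] at h
    rw [genProd_cons, map_mul, ih h.2, kill_gen (Ne.symm h.1)]

theorem kill_genProd_of_mem {s : Fin (n + 1)} {l : List (Fin (n + 1))} (h : s ∈ l) :
    kill s (genProd l) = 0 := by
  induction l with
  | nil => simp at h
  | cons i l ih =>
    rw [genProd_cons, map_mul]
    rcases List.mem_cons.1 h with rfl | h
    · rw [kill_gen_self, zero_mul]
    · rw [ih h, mul_zero]

theorem kill_mem {s : Fin (n + 1)} {I : Finset (Fin (n + 1))} {q : ℕ} {x : Model n}
    (hx : x ∈ modelSub I q) : kill s x ∈ modelSub (I.erase s) q := by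
  refine modelSub_le_comap (kill s).toLinearMap _ (fun l hl hI => ?_) hx
  change kill s (genProd l) ∈ _
  by_cases h : s ∈ l
  · rw [kill_genProd_of_mem h]; exact zero_mem _
  · rw [kill_genProd_of_notMem h, ← hl]
    exact genProd_mem fun i hi => Finset.mem_erase.2 ⟨fun h' => h (h' ▸ hi), hI i hi⟩

theorem kill_of_mem {s : Fin (n + 1)} {I : Finset (Fin (n + 1))} (hs : s ∉ I) {q : ℕ} {x : Model n}
    (hx : x ∈ modelSub I q) : kill s x = x := by
  have h1 : ((kill s).toLinearMap - LinearMap.id : Model n →ₗ[ℂ] Model n) x = 0 := by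
    refine (Submodule.mem_bot ℂ).1 (modelSub_le_comap _ ⊥ (fun l hl hI => ?_) hx)
    rw [Submodule.mem_bot, LinearMap.sub_apply, sub_eq_zero]
    exact kill_genProd_of_notMem fun h => hs (hI s h)
  rwa [LinearMap.sub_apply, sub_eq_zero] at h1

/-- The composition of the maps `1 - kill s`, `s ∈ l`. -/
def full : List (Fin (n + 1)) → (Model n →ₗ[ℂ] Model n)
  | [] => LinearMap.id
  | s :: l => full l - (kill s).toLinearMap ∘ₗ full l

theorem full_cons (s : Fin (n + 1)) (l : List (Fin (n + 1))) (x : Model n) :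
    full (s :: l) x = full l x - kill s (full l x) := rfl

theorem full_mem (l : List (Fin (n + 1))) {I : Finset (Fin (n + 1))} {q : ℕ} {x : Model n}
    (hx : x ∈ modelSub I q) : full l x ∈ modelSub I q := by
  induction l with
  | nil => exact hx
  | cons s l ih =>
    rw [full_cons]
    exact sub_mem ih (modelSub_mono (I.erase_subset s) (kill_mem ih))

/-- The factor 1 - kill s annihilates whatever is free of e_s, and the factors applied before it
introduce no e_s. -/
theorem full_eq_zero {l : List (Fin (n + 1))} {s : Fin (n + 1)} (hs : s ∈ l)
    {I : Finset (Fin (n + 1))} (hI : s ∉ I) {q : ℕ} {x : Model n} (hx : x ∈ modelSub I q) :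
    full l x = 0 := by
  induction l with
  | nil => simp at hs
  | cons t l ih =>
    rw [full_cons]
    rcases List.mem_cons.1 hs with rfl | hs
    · rw [kill_of_mem hI (full_mem l hx), sub_self]
    · rw [ih hs, map_zero, sub_zero]

/-- The projection of the exterior algebra onto the line of the elements of top degree. -/
abbrev fullAll : Model n →ₗ[ℂ] Model n := full (List.finRange (n + 1))

theorem fullAll_eq_zero {I : Finset (Fin (n + 1))} {q : ℕ} (hq : q ≤ n) {x : Model n}
    (hx : x ∈ modelSub I q) : fullAll x = 0 := by
  refine (Submodule.mem_bot ℂ).1 (modelSub_le_comap _ ⊥ (fun l hl hI => ?_) hx)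
  rw [Submodule.mem_bot]
  have h1 : l.toFinset ≠ Finset.univ := fun h => by
    have h2 := l.toFinset_card_le
    rw [h, Finset.card_univ, Fintype.card_fin] at h2
    omega
  obtain ⟨s, hs⟩ : ∃ s, s ∉ l.toFinset := by
    by_contra h
    push Not at h
    exact h1 (Finset.eq_univ_of_forall h)
  exact full_eq_zero (List.mem_finRange s) hs (genProd_mem fun i hi => List.mem_toFinset.2 hi)

/-- Only degrees above n need the hypothesis on `kos`: there e_0 x = 0, so kos(e_0 x) = x - e_0 kos
x gives x = 0. -/
theorem fullAll_eq_zero_of_kos {I : Finset (Fin (n + 1))} {q : ℕ} {x : Model n}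
    (hx : x ∈ modelSub I q) (h : kos x = 0) : fullAll x = 0 := by
  rcases le_or_gt q n with hq | hq
  · exact fullAll_eq_zero hq hx
  · have h1 := gen_mul_mem (Finset.mem_univ 0) (modelSub_mono (Finset.subset_univ I) hx)
    have h2 := eq_zero_of_mem_modelSub (by simp; omega) h1
    have h3 := kos_gen_mul 0 x
    rw [h2, h, mul_zero, sub_zero, map_zero] at h3
    rw [← h3, map_zero]

/-! ### The Čech complex of the model -/

/-- Families of elements of the exterior algebra. -/
abbrev ModelFamily (n : ℕ) : Type := Finset (Fin (n + 1)) → Model n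

/-- The Čech differential on families of elements of the exterior algebra. -/
def modelD : ModelFamily n →ₗ[ℂ] ModelFamily n where
  toFun ω I := ∑ j ∈ I, (-1 : ℂ) ^ position I j • ω (I.erase j)
  map_add' ω η := by
    funext I
    simp only [Pi.add_apply, smul_add, Finset.sum_add_distrib]
  map_smul' r ω := by
    funext I
    simp only [Pi.smul_apply, RingHom.id_apply, Finset.smul_sum]
    exact Finset.sum_congr rfl fun j _ => smul_comm _ _ _

theorem modelD_apply (ω : ModelFamily n) (I : Finset (Fin (n + 1))) :
    modelD ω I = ∑ j ∈ I, (-1 : ℂ) ^ position I j • ω (I.erase j) := rfl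

theorem modelD_modelD (ω : ModelFamily n) : modelD (modelD ω) = 0 := by
  funext I
  simp only [modelD_apply, Finset.smul_sum, smul_smul]
  rw [Finset.sum_sigma']
  refine Finset.sum_involution (fun p _ => ⟨p.2, p.1⟩) ?_ ?_ ?_ ?_
  · rintro ⟨j, l⟩ h
    simp only [Finset.mem_sigma, Finset.mem_erase] at h
    obtain ⟨hj, hlj, hl⟩ := h
    rw [position_swap hj hl hlj.symm, neg_smul, Finset.erase_right_comm]
    exact neg_add_cancel _
  · rintro ⟨j, l⟩ h _ h'
    simp only [Finset.mem_sigma, Finset.mem_erase] at h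
    exact h.2.1 (congrArg Sigma.fst h')
  · rintro ⟨j, l⟩ h
    simp only [Finset.mem_sigma, Finset.mem_erase] at h ⊢
    exact ⟨h.2.2, h.2.1.symm, h.1⟩
  · rintro ⟨j, l⟩ _; rfl

/-- Application of a linear map to all members of a family. -/
def mapFamily (f : Model n →ₗ[ℂ] Model n) : ModelFamily n →ₗ[ℂ] ModelFamily n where
  toFun ω I := f (ω I)
  map_add' ω η := by funext I; exact map_add _ _ _
  map_smul' r ω := by funext I; exact map_smul f _ _

theorem mapFamily_apply (f : Model n →ₗ[ℂ] Model n) (ω : ModelFamily n)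
    (I : Finset (Fin (n + 1))) : mapFamily f ω I = f (ω I) := rfl

theorem modelD_mapFamily (f : Model n →ₗ[ℂ] Model n) (ω : ModelFamily n) :
    modelD (mapFamily f ω) = mapFamily f (modelD ω) := by
  funext I
  simp only [modelD_apply, mapFamily_apply, map_sum, map_smul]

/-- The families with `ω I` of degree `q` for `|I| + q = N`. -/
def modelCochains (n N : ℕ) : Submodule ℂ (ModelFamily n) where
  carrier := {ω | (∀ I q, I.card + q = N → ω I ∈ modelSub I q) ∧ ∀ I, N < I.card → ω I = 0}
  add_mem' h h' := ⟨fun I q hI => add_mem (h.1 I q hI) (h'.1 I q hI), fun I hI => by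
    rw [Pi.add_apply, h.2 I hI, h'.2 I hI, add_zero]⟩
  zero_mem' := ⟨fun _ _ _ => zero_mem _, fun _ _ => rfl⟩
  smul_mem' r ω h := ⟨fun I q hI => Submodule.smul_mem _ _ (h.1 I q hI), fun I hI => by
    rw [Pi.smul_apply, h.2 I hI, smul_zero]⟩

theorem modelD_mem {N : ℕ} {ω : ModelFamily n} (h : ω ∈ modelCochains n N) :
    modelD ω ∈ modelCochains n (N + 1) := by
  refine ⟨fun I q hI => Submodule.sum_mem _ fun j hj => Submodule.smul_mem _ _ ?_,
    fun I hI => Finset.sum_eq_zero fun j hj => ?_⟩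
  · have := Finset.card_erase_add_one hj
    exact modelSub_mono (I.erase_subset j) (h.1 _ q (by omega))
  · have := Finset.card_erase_add_one hj
    rw [h.2 _ (by omega), smul_zero]

/-- The homotopy that inserts `s`. -/
def insertH (s : Fin (n + 1)) (ω : ModelFamily n) : ModelFamily n := fun I =>
  if s ∈ I then 0 else (-1 : ℂ) ^ position I s • kill s (ω (insert s I))

theorem insertH_mem (s : Fin (n + 1)) {N : ℕ} {ω : ModelFamily n}
    (h : ω ∈ modelCochains n (N + 1)) : insertH s ω ∈ modelCochains n N := by
  refine ⟨fun I q hI => ?_, fun I hI => ?_⟩ <;> unfold insertH <;> split_ifs with hs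
  · exact zero_mem _
  · have := Finset.card_insert_of_notMem hs
    have := kill_mem (s := s) (h.1 (insert s I) q (by omega))
    rw [Finset.erase_insert hs] at this
    exact Submodule.smul_mem _ _ this
  · rfl
  · have := Finset.card_insert_of_notMem hs
    rw [h.2 _ (by omega), map_zero, smul_zero]

/-- Inserting s and deleting it again contributes `kill s`; deleting any other index anticommutes
with inserting s, by the sign rule `position_swap`. -/
theorem modelD_insertH (s : Fin (n + 1)) (ω : ModelFamily n) :
    modelD (insertH s ω) + insertH s (modelD ω) = mapFamily (kill s).toLinearMap ω := by
  funext I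
  rw [Pi.add_apply, mapFamily_apply, modelD_apply]
  change _ = kill s (ω I)
  have hsq : ∀ m : ℕ, (-1 : ℂ) ^ m * (-1 : ℂ) ^ m = 1 := fun m => by rw [← mul_pow]; norm_num
  by_cases hs : s ∈ I
  -- For s ∈ I only the deletion of s survives, because `insertH` vanishes on sets that contain s.
  · rw [Finset.sum_eq_single_of_mem s hs fun j hj hjs => by
      rw [insertH, if_pos (Finset.mem_erase.2 ⟨hjs.symm, hs⟩), smul_zero]]
    rw [insertH, if_neg (Finset.notMem_erase s I), insertH, if_pos hs, add_zero,
      Finset.insert_erase hs, position_erase_of_le le_rfl, smul_smul, hsq, one_smul]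
  · have hi : ∀ j ∈ I, insert s (I.erase j) = (insert s I).erase j := fun j hj => by
      rw [Finset.erase_insert_of_ne (by rintro rfl; exact hs hj)]
    have hp : position (insert s I) s = position I s := by
      have := position_erase_of_le (I := insert s I) (j := s) (l := s) le_rfl
      rwa [Finset.erase_insert hs, eq_comm] at this
    have h1 : insertH s (modelD ω) I = kill s (ω I) +
        ∑ j ∈ I, ((-1 : ℂ) ^ position I s * (-1) ^ position (insert s I) j) •
          kill s (ω ((insert s I).erase j)) := by
      rw [insertH, if_neg hs, modelD_apply, Finset.sum_insert hs, Finset.erase_insert hs, map_add,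
        map_smul, smul_add, smul_smul, hp, hsq, one_smul, map_sum, Finset.smul_sum]
      congr 1
      exact Finset.sum_congr rfl fun j _ => by rw [map_smul, smul_smul]
    rw [h1, add_left_comm, ← Finset.sum_add_distrib, Finset.sum_eq_zero, add_zero]
    intro j hj
    have hjs : j ≠ s := by rintro rfl; exact hs hj
    have hsw := position_swap (I := insert s I) (Finset.mem_insert_of_mem hj)
      (Finset.mem_insert_self s I) hjs
    have hps : position ((insert s I).erase s) j = position I j := by rw [Finset.erase_insert hs]
    rw [insertH, if_neg fun h => hs (Finset.mem_of_mem_erase h), hi j hj, smul_smul, ← add_smul]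
    rw [hps, hp] at hsw
    have hpj : position (I.erase j) s = position ((insert s I).erase j) s := by
      rw [← hi j hj]
      have := position_erase_of_le (I := insert s (I.erase j)) (j := s) (l := s) le_rfl
      rwa [Finset.erase_insert fun h => hs (Finset.mem_of_mem_erase h)] at this
    rw [← hpj] at hsw
    refine (congrArg (· • _) ?_).trans (zero_smul ℂ _)
    -- Multiplying the swap rule by two of its own signs moves them across; the other two terms use
    -- that signs square to 1.
    linear_combination (-1 : ℂ) ^ position (insert s I) j * (-1 : ℂ) ^ position I j * hsw -
      (-1 : ℂ) ^ position I j * (-1 : ℂ) ^ position (I.erase j) s * hsq (position (insert s I) j) -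
      (-1 : ℂ) ^ position (insert s I) j * (-1 : ℂ) ^ position I s * hsq (position I j)

/-- By `modelD_insertH`, replacing a cocycle by its image under 1 - kill s changes it by a
coboundary. After all s only the part containing every generator remains, and this is zero by
hypothesis. -/
theorem modelD_mem_exact {N : ℕ} {ω : ModelFamily n} (h : ω ∈ modelCochains n (N + 1))
    (hω : modelD ω = 0) (hf : ∀ I, fullAll (ω I) = 0) :
    ∃ η ∈ modelCochains n N, ω = modelD η := by
  have key : ∀ l : List (Fin (n + 1)), mapFamily (full l) ω ∈ modelCochains n (N + 1) ∧
      ∃ η ∈ modelCochains n N, ω = mapFamily (full l) ω + modelD η := by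
    intro l
    refine ⟨⟨fun I q hI => full_mem l (h.1 I q hI), fun I hI => ?_⟩, ?_⟩
    · rw [mapFamily_apply, h.2 I hI, map_zero]
    induction l with
    | nil => exact ⟨0, zero_mem _, by rw [map_zero, add_zero]; rfl⟩
    | cons s l ih =>
      obtain ⟨η, hη, h1⟩ := ih
      have hl : mapFamily (full l) ω ∈ modelCochains n (N + 1) :=
        ⟨fun I q hI => full_mem l (h.1 I q hI), fun I hI => by
          rw [mapFamily_apply, h.2 I hI, map_zero]⟩
      refine ⟨η + insertH s (mapFamily (full l) ω), add_mem hη (insertH_mem s hl), ?_⟩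
      have h2 := modelD_insertH s (mapFamily (full l) ω)
      rw [modelD_mapFamily, hω, map_zero] at h2
      have h0 : insertH s (0 : ModelFamily n) = 0 := by
        funext I; simp [insertH]
      rw [h0, add_zero] at h2
      rw [map_add, h2]
      conv_lhs => rw [h1]
      funext I
      simp only [Pi.add_apply, mapFamily_apply, full_cons, AlgHom.toLinearMap_apply]
      abel
  obtain ⟨-, η, hη, h1⟩ := key (List.finRange (n + 1))
  refine ⟨η, hη, h1.trans ?_⟩
  rw [show mapFamily (full (List.finRange (n + 1))) ω = 0 from funext hf, zero_add]

/-- The cochains of the model of the total complex of the torus complexes. -/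
def modelTorus (n N : ℕ) : Submodule ℂ (ModelFamily n) where
  carrier := {ω | ω ∈ modelCochains n N ∧ (∀ I, kos (ω I) = 0) ∧ ω ∅ = 0}
  add_mem' h h' := ⟨add_mem h.1 h'.1, fun I => by rw [Pi.add_apply, map_add, h.2.1, h'.2.1,
    add_zero], by rw [Pi.add_apply, h.2.2, h'.2.2, add_zero]⟩
  zero_mem' := ⟨zero_mem _, fun _ => map_zero _, rfl⟩
  smul_mem' r ω h := ⟨Submodule.smul_mem _ _ h.1, fun I => by
    rw [Pi.smul_apply, map_smul, h.2.1, smul_zero], by rw [Pi.smul_apply, h.2.2, smul_zero]⟩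

theorem fullAll_modelTorus {N : ℕ} {ω : ModelFamily n} (h : ω ∈ modelTorus n N)
    (I : Finset (Fin (n + 1))) : fullAll (ω I) = 0 := by
  by_cases hI : N < I.card
  · rw [h.1.2 I hI, map_zero]
  · exact fullAll_eq_zero_of_kos (h.1.1 I (N - I.card) (by omega)) (h.2.1 I)

theorem modelCochains_empty {N : ℕ} {ω : ModelFamily n} (h : ω ∈ modelCochains n (N + 1)) :
    ω ∅ = 0 := eq_zero_of_mem_modelSub (by simp) (h.1 ∅ (N + 1) (by simp))

/-- The component at ∅ vanishes since Λ^{N+2} of the zero space is zero; this fails in degree 0,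
whence the bound on the degree. -/
theorem kos_mem_modelTorus {N : ℕ} {ω : ModelFamily n} (h : ω ∈ modelCochains n (N + 2)) :
    mapFamily kos ω ∈ modelTorus n (N + 1) := by
  refine ⟨⟨fun I q hI => modelContr_mem 1 (h.1 I (q + 1) (by omega)), fun I hI => ?_⟩,
    fun I => modelContr_modelContr 1 _, ?_⟩
  · rw [mapFamily_apply]
    by_cases hI' : N + 2 < I.card
    · rw [h.2 I hI', map_zero]
    · exact modelContr_of_mem_zero 1 (h.1 I 0 (by omega))
  · rw [mapFamily_apply, modelCochains_empty h, map_zero]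

theorem eq_zero_of_mem_modelTorus_zero {ω : ModelFamily n} (h : ω ∈ modelTorus n 0) : ω = 0 := by
  funext I
  rcases I.eq_empty_or_nonempty with rfl | hI
  · exact h.2.2
  · exact h.1.2 I hI.card_pos

/-! ### The zigzag between the Čech and Koszul differentials -/

/-- The family with the component `∏_{i ∈ I} e_i` for `|I| = k`. -/
def topFamily (n k : ℕ) : ModelFamily n := fun I =>
  if I.card = k then genProd (I.sort (· ≤ ·)) else 0

theorem topFamily_mem (n k : ℕ) : topFamily n k ∈ modelCochains n (2 * k) := by
  refine ⟨fun I q hI => ?_, fun I hI => if_neg (by omega)⟩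
  unfold topFamily
  split_ifs with h
  · obtain rfl : (I.sort (· ≤ ·)).length = q := by rw [Finset.length_sort]; omega
    exact genProd_mem fun i hi => (Finset.mem_sort _).1 hi
  · exact zero_mem _

theorem genProd_sort_insert {K : Finset (Fin (n + 1))} {a : Fin (n + 1)} (ha : ∀ x ∈ K, a < x) :
    genProd ((insert a K).sort (· ≤ ·)) = gen a * genProd (K.sort (· ≤ ·)) := by
  rw [Finset.sort_insert (r := (· ≤ ·)) (fun b hb => (ha b hb).le) (fun h => (ha a h).false),
    genProd_cons]

/-- Contraction removes the factors one at a time, and moving past the smaller ones produces exactly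
the Čech sign of the removed index. -/
theorem kos_genProd_sort (I : Finset (Fin (n + 1))) : kos (genProd (I.sort (· ≤ ·))) =
    ∑ j ∈ I, (-1 : ℂ) ^ position I j • genProd ((I.erase j).sort (· ≤ ·)) := by
  induction I using Finset.induction_on_min with
  | empty =>
    rw [Finset.sort_empty, genProd_nil, Finset.sum_empty]; exact modelContr_one 1
  | insert a K ha ih =>
    have haK : a ∉ K := fun h => (ha a h).false
    have h0 : position (insert a K) a = 0 := by
      rw [position, Finset.card_eq_zero, Finset.filter_eq_empty_iff]
      intro x hx
      rcases Finset.mem_insert.1 hx with rfl | hx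
      · exact lt_irrefl _
      · exact (ha x hx).not_gt
    rw [genProd_sort_insert ha, kos_gen_mul, ih, Finset.sum_insert haK, Finset.erase_insert haK, h0,
      pow_zero, one_smul, sub_eq_add_neg, Finset.mul_sum, ← Finset.sum_neg_distrib]
    congr 1
    refine Finset.sum_congr rfl fun j hj => ?_
    have hja : a ≠ j := by rintro rfl; exact haK hj
    have h1 := position_erase_of_lt (Finset.mem_insert_self a K) (ha j hj)
    rw [Finset.erase_insert haK] at h1
    rw [← h1, Finset.erase_insert_of_ne hja,
      genProd_sort_insert fun x hx => ha x (Finset.mem_of_mem_erase hx), mul_smul_comm, pow_succ,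
      mul_neg_one, neg_smul]

/-- The model of the family `c_k`. -/
def modelChern (n k : ℕ) : ModelFamily n := modelD (topFamily n k)

/-- This is the rung of the zigzag: `modelChern n k` is both the Čech coboundary of the products of
k generators and the Koszul image of those of k + 1. -/
theorem kos_topFamily (n k : ℕ) : mapFamily kos (topFamily n (k + 1)) = modelChern n k := by
  funext I
  rw [mapFamily_apply, modelChern, modelD_apply, topFamily]
  split_ifs with h
  · rw [kos_genProd_sort]
    refine Finset.sum_congr rfl fun j hj => ?_
    have := Finset.card_erase_add_one hj
    rw [topFamily, if_pos (by omega)]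
  · rw [map_zero, Finset.sum_eq_zero]
    intro j hj
    have := Finset.card_erase_add_one hj
    rw [topFamily, if_neg (by omega), smul_zero]

/-- The cocycles of the model of the total complex of the torus complexes. -/
theorem exists_modelChern_add (M : ℕ) : ∀ ω ∈ modelTorus n (M + 1), modelD ω = 0 →
    ∃ k : ℕ, ∃ a : ℂ, ∃ σ ∈ modelTorus n M,
      ω = a • modelChern n k + modelD σ ∧ (a = 0 ∨ M = 2 * k) := by
  induction M using Nat.twoStepInduction with
  | zero =>
    intro ω h hω
    obtain ⟨η, hη, rfl⟩ := modelD_mem_exact h.1 hω (fullAll_modelTorus h)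
    -- A cochain of total degree 0 is a single constant at I = ∅; that constant is the coefficient
    -- of the class.
    obtain ⟨a, ha⟩ := mem_modelSub_zero (hη.1 ∅ 0 (by simp))
    refine ⟨0, a, 0, zero_mem _, ?_, Or.inr rfl⟩
    rw [map_zero, add_zero, modelChern, ← map_smul]
    congr 1
    funext I
    rcases I.eq_empty_or_nonempty with rfl | hI
    · rw [ha, Pi.smul_apply, topFamily, if_pos Finset.card_empty, Finset.sort_empty, genProd_nil]
    · rw [hη.2 I hI.card_pos, Pi.smul_apply, topFamily, if_neg hI.card_pos.ne', smul_zero]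
  | one =>
    intro ω h hω
    obtain ⟨η, hη, rfl⟩ := modelD_mem_exact h.1 hω (fullAll_modelTorus h)
    -- In total degree 1 the potential η consists of constants on one-element sets, which `kos`
    -- kills; it already is a cochain of the torus model, and no class arises.
    have h0 := modelCochains_empty hη
    refine ⟨0, 0, η, ⟨hη, fun I => ?_, h0⟩, by rw [zero_smul, zero_add], Or.inl rfl⟩
    rcases I.eq_empty_or_nonempty with rfl | hI
    · rw [h0, map_zero]
    · by_cases hI' : 1 < I.card
      · rw [hη.2 I hI', map_zero]
      · have := hI.card_pos
        exact modelContr_of_mem_zero 1 (hη.1 I 0 (by omega))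
  | more M ih _ =>
    intro ω h hω
    obtain ⟨η, hη, rfl⟩ := modelD_mem_exact h.1 hω (fullAll_modelTorus h)
    -- The connecting map of the Koszul sequence: kos η is a cocycle two total degrees below Dη.
    obtain ⟨k, a, σ, hσ, h1, hk⟩ := ih _ (kos_mem_modelTorus hη) (by
      rw [modelD_mapFamily]; exact funext h.2.1)
    -- A lift of σ along `kos`: kos(e_i x) = x whenever kos x = 0, for any i ∈ I.
    let σ' : ModelFamily n := fun I => if hI : I.Nonempty then gen (I.min' hI) * σ I else 0
    have hσ' : σ' ∈ modelCochains n (M + 1) := by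
      refine ⟨fun I q hI => ?_, fun I hI => ?_⟩
      · change dite _ _ _ ∈ _
        split_ifs with hn
        · rcases q with _ | q
          · rw [hσ.1.2 I (by omega), mul_zero]; exact zero_mem _
          · exact gen_mul_mem (I.min'_mem hn) (hσ.1.1 I q (by omega))
        · exact zero_mem _
      · change dite _ _ _ = _
        split_ifs with hn
        · rw [hσ.1.2 I (by omega), mul_zero]
        · rfl
    have hkσ : mapFamily kos σ' = σ := by
      funext I
      change kos (dite _ _ _) = _
      split_ifs with hn
      · rw [kos_gen_mul, hσ.2.1, mul_zero, sub_zero]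
      · rw [Finset.not_nonempty_iff_eq_empty.1 hn, hσ.2.2, map_zero]
    have ht : a • topFamily n (k + 1) ∈ modelCochains n (M + 2) := by
      rcases hk with rfl | rfl
      · rw [zero_smul]; exact zero_mem _
      · exact Submodule.smul_mem _ _ (topFamily_mem n (k + 1))
    -- Subtracting lifts of both terms of kos η lands in the kernel of `kos`, and changes Dη only by
    -- a multiple of `modelChern n (k + 1)`.
    have hη' := sub_mem (sub_mem hη ht) (modelD_mem hσ')
    refine ⟨k + 1, a, η - a • topFamily n (k + 1) - modelD σ', ⟨hη', fun I => ?_,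
      modelCochains_empty hη'⟩, ?_, ?_⟩
    · change mapFamily kos (η - a • topFamily n (k + 1) - modelD σ') I = 0
      rw [map_sub, map_sub, map_smul, kos_topFamily, ← modelD_mapFamily, hkσ, h1]
      simp
    · rw [map_sub, map_sub, modelD_modelD, map_smul, modelChern]
      abel
    · rcases hk with rfl | rfl
      · exact Or.inl rfl
      · exact Or.inr (by ring)

/-- If a · modelChern k = Dσ, then a · topFamily k - σ is a cocycle of an acyclic complex, say Dρ,
and `kos` turns this into the same relation for k - 1 with kos ρ. At k = 0 nothing is left to bound
a constant. -/
theorem eq_zero_of_smul_modelChern {k : ℕ} (hk : k ≤ n) {a : ℂ} {σ : ModelFamily n}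
    (hσ : σ ∈ modelTorus n (2 * k)) (h : a • modelChern n k = modelD σ) : a = 0 := by
  induction k generalizing σ with
  | zero =>
    rw [eq_zero_of_mem_modelTorus_zero hσ, map_zero] at h
    have h1 := congrFun h {0}
    rw [Pi.smul_apply, modelChern, modelD_apply, Finset.sum_singleton, Finset.erase_singleton,
      topFamily, if_pos Finset.card_empty, Finset.sort_empty, genProd_nil, Pi.zero_apply,
      smul_smul] at h1
    have h2 := (smul_eq_zero.1 h1).resolve_right one_ne_zero
    exact (mul_eq_zero.1 h2).resolve_right (pow_ne_zero _ (by norm_num))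
  | succ k ih =>
    have hm : a • topFamily n (k + 1) - σ ∈ modelCochains n (2 * k + 1 + 1) :=
      sub_mem (Submodule.smul_mem _ _ (topFamily_mem n (k + 1))) hσ.1
    obtain ⟨ρ, hρ, h1⟩ := modelD_mem_exact hm (by
      rw [map_sub, map_smul, ← h, modelChern, sub_self]) (fun I => by
      rw [Pi.sub_apply, map_sub, fullAll_modelTorus hσ, sub_zero, Pi.smul_apply, map_smul,
        topFamily]
      split_ifs with hI
      -- The bound on k enters here: a product of at most n generators omits one of the n + 1.
      · rw [fullAll_eq_zero (q := k + 1) hk, smul_zero]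
        have := genProd_mem (I := I) (l := I.sort (· ≤ ·)) fun i hi => (Finset.mem_sort _).1 hi
        rwa [Finset.length_sort, hI] at this
      · rw [map_zero, smul_zero])
    have h2 := congrArg (mapFamily kos) h1
    rw [map_sub, map_smul, kos_topFamily, show mapFamily kos σ = 0 from funext hσ.2.1, sub_zero,
      ← modelD_mapFamily] at h2
    refine ih (by omega) ?_ h2
    -- In total degree 1, below the range of `kos_mem_modelTorus`, the contraction of ρ is simply
    -- zero.
    rcases k with _ | k
    · have : mapFamily kos ρ = 0 := by
        funext I
        rw [mapFamily_apply, Pi.zero_apply]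
        rcases I.eq_empty_or_nonempty with rfl | hI
        · rw [modelCochains_empty hρ, map_zero]
        · by_cases hI' : 1 < I.card
          · rw [hρ.2 I hI', map_zero]
          · have := hI.card_pos
            exact modelContr_of_mem_zero 1 (hρ.1 I 0 (by omega))
      rw [this]; exact zero_mem _
    · exact kos_mem_modelTorus hρ

/-! ## Comparison of the model with the torus complexes -/

theorem dlog_eq_ι (I : Finset (Fin (n + 1))) (i j : Fin (n + 1)) : dlog I i j =
    ExteriorAlgebra.ι (ChartRing n I) (ratio I j i • D ℂ (ChartRing n I) (ratio I i j)) := by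
  rw [map_smul, smul_eq_fn_mul]; rfl

theorem smul_ι (I : Finset (Fin (n + 1))) (r : ℂ) (w : Ω[ChartRing n I⁄ℂ]) :
    r • (ExteriorAlgebra.ι (ChartRing n I) w : ChartForms n I) =
      ExteriorAlgebra.ι (ChartRing n I) (algebraMap ℂ (ChartRing n I) r • w) := by
  rw [map_smul, smul_eq_fn_mul, scalar_smul]

theorem sum_smul_dlog_sq (I : Finset (Fin (n + 1))) (i₀ : Fin (n + 1)) (v : Fin (n + 1) → ℂ) :
    Fintype.linearCombination ℂ (fun j => dlog I j i₀) v *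
      Fintype.linearCombination ℂ (fun j => dlog I j i₀) v = 0 := by
  have : Fintype.linearCombination ℂ (fun j => dlog I j i₀) v =
      ExteriorAlgebra.ι (ChartRing n I) (∑ j, algebraMap ℂ (ChartRing n I) (v j) •
        ratio I i₀ j • D ℂ (ChartRing n I) (ratio I j i₀)) := by
    rw [Fintype.linearCombination_apply, map_sum]
    exact Finset.sum_congr rfl fun j _ => by rw [dlog_eq_ι, smul_ι]
  rw [this, ExteriorAlgebra.ι_sq_zero]

/-- The algebra homomorphism `e_i ↦ d(x_i/x_{i₀}) / (x_i/x_{i₀})`. -/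
def realize (I : Finset (Fin (n + 1))) (i₀ : Fin (n + 1)) : Model n →ₐ[ℂ] ChartForms n I :=
  ExteriorAlgebra.lift ℂ ⟨Fintype.linearCombination ℂ fun j => dlog I j i₀, sum_smul_dlog_sq I i₀⟩

theorem realize_gen (I : Finset (Fin (n + 1))) (i₀ i : Fin (n + 1)) :
    realize I i₀ (gen i) = dlog I i i₀ := by
  rw [realize, gen, ExteriorAlgebra.lift_ι_apply, Fintype.linearCombination_apply_single, one_smul]

theorem realize_genProd (I : Finset (Fin (n + 1))) (i₀ : Fin (n + 1)) (l : List (Fin (n + 1))) :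
    realize I i₀ (genProd l) = (l.map fun i => dlog I i i₀).prod := by
  induction l with
  | nil => rw [genProd_nil, map_one, List.map_nil, List.prod_nil]
  | cons i l ih => rw [genProd_cons, map_mul, ih, realize_gen, List.map_cons, List.prod_cons]

/-- Two linear maps that agree on the products of `q` generators from `I` agree on their span. -/
theorem eqOn_modelSub {V : Type} [AddCommGroup V] [Module ℂ V] {I : Finset (Fin (n + 1))} {q : ℕ}
    (f g : Model n →ₗ[ℂ] V)
    (h : ∀ l : List (Fin (n + 1)), l.length = q → (∀ i ∈ l, i ∈ I) → f (genProd l) = g (genProd l))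
    {x : Model n} (hx : x ∈ modelSub I q) : f x = g x := by
  refine LinearMap.eqOn_span ?_ hx
  rintro _ ⟨l, hl, hI, rfl⟩
  exact h l hl hI

theorem realize_shift {I : Finset (Fin (n + 1))} {i₀ : Fin (n + 1)} (h₀ : i₀ ∈ I)
    (l : List (Fin (n + 1))) : realize I i₀ (shift i₀ (genProd l)) = realize I i₀ (genProd l) := by
  induction l with
  | nil => rw [genProd_nil, map_one]
  | cons i l ih =>
    rw [genProd_cons, map_mul, map_mul, ih, shift_gen, map_sub, realize_gen, realize_gen,
      dlog_self h₀, sub_zero, map_mul, realize_gen]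

/-- The rule dlog(x_i/x_{i₀}) = dlog(x_i/x_{j₀}) - dlog(x_{i₀}/x_{j₀}) says that changing the base
point is `shift i₀`, which fixes the kernel of `kos`. -/
theorem restrict_realize {I J : Finset (Fin (n + 1))} (h : I ⊆ J) {i₀ j₀ : Fin (n + 1)}
    (hi : i₀ ∈ I) (hj : j₀ ∈ J) {q : ℕ} {x : Model n} (hx : x ∈ modelSub I q) (hk : kos x = 0) :
    restrict h (realize I i₀ x) = realize J j₀ x := by
  conv_rhs => rw [← shift_of_mem hx i₀ hk]
  refine eqOn_modelSub ((restrict h).toLinearMap ∘ₗ (realize I i₀).toLinearMap)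
    ((realize J j₀).toLinearMap ∘ₗ (shift i₀).toLinearMap) (fun l hl hI => ?_) hx
  change restrict h (realize I i₀ (genProd l)) = realize J j₀ (shift i₀ (genProd l))
  clear hx hl
  induction l with
  | nil => rw [genProd_nil, map_one, map_one, map_one, map_one]
  | cons i l ih =>
    have hiI := hI i List.mem_cons_self
    rw [genProd_cons, map_mul, map_mul, map_mul, map_mul,
      ih fun k hk => hI k (List.mem_cons_of_mem _ hk), realize_gen, shift_gen, map_sub, realize_gen,
      realize_gen, restrict_dlog h hiI hi, dlog_sub (h hiI) (h hi) hj]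

theorem realize_mem_torus {I : Finset (Fin (n + 1))} {i₀ : Fin (n + 1)}
    (h₀ : IsLeast (I : Set (Fin (n + 1))) i₀) {q : ℕ} {x : Model n} (hx : x ∈ modelSub I q) :
    realize I i₀ x ∈ torus I q := by
  have : modelSub I q ≤ (torus I q).comap (realize I i₀).toLinearMap := by
    refine Submodule.span_le.2 ?_
    rintro _ ⟨l, rfl, hI, rfl⟩
    change realize I i₀ (genProd l) ∈ torus I l.length
    rw [realize_genProd]
    exact prod_dlog_mem_torus h₀ l hI
  exact this hx

/-- A product of generators need not lie in the kernel of `kos`, but its shift does, and has the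
same realization because dlog(x_{i₀}/x_{i₀}) = 0. -/
theorem exists_realize_eq {I : Finset (Fin (n + 1))} {i₀ : Fin (n + 1)}
    (h₀ : IsLeast (I : Set (Fin (n + 1))) i₀) {q : ℕ} {t : ChartForms n I} (ht : t ∈ torus I q) :
    ∃ x ∈ modelSub I q, kos x = 0 ∧ realize I i₀ x = t := by
  induction ht using Submodule.span_induction with
  | mem t ht =>
    obtain ⟨i₁, J, hl, hi, hJ, hc, rfl⟩ := ht
    obtain rfl := hl.unique h₀
    have hmem : ∀ i ∈ (J.erase i₁).sort (· ≤ ·), i ∈ I := fun i hi' =>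
      hJ (Finset.erase_subset _ _ ((Finset.mem_sort _).1 hi'))
    have h1 := genProd_mem hmem
    rw [Finset.length_sort, Finset.card_erase_of_mem hi, hc, Nat.add_sub_cancel] at h1
    refine ⟨shift i₁ (genProd ((J.erase i₁).sort (· ≤ ·))), ?_, ?_, ?_⟩
    · rw [shift_genProd]
      exact modelContr_mem 1 (gen_mul_mem h₀.1 h1)
    · rw [shift_genProd]
      exact modelContr_modelContr 1 _
    · rw [realize_shift h₀.1, realize_genProd]; rfl
  | zero => exact ⟨0, zero_mem _, map_zero _, map_zero _⟩
  | add t t' _ _ h h' =>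
    obtain ⟨x, hx, hk, rfl⟩ := h
    obtain ⟨x', hx', hk', rfl⟩ := h'
    exact ⟨x + x', add_mem hx hx', by rw [map_add, hk, hk', add_zero], map_add _ _ _⟩
  | smul r t _ h =>
    obtain ⟨x, hx, hk, rfl⟩ := h
    exact ⟨r • x, Submodule.smul_mem _ _ hx, by rw [map_smul, hk, smul_zero], map_smul _ _ _⟩

theorem realize_modelContr {I : Finset (Fin (n + 1))} {i₀ : Fin (n + 1)} (h₀ : i₀ ∈ I)
    {c : Fin (n + 1) → ℂ} (hc : c i₀ = 0) {q : ℕ} {x : Model n} (hx : x ∈ modelSub I q) :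
    realize I i₀ (modelContr c x) = contr (euler c I) (realize I i₀ x) := by
  have hlin : ∀ (r : ℂ) (y : ChartForms n I),
      contr (euler c I) (r • y) = r • contr (euler c I) y := contr_scalar_smul c
  let f : ChartForms n I →ₗ[ℂ] ChartForms n I :=
    { toFun := contr (euler c I), map_add' := map_add _, map_smul' := hlin }
  refine eqOn_modelSub ((realize I i₀).toLinearMap ∘ₗ modelContr c)
    (f ∘ₗ (realize I i₀).toLinearMap) (fun l hl hI => ?_) hx
  change realize I i₀ (modelContr c (genProd l)) = contr (euler c I) (realize I i₀ (genProd l))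
  clear hx hl
  induction l with
  | nil => rw [genProd_nil, modelContr_one, map_zero, map_one, ← fn_one, contr_fn]
  | cons i l ih =>
    rw [genProd_cons, modelContr_gen_mul, map_sub, map_mul, map_smul,
      ih fun k hk => hI k (List.mem_cons_of_mem _ hk), map_mul, realize_gen,
      contr_dlog_mul c (hI i List.mem_cons_self) h₀, hc, sub_zero]

/-- Euler's formula: replacing each factor in turn by itself counts the degree. Consequently an
element of positive degree is zero if all its contractions are. -/
theorem sum_gen_mul_modelContr {I : Finset (Fin (n + 1))} {q : ℕ} {x : Model n}
    (hx : x ∈ modelSub I q) :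
    ∑ k, gen k * modelContr (Pi.single k 1) x = (q : ℂ) • x := by
  have := eqOn_modelSub (∑ k, LinearMap.mulLeft ℂ (gen k) ∘ₗ modelContr (Pi.single k 1))
    ((q : ℂ) • LinearMap.id) (fun l hl hI => ?_) hx
  · simpa [LinearMap.sum_apply] using this
  · simp only [LinearMap.sum_apply, LinearMap.comp_apply, LinearMap.mulLeft_apply,
      LinearMap.smul_apply, LinearMap.id_apply]
    clear hx hI
    induction l generalizing q with
    | nil =>
      obtain rfl : q = 0 := by simpa using hl.symm
      simp [genProd_nil, modelContr_one]
    | cons i l ih =>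
      obtain rfl : q = l.length + 1 := by simpa using hl.symm
      have h1 : ∀ k, gen k * modelContr (Pi.single k 1) (genProd (i :: l)) =
          (Pi.single k (1 : ℂ) : Fin (n + 1) → ℂ) i • (gen k * genProd l) +
            gen i * (gen k * modelContr (Pi.single k 1) (genProd l)) := by
        intro k
        rw [genProd_cons, modelContr_gen_mul, mul_sub, mul_smul_comm, ← mul_assoc (gen k),
          gen_mul_gen k i, neg_mul, sub_neg_eq_add, mul_assoc]
      rw [Finset.sum_congr rfl fun k _ => h1 k, Finset.sum_add_distrib, ← Finset.mul_sum, ih rfl,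
        Finset.sum_eq_single i (fun k _ hk => by rw [Pi.single_eq_of_ne hk.symm, zero_smul])
          (by simp), Pi.single_eq_same, one_smul, mul_smul_comm, ← genProd_cons, Nat.cast_add,
        Nat.cast_one, add_smul, one_smul, add_comm]

theorem kos_eq_sum (x : Model n) : kos x = ∑ k, modelContr (Pi.single k 1) x := by
  rw [kos, modelContr, ← LinearMap.sum_apply]
  congr 1
  simp only [modelContr]
  rw [← map_sum]
  congr 1
  refine Finset.sum_congr rfl fun k _ => ?_
  rw [Finset.sum_eq_single k (fun j _ hj => by rw [Pi.single_eq_of_ne hj, zero_smul]) (by simp),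
    Pi.single_eq_same, Pi.one_apply]

/-- By induction on the degree, the contractions in the directions k ≠ i₀ vanish, since realization
carries them to contractions of forms. The direction i₀ is `kos` minus the others, and Euler's
formula concludes. -/
theorem eq_zero_of_realize_eq_zero {I : Finset (Fin (n + 1))} {i₀ : Fin (n + 1)} (h₀ : i₀ ∈ I)
    {q : ℕ} {x : Model n} (hx : x ∈ modelSub I q) (hk : kos x = 0) (h : realize I i₀ x = 0) :
    x = 0 := by
  induction q generalizing x with
  | zero =>
    obtain ⟨a, rfl⟩ := mem_modelSub_zero hx
    rw [map_smul, map_one] at h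
    rw [(smul_eq_zero.1 h).resolve_right chartForms_one_ne_zero, zero_smul]
  | succ q ih =>
    have h1 : ∀ k, k ≠ i₀ → modelContr (Pi.single k 1) x = 0 := by
      intro k hki
      refine ih (modelContr_mem _ hx) ?_ ?_
      · rw [kos, modelContr_comm, ← kos, hk, map_zero, neg_zero]
      · rw [realize_modelContr h₀ (Pi.single_eq_of_ne hki.symm _) hx, h, map_zero]
    have h2 : modelContr (Pi.single i₀ 1) x = 0 := by
      rw [← hk, kos_eq_sum, Finset.sum_eq_single i₀ (fun k _ hki => h1 k hki) (by simp)]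
    have h3 := sum_gen_mul_modelContr hx
    rw [Finset.sum_eq_zero fun k _ => by
      by_cases hki : k = i₀
      · rw [hki, h2, mul_zero]
      · rw [h1 k hki, mul_zero]] at h3
    exact (smul_eq_zero.1 h3.symm).resolve_left (by exact_mod_cast q.succ_ne_zero)

/-- The family of forms that corresponds to a family of elements of the exterior algebra. -/
def realizeFamily : ModelFamily n →ₗ[ℂ] Family n where
  toFun ω I := if hI : I.Nonempty then realize I (I.min' hI) (ω I) else 0
  map_add' ω η := by
    funext I
    by_cases hI : I.Nonempty <;> simp [hI]
  map_smul' r ω := by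
    funext I
    by_cases hI : I.Nonempty <;> simp [hI]

theorem realizeFamily_apply {I : Finset (Fin (n + 1))} (hI : I.Nonempty) (ω : ModelFamily n) :
    realizeFamily ω I = realize I (I.min' hI) (ω I) := dif_pos hI

theorem realizeFamily_empty (ω : ModelFamily n) : realizeFamily ω ∅ = 0 := by
  simp [realizeFamily]

theorem realizeFamily_mem {m : ℕ} {ω : ModelFamily n} (h : ω ∈ modelTorus n (m + 1)) :
    realizeFamily ω ∈ torusCochains n m := by
  refine ⟨fun I q hn hI => ?_, fun I hI => ?_⟩
  · rw [realizeFamily_apply hn]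
    exact realize_mem_torus (I.isLeast_min' hn) (h.1.1 I q hI)
  · rcases I.eq_empty_or_nonempty with rfl | hn
    · exact realizeFamily_empty ω
    · rcases hI with rfl | hI
      · exact absurd hn Finset.not_nonempty_empty
      · rw [realizeFamily_apply hn, h.1.2 I hI, map_zero]

theorem extD_torusCochains {m : ℕ} {τ : Family n} (h : τ ∈ torusCochains n m)
    (I : Finset (Fin (n + 1))) : extD (τ I) = 0 := by
  by_cases hI : I = ∅ ∨ m + 1 < I.card
  · rw [h.2 I hI, map_zero]
  · push Not at hI
    exact extD_torus (h.1 I (m + 1 - I.card) hI.1 (by omega))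

theorem totalD_realizeFamily {m : ℕ} {ω : ModelFamily n} (h : ω ∈ modelTorus n (m + 1)) :
    totalD (realizeFamily ω) = realizeFamily (modelD ω) := by
  funext I
  rw [totalD_apply, extD_torusCochains (realizeFamily_mem h), smul_zero, add_zero, cechD_apply]
  rcases I.eq_empty_or_nonempty with rfl | hn
  · rw [Finset.sum_empty, realizeFamily_empty]
  · rw [realizeFamily_apply hn, modelD_apply, map_sum]
    refine Finset.sum_congr rfl fun j hj => ?_
    rw [map_smul]
    congr 1
    rcases (I.erase j).eq_empty_or_nonempty with he | he
    -- For one-element I the term at ∅ must vanish on both sides; this is why cochains of the torus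
    -- model are required to be zero at ∅.
    · have h1 : ∀ K : Finset (Fin (n + 1)), K = ∅ → realizeFamily ω K = 0 ∧ ω K = 0 := by
        rintro _ rfl; exact ⟨realizeFamily_empty ω, h.2.2⟩
      rw [(h1 _ he).1, (h1 _ he).2, map_zero, map_zero]
    · rw [realizeFamily_apply he]
      by_cases hc : m + 1 < (I.erase j).card
      · rw [h.1.2 _ hc, map_zero, map_zero, map_zero]
      · exact restrict_realize _ (Finset.min'_mem _ _) (Finset.min'_mem _ _)
          (h.1.1 (I.erase j) (m + 1 - (I.erase j).card) (by omega)) (h.2.1 _)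

theorem exists_realizeFamily_eq {m : ℕ} {τ : Family n} (h : τ ∈ torusCochains n m) :
    ∃ ω ∈ modelTorus n (m + 1), realizeFamily ω = τ := by
  have key : ∀ I : Finset (Fin (n + 1)), ∃ x : Model n, kos x = 0 ∧
      (∀ q, I.card + q = m + 1 → x ∈ modelSub I q) ∧ (I = ∅ ∨ m + 1 < I.card → x = 0) ∧
      ∀ hI : I.Nonempty, realize I (I.min' hI) x = τ I := by
    intro I
    by_cases hI : I = ∅ ∨ m + 1 < I.card
    · exact ⟨0, map_zero _, fun _ _ => zero_mem _, fun _ => rfl, fun _ => by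
        rw [map_zero, h.2 I hI]⟩
    · have hI' := hI
      push Not at hI'
      obtain ⟨x, hx, hk, hr⟩ := exists_realize_eq (I.isLeast_min' hI'.1)
        (h.1 I (m + 1 - I.card) hI'.1 (by omega))
      refine ⟨x, hk, fun q hq => ?_, fun h' => absurd h' hI, fun _ => hr⟩
      obtain rfl : q = m + 1 - I.card := by omega
      exact hx
  choose ω hk hm h0 hr using key
  refine ⟨ω, ⟨⟨hm, fun I hI => h0 I (Or.inr hI)⟩, hk, h0 ∅ (Or.inl rfl)⟩, ?_⟩
  funext I
  rcases I.eq_empty_or_nonempty with rfl | hn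
  · rw [realizeFamily_empty, h.2 ∅ (Or.inl rfl)]
  · rw [realizeFamily_apply hn, hr]

theorem eq_zero_of_realizeFamily_eq_zero {m : ℕ} {ω : ModelFamily n}
    (h : ω ∈ modelTorus n (m + 1)) (h0 : realizeFamily ω = 0) : ω = 0 := by
  funext I
  rcases I.eq_empty_or_nonempty with rfl | hn
  · exact h.2.2
  · by_cases hc : m + 1 < I.card
    · exact h.1.2 I hc
    · refine eq_zero_of_realize_eq_zero (I.min'_mem hn) (h.1.1 I (m + 1 - I.card) (by omega))
        (h.2.1 I) ?_
      rw [← realizeFamily_apply hn, h0]; rfl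

theorem modelChern_mem (n k : ℕ) : modelChern n k ∈ modelTorus n (2 * k + 1) := by
  rw [← kos_topFamily]
  exact kos_mem_modelTorus (topFamily_mem n (k + 1))

/-- The component at I is kos(e_I), which is the shift of the product of the e_i with i ≠ min I. -/
theorem realizeFamily_modelChern (n k : ℕ) : realizeFamily (modelChern n k) = chernFamily n k := by
  funext I
  rcases I.eq_empty_or_nonempty with rfl | hn
  · rw [realizeFamily_empty, ((chernFamily_mem n k).2 ∅ (Or.inl rfl))]
  · rw [realizeFamily_apply hn, ← kos_topFamily, mapFamily_apply, topFamily, chernFamily]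
    split_ifs with h
    · have h1 : genProd (I.sort (· ≤ ·)) =
          gen (I.min' hn) * genProd ((I.erase (I.min' hn)).sort (· ≤ ·)) := by
        rw [← genProd_sort_insert fun x hx => Finset.min'_lt_of_mem_erase_min' I hn hx,
          Finset.insert_erase (I.min'_mem hn)]
      rw [h1, ← shift_genProd, realize_shift (I.min'_mem hn), realize_genProd]
      rfl
    · rw [map_zero, map_zero]

theorem modelD_modelTorus_mem {N : ℕ} {ω : ModelFamily n} (h : ω ∈ modelTorus n N) :
    modelD ω ∈ modelTorus n (N + 1) := by
  refine ⟨modelD_mem h.1, fun I => ?_, modelCochains_empty (modelD_mem h.1)⟩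
  change mapFamily kos (modelD ω) I = 0
  rw [← modelD_mapFamily, show mapFamily kos ω = 0 from funext h.2.1, map_zero]; rfl

/-- In the larger complex of exterior algebras the family is the coboundary of `topFamily n k`, so
δ² = 0 applies. -/
theorem totalD_chernFamily (n k : ℕ) : totalD (chernFamily n k) = 0 := by
  rw [← realizeFamily_modelChern, totalD_realizeFamily (modelChern_mem n k), modelChern,
    modelD_modelD, map_zero]

theorem chernFamily_eq_zero {k : ℕ} (hk : n < k) : chernFamily n k = 0 := by
  funext I
  have := card_finset_fin_le I
  rw [chernFamily, dif_neg (by omega)]; rfl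

/-- The cocycles of the torus complexes. -/
theorem exists_smul_chernFamily_add {m : ℕ} {τ : Family n} (h : τ ∈ torusCochains n m)
    (hτ : totalD τ = 0) : ∃ k : ℕ, ∃ a : ℂ, (a = 0 ∨ m = 2 * k) ∧ (τ = a • chernFamily n k ∨
      ∃ l, m = l + 1 ∧ ∃ σ ∈ torusCochains n l, τ = a • chernFamily n k + totalD σ) := by
  obtain ⟨ω, hω, rfl⟩ := exists_realizeFamily_eq h
  rw [totalD_realizeFamily hω] at hτ
  obtain ⟨k, a, σ, hσ, h1, hk⟩ := exists_modelChern_add m ω hω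
    (eq_zero_of_realizeFamily_eq_zero (modelD_modelTorus_mem hω) hτ)
  refine ⟨k, a, hk, ?_⟩
  rcases m with _ | l
  · left
    rw [h1, eq_zero_of_mem_modelTorus_zero hσ, map_zero, add_zero, map_smul,
      realizeFamily_modelChern]
  · refine Or.inr ⟨l, rfl, realizeFamily σ, realizeFamily_mem hσ, ?_⟩
    rw [totalD_realizeFamily hσ, ← realizeFamily_modelChern, ← map_smul, ← map_add, h1]

/-- The alternative spells out "is a coboundary", with the first case covering degree 0, which has
no predecessor. -/
theorem eq_zero_of_smul_chernFamily {k : ℕ} (hk : k ≤ n) {a : ℂ}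
    (h : a • chernFamily n k = 0 ∨
      ∃ l, 2 * k = l + 1 ∧ ∃ σ ∈ torusCochains n l, a • chernFamily n k = totalD σ) : a = 0 := by
  obtain ⟨ω, hω, h1⟩ : ∃ ω ∈ modelTorus n (2 * k),
      a • chernFamily n k = realizeFamily (modelD ω) := by
    rcases h with h | ⟨l, hl, σ, hσ, h⟩
    · exact ⟨0, zero_mem _, by rw [h, map_zero, map_zero]⟩
    · obtain ⟨ω, hω, rfl⟩ := exists_realizeFamily_eq hσ
      rw [hl]
      exact ⟨ω, hω, by rw [h, totalD_realizeFamily hω]⟩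
  refine eq_zero_of_smul_modelChern hk hω (sub_eq_zero.1 ?_)
  refine eq_zero_of_realizeFamily_eq_zero (m := 2 * k) (sub_mem (Submodule.smul_mem _ _
    (modelChern_mem n k)) (modelD_modelTorus_mem hω)) ?_
  rw [map_sub, map_smul, realizeFamily_modelChern, h1, sub_self]

/-! ## The homology of total complexes -/

/-- An identification of a complex with the complex of the submodules `V m` of the families of
forms, with the differential `D`. -/
structure FamilyModel (K : CochainComplex (ModuleCat ℂ) ℕ) (V : ℕ → Submodule ℂ (Family n)) where
  /-- The identification in degree `m`. -/
  equiv (m : ℕ) : K.X m ≃ₗ[ℂ] V m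
  equiv_d (m : ℕ) (x : K.X m) :
    (equiv (m + 1) (K.d m (m + 1) x) : Family n) = totalD (equiv m x : Family n)

/-- The tautological identification of the total complex. -/
def totalComplexModel (V : ℕ → Submodule ℂ (Family n))
    (hV : ∀ m, ∀ ω ∈ V m, totalD ω ∈ V (m + 1)) : FamilyModel (totalComplex V hV) V where
  equiv m := LinearEquiv.refl ℂ (V m)
  equiv_d m x := by
    simp only [totalComplex, CochainComplex.of_d]
    rfl

namespace FamilyModel

variable {K : CochainComplex (ModuleCat ℂ) ℕ} {V : ℕ → Submodule ℂ (Family n)} {m : ℕ}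
  (M : FamilyModel K V)

/-- The family of forms that underlies a cocycle. -/
def cycleFamily (m : ℕ) : K.cycles m →ₗ[ℂ] Family n :=
  (V m).subtype ∘ₗ (M.equiv m).toLinearMap ∘ₗ (K.iCycles m).hom

theorem cycleFamily_apply (z : K.cycles m) :
    M.cycleFamily m z = (M.equiv m (K.iCycles m z) : Family n) := rfl

theorem cycleFamily_mem (z : K.cycles m) : M.cycleFamily m z ∈ V m :=
  (M.equiv m (K.iCycles m z)).2

theorem totalD_cycleFamily (z : K.cycles m) : totalD (M.cycleFamily m z) = 0 := by
  rw [cycleFamily_apply, ← M.equiv_d, ← ModuleCat.comp_apply, HomologicalComplex.iCycles_d]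
  exact congrArg (V (m + 1)).subtype (map_zero _)

theorem exists_iCycles_eq {x : K.X m} (h : totalD (M.equiv m x : Family n) = 0) :
    ∃ z : K.cycles m, K.iCycles m z = x := by
  have h0 : K.d m ((ComplexShape.up ℕ).next m) x = 0 := by
    rw [(ComplexShape.up ℕ).next_eq' (show (ComplexShape.up ℕ).Rel m (m + 1) from rfl)]
    refine (M.equiv (m + 1)).injective (Subtype.ext ?_)
    rw [M.equiv_d, h, map_zero]
    rfl
  exact ⟨(K.sc m).moduleCatCyclesIso.inv ⟨x, h0⟩,
    ShortComplex.moduleCatCyclesIso_inv_iCycles_apply _ _⟩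

theorem exists_cycleFamily_eq {ω : Family n} (h : ω ∈ V m) (hω : totalD ω = 0) :
    ∃ z : K.cycles m, M.cycleFamily m z = ω := by
  obtain ⟨x, hx⟩ := (M.equiv m).surjective ⟨ω, h⟩
  obtain ⟨z, rfl⟩ := M.exists_iCycles_eq (x := x) (by rw [hx, hω])
  exact ⟨z, by rw [cycleFamily_apply, hx]⟩

/-- Homology embeds in the quotient of the cochains by the coboundaries, where vanishing means lying
in the image of the differential. -/
theorem homologyπ_eq_zero_iff_mem_range (K : CochainComplex (ModuleCat ℂ) ℕ) {m : ℕ}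
    (z : K.cycles m) : K.homologyπ m z = 0 ↔
      ∃ y, K.d ((ComplexShape.up ℕ).prev m) m y = K.iCycles m z := by
  refine Iff.trans ?_ ((K.sc m).moduleCat_pOpcycles_eq_zero_iff (K.iCycles m z))
  have h : K.homologyι m (K.homologyπ m z) = (K.sc m).pOpcycles (K.iCycles m z) := by
    rw [← ModuleCat.comp_apply, HomologicalComplex.homology_π_ι]
    rfl
  rw [← h]
  exact ⟨fun h => (congrArg (K.homologyι m) h).trans (map_zero _), fun h =>
    (ModuleCat.mono_iff_injective (K.homologyι m)).1 inferInstance (h.trans (map_zero _).symm)⟩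

theorem homologyπ_eq_zero_iff (z : K.cycles m) :
    K.homologyπ m z = 0 ↔ M.cycleFamily m z = 0 ∨
      ∃ l, m = l + 1 ∧ ∃ η ∈ V l, M.cycleFamily m z = totalD η := by
  rw [homologyπ_eq_zero_iff_mem_range]
  have hz : M.cycleFamily m z = 0 → K.iCycles m z = 0 := fun h =>
    (M.equiv m).injective (Subtype.ext (by rw [map_zero]; exact h))
  constructor
  · intro h
    rcases m with _ | l
    · obtain ⟨y, hy⟩ := h
      rw [K.shape _ _ (by simp)] at hy
      left
      rw [cycleFamily_apply, ← hy]
      exact congrArg (V 0).subtype (map_zero (M.equiv 0))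
    · rw [(ComplexShape.up ℕ).prev_eq' (show (ComplexShape.up ℕ).Rel l (l + 1) from rfl)] at h
      obtain ⟨y, hy⟩ := h
      refine Or.inr ⟨l, rfl, M.equiv l y, (M.equiv l y).2, ?_⟩
      rw [cycleFamily_apply, ← hy, M.equiv_d]
  · rintro (h | ⟨l, rfl, η, hη, h⟩)
    · exact ⟨0, by rw [map_zero, hz h]⟩
    · rw [(ComplexShape.up ℕ).prev_eq' (show (ComplexShape.up ℕ).Rel l (l + 1) from rfl)]
      obtain ⟨y, hy⟩ := (M.equiv l).surjective ⟨η, hη⟩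
      refine ⟨y, (M.equiv (l + 1)).injective (Subtype.ext ?_)⟩
      rw [M.equiv_d, hy, ← h, cycleFamily_apply]

end FamilyModel

theorem homologyπ_surjective (K : CochainComplex (ModuleCat ℂ) ℕ) (m : ℕ) :
    Function.Surjective (K.homologyπ m) :=
  (ModuleCat.epi_iff_surjective _).1 inferInstance

/-! ### The inclusion of the torus complexes on homology -/

/-- The tautological identification of the Čech–de Rham complex. -/
def cechModel (n : ℕ) : FamilyModel (cechDeRham n) (cochains n) := totalComplexModel _ _

/-- The tautological identification of the total complex of the torus complexes. -/
def torusModel (n : ℕ) : FamilyModel (torusTotal n) (torusCochains n) := totalComplexModel _ _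

theorem cycleFamily_cyclesMap {m : ℕ} (z : (torusTotal n).cycles m) :
    (cechModel n).cycleFamily m
      (HomologicalComplex.cyclesMap (torusInclusion n) m z) =
    (torusModel n).cycleFamily m z := by
  have h : (cechDeRham n).iCycles m (HomologicalComplex.cyclesMap (torusInclusion n) m z) =
      (torusInclusion n).f m ((torusTotal n).iCycles m z) := by
    rw [← ModuleCat.comp_apply, HomologicalComplex.cyclesMap_i, ModuleCat.comp_apply]
  exact congrArg (cochains n m).subtype h

theorem homologyMap_π {m : ℕ} (z : (torusTotal n).cycles m) :
    HomologicalComplex.homologyMap (torusInclusion n) m ((torusTotal n).homologyπ m z) =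
      (cechDeRham n).homologyπ m (HomologicalComplex.cyclesMap (torusInclusion n) m z) := by
  rw [← ModuleCat.comp_apply, HomologicalComplex.homologyπ_naturality, ModuleCat.comp_apply]

theorem homologyMap_surjective (n m : ℕ) :
    Function.Surjective (HomologicalComplex.homologyMap (torusInclusion n) m) := by
  intro c
  obtain ⟨w, rfl⟩ := homologyπ_surjective _ _ c
  obtain ⟨τ, hτ, hd, h⟩ := exists_torus_cohomologous
    ((cechModel n).cycleFamily_mem w)
    ((cechModel n).totalD_cycleFamily w)
  obtain ⟨z, hz⟩ := (torusModel n).exists_cycleFamily_eq hτ hd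
  refine ⟨(torusTotal n).homologyπ m z, ?_⟩
  rw [homologyMap_π, eq_comm, ← sub_eq_zero, ← map_sub]
  refine ((cechModel n).homologyπ_eq_zero_iff _).2 ?_
  rw [map_sub, cycleFamily_cyclesMap, hz]
  rcases h with h | ⟨l, hl, η, hη, h⟩
  · exact Or.inl (sub_eq_zero.2 h)
  · exact Or.inr ⟨l, hl, η, hη, sub_eq_of_eq_add' h⟩

theorem homologyMap_injective (n m : ℕ) :
    Function.Injective (HomologicalComplex.homologyMap (torusInclusion n) m) := by
  refine (injective_iff_map_eq_zero _).2 fun c hc => ?_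
  obtain ⟨z, rfl⟩ := homologyπ_surjective _ _ c
  rw [homologyMap_π] at hc
  have h := ((cechModel n).homologyπ_eq_zero_iff _).1 hc
  rw [cycleFamily_cyclesMap] at h
  refine ((torusModel n).homologyπ_eq_zero_iff _).2 ?_
  rcases h with h | ⟨l, rfl, η, hη, h⟩
  · exact Or.inl h
  · obtain ⟨σ, hσ, h'⟩ := exists_torus_totalD_eq ((torusModel n).cycleFamily_mem z) hη h
    exact Or.inr ⟨l, rfl, σ, hσ, h'⟩

theorem quasiIso_torusInclusion (n : ℕ) : QuasiIso (torusInclusion n) := by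
  rw [quasiIso_iff]
  intro m
  rw [quasiIsoAt_iff_isIso_homologyMap]
  exact (ConcreteCategory.isIso_iff_bijective _).2
    ⟨homologyMap_injective n m, homologyMap_surjective n m⟩

/-! ### The classes of the families c_k -/

theorem exists_chernCycle (n k : ℕ) : ∃ z : (torusTotal n).cycles (2 * k),
    (torusTotal n).iCycles (2 * k) z = chernCochain n k :=
  (torusModel n).exists_iCycles_eq (x := chernCochain n k) (totalD_chernFamily n k)

theorem cycleFamily_of_iCycles {k : ℕ} {z : (torusTotal n).cycles (2 * k)}
    (h : (torusTotal n).iCycles (2 * k) z = chernCochain n k) :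
    (torusModel n).cycleFamily (2 * k) z = chernFamily n k :=
  congrArg (torusCochains n (2 * k)).subtype h

theorem span_homologyπ_chern {k : ℕ} {z : (torusTotal n).cycles (2 * k)}
    (hz : (torusTotal n).iCycles (2 * k) z = chernCochain n k) :
    Submodule.span ℂ {(torusTotal n).homologyπ (2 * k) z} = ⊤ := by
  refine eq_top_iff.2 fun c _ => ?_
  obtain ⟨w, rfl⟩ := homologyπ_surjective _ _ c
  obtain ⟨k', a, ha, h⟩ := exists_smul_chernFamily_add
    ((torusModel n).cycleFamily_mem w)
    ((torusModel n).totalD_cycleFamily w)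
  -- The index k' is either forced by the degree or irrelevant because its coefficient is zero.
  have ha' : a • chernFamily n k' = a • chernFamily n k := by
    rcases ha with rfl | ha
    · rw [zero_smul, zero_smul]
    · rw [show k' = k by omega]
  rw [ha'] at h
  refine Submodule.mem_span_singleton.2 ⟨a, ?_⟩
  rw [eq_comm, ← sub_eq_zero, ← map_smul, ← map_sub]
  refine ((torusModel n).homologyπ_eq_zero_iff _).2 ?_
  rw [map_sub, map_smul, cycleFamily_of_iCycles hz]
  rcases h with h | ⟨l, hl, σ, hσ, h⟩
  · exact Or.inl (sub_eq_zero.2 h)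
  · exact Or.inr ⟨l, hl, σ, hσ, sub_eq_of_eq_add' h⟩

theorem homologyπ_chern_ne_zero {k : ℕ} (hk : k ≤ n) {z : (torusTotal n).cycles (2 * k)}
    (hz : (torusTotal n).iCycles (2 * k) z = chernCochain n k) :
    (torusTotal n).homologyπ (2 * k) z ≠ 0 := by
  intro h
  have h := ((torusModel n).homologyπ_eq_zero_iff _).1 h
  rw [cycleFamily_of_iCycles hz, ← one_smul ℂ (chernFamily n k)] at h
  exact one_ne_zero (eq_zero_of_smul_chernFamily hk h)

theorem span_homologyMap_chern {k : ℕ} {z : (torusTotal n).cycles (2 * k)}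
    (hz : (torusTotal n).iCycles (2 * k) z = chernCochain n k) :
    Submodule.span ℂ {HomologicalComplex.homologyMap (torusInclusion n) (2 * k)
      ((torusTotal n).homologyπ (2 * k) z)} = ⊤ := by
  have h := congrArg (Submodule.map
    (HomologicalComplex.homologyMap (torusInclusion n) (2 * k)).hom) (span_homologyπ_chern hz)
  rw [Submodule.map_span, Set.image_singleton, Submodule.map_top,
    LinearMap.range_eq_top.2 (homologyMap_surjective n (2 * k))] at h
  exact h

theorem finrank_homology {k : ℕ} (hk : k ≤ n) :
    Module.finrank ℂ ((cechDeRham n).homology (2 * k)) = 1 := by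
  obtain ⟨z, hz⟩ := exists_chernCycle n k
  refine (finrank_eq_one_iff_of_nonzero _ fun h => homologyπ_chern_ne_zero hk hz ?_).2
    (span_homologyMap_chern hz)
  exact homologyMap_injective n (2 * k) (h.trans (map_zero _).symm)

theorem subsingleton_homology {m : ℕ} (hm : ∀ k ≤ n, m ≠ 2 * k) :
    Subsingleton ((cechDeRham n).homology m) := by
  refine subsingleton_of_forall_eq 0 fun c => ?_
  obtain ⟨c, rfl⟩ := homologyMap_surjective n m c
  obtain ⟨w, rfl⟩ := homologyπ_surjective _ _ c
  obtain ⟨k, a, ha, h⟩ := exists_smul_chernFamily_add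
    ((torusModel n).cycleFamily_mem w)
    ((torusModel n).totalD_cycleFamily w)
  -- In an even degree above 2n the family itself vanishes: no I has more than n + 1 elements.
  have ha' : a • chernFamily n k = 0 := by
    rcases ha with rfl | ha
    · rw [zero_smul]
    · rw [chernFamily_eq_zero (lt_of_not_ge fun hk => hm k hk ha), smul_zero]
  rw [ha'] at h
  simp only [zero_add] at h
  have h0 := ((torusModel n).homologyπ_eq_zero_iff w).2 h
  exact (congrArg _ h0).trans (map_zero _)

end CechDeRham

end

/-- The algebraic Čech–de Rham cohomology of `ℙⁿ` for the cover by the standard charts is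
one-dimensional in the degrees `0, 2, …, 2n` and zero in all others; the total complex of the torus
complexes (whose terms are direct sums of lines spanned by products of logarithmic forms) is
quasi-isomorphic to the Čech–de Rham complex under the inclusion; and `c_k` is a cocycle whose class
generates the cohomology in degree `2k`. -/
theorem mainTheorem6 (n : ℕ) :
    (∀ k ≤ n, Module.finrank ℂ ((CechDeRham.cechDeRham n).homology (2 * k)) = 1) ∧
    (∀ m, (∀ k ≤ n, m ≠ 2 * k) → Subsingleton ((CechDeRham.cechDeRham n).homology m)) ∧
    (∀ (I : Finset (Fin (n + 1))) (i₀ : Fin (n + 1)), IsLeast (I : Set (Fin (n + 1))) i₀ →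
      LinearIndependent ℂ
        (fun K : {K : Finset (Fin (n + 1)) // K ⊆ I.erase i₀} => CechDeRham.dlogProd I i₀ K)) ∧
    QuasiIso (CechDeRham.torusInclusion n) ∧
    (∀ k ≤ n, ∃ z : (CechDeRham.torusTotal n).cycles (2 * k),
      (CechDeRham.torusTotal n).iCycles (2 * k) z = CechDeRham.chernCochain n k ∧
      Submodule.span ℂ {HomologicalComplex.homologyMap (CechDeRham.torusInclusion n) (2 * k)
        ((CechDeRham.torusTotal n).homologyπ (2 * k) z)} = ⊤) := by
  exact ⟨fun k hk => CechDeRham.finrank_homology hk, fun m hm => CechDeRham.subsingleton_homology hm,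
    fun I i₀ h₀ => CechDeRham.linearIndependent_dlogProd h₀, CechDeRham.quasiIso_torusInclusion n,
    fun k _ => (CechDeRham.exists_chernCycle n k).imp fun z hz =>
      ⟨hz, CechDeRham.span_homologyMap_chern hz⟩⟩
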